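/- Let $M>0$, let $X=\mathbb R/M\mathbb Z$, and for real $s\ge 0$ let $H^s=H^s(X)$ be the Sobolev space of real-valued $M$-periodic functions, with norm $\|f\|_{H^s}^2=M\sum_{k\in\mathbb Z}\bigl(1+(2\pi k/M)^2\bigr)^s|\hat f(k)|^2$, where $\hat f(k)=\frac1M\int_0^M f(x)e^{-2\pi i kx/M}\,dx$ (for integer $s=n$ this is $W^{n,2}(X)$ up to an equivalent norm); for $s>1/2$, elements of $H^s$ are identified with their continuous representatives. Let $n\ge 4$ be an integer and $a_0>0$. For $T>0$ and $u_0\in H^n$, a solution on $[0,T]$ with data $u_0$ means a function $u\in C([0,T];H^n)$ with $u(\cdot,0)=u_0$ that satisfies the Harry Dym equation $$u_t=u^3u_{xxx}$$ pointwise on $X\times[0,T]$ (with one-sided time derivatives at $t=0$ and $t=T$). Theorem. Let $u_0\in H^n$ satisfy $u_0(x)>a_0$ for all $x\in X$. Then there exist $T>0$ and a solution $u\in C([0,T];H^n)$ on $[0,T]$ with data $u_0$ such that $u(x,t)>a_0/2$ for all $x\in X$ and $t\in[0,T]$, and $u$ is the only solution in $C([0,T];H^n)$ on $[0,T]$ with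 data $u_0$. Moreover, for this $T$, for every real $n'$ with $0\le n'<n$ and every $\epsilon>0$ there exists $\delta>0$ such that for every $v_0\in H^n$ with $v_0(x)>a_0$ for all $x\in X$ and $\|v_0-u_0\|_{H^n}\le\delta$, there is exactly one solution $v\in C([0,T];H^n)$ on $[0,T]$ with data $v_0$, and it satisfies $$\sup_{t\in[0,T]}\|u(\cdot,t)-v(\cdot,t)\|_{H^{n'}}<\epsilon.$$ -/

import Mathlib

open scoped ENNReal Topology

/-- The norm of the periodic Sobolev space `H^s(X)`, `s ≥ 0` real, on the periodic interval
`X = ℝ / Mℤ`: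
`‖f‖² = M · ∑_{k ∈ ℤ} (1 + (2πk/M)²)^s |f̂(k)|²`, with values in `[0, ∞]`, where
`f̂(k) = M⁻¹ ∫_0^M f(x) exp(-2πikx/M) dx`. For `s = 0` this is the norm of `L²(0, M)`, and for
`s = n` a natural number it is equivalent to the norm of `W^{n,2}`. -/
noncomputable def sobolevENorm {M : ℝ} [Fact (0 < M)] (s : ℝ) (f : AddCircle M → ℝ) : ℝ≥0∞ :=
  (∑' k : ℤ, ENNReal.ofReal (M * (1 + (2 * Real.pi * k / M) ^ 2) ^ s) *
    ‖fourierCoeff (fun x : AddCircle M => (f x : ℂ)) k‖ₑ ^ 2) ^ (1 / 2 : ℝ)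

/-- `f ∈ H^s(X)` for `s ≥ 0`: `f` is square integrable and its `H^s` norm is finite. -/
def MemSobolev {M : ℝ} [Fact (0 < M)] (s : ℝ) (f : AddCircle M → ℝ) : Prop :=
  MeasureTheory.MemLp f 2 MeasureTheory.volume ∧ sobolevENorm s f < ∞

/-- `u ∈ C([0,T]; H^s)`. Only the values `u t` for `t ∈ [0,T]` matter, and for `s > 1/2` each
element of `H^s` is identified with its continuous representative. -/
def ContinuousIntoSobolev {M : ℝ} [Fact (0 < M)] (s T : ℝ) (u : ℝ → C(AddCircle M, ℝ)) : Prop :=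
  (∀ t ∈ Set.Icc 0 T, MemSobolev s (u t)) ∧
  ∀ t ∈ Set.Icc 0 T,
    Filter.Tendsto (fun r => sobolevENorm s (u r - u t)) (𝓝[Set.Icc 0 T] t) (𝓝 0)

/-- `u ∈ C([0,T]; H^n)` solves the Harry Dym equation `u_t = u³ u_xxx` on `X × [0,T]` with
`u(·,0) = u₀`. For `n ≥ 4` every `u t` is of class `C³`, and the equation is meant pointwise, with
one-sided time derivatives at the two ends of `[0,T]`. -/
structure IsHarryDymSolution {M : ℝ} [Fact (0 < M)] (n : ℕ) (T : ℝ) (u₀ : C(AddCircle M, ℝ))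
    (u : ℝ → C(AddCircle M, ℝ)) : Prop where
  continuousInto : ContinuousIntoSobolev n T u
  initial : u 0 = u₀
  equation : ∀ t ∈ Set.Icc 0 T, ∀ x : ℝ,
    HasDerivWithinAt (fun r => u r (x : AddCircle M))
      ((u t (x : AddCircle M)) ^ 3 * iteratedDeriv 3 (fun y : ℝ => u t (y : AddCircle M)) x)
      (Set.Icc 0 T) t

/-! Apply `∂ⁿ` to the equation and pair it with `w = ∂ⁿu`: the right-hand side contains `u³ ∂³w + n
(u³)' ∂²w`, which an unweighted energy does not control. With the weight `u^(2n-3)` the two terms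
combine, by the identity `avg_dispersive`, into one quadratic in `w` without derivatives. Hence the
mean of `u^(2n-3) (∂ⁿu)²`, which controls the top Sobolev seminorm while `u` is bounded below, grows
at a bounded rate (`exists_dispersive_bound`).

The approximations are trigonometric polynomials of degree `m⁴` solving the projected equation with
viscosity `m⁻³ ∂⁴`. The projection does not commute with the weight. The resulting error is `O(m⁻⁴)`
times the squared norm of `∂ⁿ⁺²u`, up to bounded terms, and the viscosity absorbs it for large `m`
(`exists_energy_rate`); yet the viscosity still vanishes uniformly as `m → ∞`
(`exists_residual_bound`). A continuity argument then gives a time and bounds depending only on the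
lower bound and the size of the data (`exists_galerkin`).

Two approximate solutions `U`, `V` are compared in `L²` with weight `U⁻³`. It turns `U³ ∂³(U - V)`
into the skew term `∂³(U - V)`, and Gronwall's inequality gives `exists_stability`. Smallness in
`L²` interpolates against the `H⁴` bound to smallness in `C³`, so the approximations converge in
`C³` uniformly in time and the limit solves the equation (`exists_limit`, `exists_local`). The same
estimate gives uniqueness, since any competitor is bounded in `H^n` by compactness of `[0,T]`.

The `H^n` bound passes to the limit by lower semicontinuity; continuity in `H^n` needs more. The
weighted energy of the approximations grows by at most `C t`, and their low frequencies move little,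
which together force closeness to the data in `H^n` for small `t`, uniformly in `m`
(`exists_sobLe_sub`). This is continuity from the right at time zero. Restarting at `t₀` and using
uniqueness gives it at every time; the symmetry `(x,t) ↦ (-x,-t)` gives continuity from the left.

All data in a unit ball of `H^n` above the same lower bound share one `T`. Lipschitz dependence in
`L²` and the common `H^n` bound interpolate to continuous dependence in every `H^{n'}` with `n' <
n`. -/

namespace HarryDym

set_option linter.unusedSectionVars false

open MeasureTheory

variable {M : ℝ} [hM : Fact (0 < M)]

/-! ### Means and derivatives of continuous periodic functions -/

/-- The mean value of a continuous function over one period. -/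
noncomputable def avg : C(AddCircle M, ℝ) →L[ℝ] ℝ :=
  LinearMap.mkContinuous
    { toFun := fun f => ∫ x, f x ∂AddCircle.haarAddCircle
      map_add' := fun f g => by
        simp only [ContinuousMap.add_apply]
        exact integral_add (f.continuous.integrable_of_hasCompactSupport
          (HasCompactSupport.of_compactSpace _)) (g.continuous.integrable_of_hasCompactSupport
          (HasCompactSupport.of_compactSpace _))
      map_smul' := fun c f => by
        simp only [ContinuousMap.smul_apply, RingHom.id_apply]
        exact integral_smul _ _ } 1 (fun f => by
      simp only [LinearMap.coe_mk, AddHom.coe_mk, one_mul]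
      refine (norm_integral_le_of_norm_le_const
        (Filter.Eventually.of_forall fun x => f.norm_coe_le_norm x)).trans ?_
      simp)

theorem avg_apply (f : C(AddCircle M, ℝ)) : avg f = ∫ x, f x ∂AddCircle.haarAddCircle := rfl

theorem integrable_haar (f : C(AddCircle M, ℝ)) : Integrable f AddCircle.haarAddCircle :=
  f.continuous.integrable_of_hasCompactSupport (HasCompactSupport.of_compactSpace _)

theorem avg_mono {f g : C(AddCircle M, ℝ)} (h : ∀ x, f x ≤ g x) : avg f ≤ avg g :=
  integral_mono (integrable_haar f) (integrable_haar g) h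

theorem avg_nonneg {f : C(AddCircle M, ℝ)} (h : ∀ x, 0 ≤ f x) : 0 ≤ avg f :=
  integral_nonneg h

theorem avg_const (c : ℝ) : avg (ContinuousMap.const (AddCircle M) c) = c := by
  simp [avg_apply]

theorem abs_avg_le (f : C(AddCircle M, ℝ)) : |avg f| ≤ ‖f‖ := by
  refine (norm_integral_le_of_norm_le_const
        (Filter.Eventually.of_forall fun x => f.norm_coe_le_norm x)).trans ?_
  simp

theorem apply_le_norm (f : C(AddCircle M, ℝ)) (x : AddCircle M) : f x ≤ ‖f‖ :=
  (le_abs_self _).trans (f.norm_coe_le_norm x)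

theorem norm_le_of_forall {f : C(AddCircle M, ℝ)} {C : ℝ} (h : ∀ x, |f x| ≤ C) : ‖f‖ ≤ C :=
  (ContinuousMap.norm_le _ ((abs_nonneg _).trans (h 0))).2 h

theorem avg_eq_interval (f : C(AddCircle M, ℝ)) (a : ℝ) :
    M * avg f = ∫ x in a..a + M, f (x : AddCircle M) := by
  rw [AddCircle.intervalIntegral_preimage M a (fun x => f x), AddCircle.volume_eq_smul_haarAddCircle,
    integral_smul_measure, avg_apply, ENNReal.toReal_ofReal hM.out.le, smul_eq_mul]

/-- `g` is the derivative of `f`. -/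
def IsDeriv (f g : C(AddCircle M, ℝ)) : Prop :=
  ∀ x : ℝ, HasDerivAt (fun y : ℝ => f (y : AddCircle M)) (g (x : AddCircle M)) x

namespace IsDeriv

variable {f f' g g' : C(AddCircle M, ℝ)}

theorem unique (h : IsDeriv f f') (h' : IsDeriv f g) : f' = g := by
  ext x
  induction x using QuotientAddGroup.induction_on with
  | H x => exact (h x).unique (h' x)

theorem add (hf : IsDeriv f f') (hg : IsDeriv g g') : IsDeriv (f + g) (f' + g') :=
  fun x => (hf x).add (hg x)

theorem sub (hf : IsDeriv f f') (hg : IsDeriv g g') : IsDeriv (f - g) (f' - g') :=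
  fun x => (hf x).sub (hg x)

theorem smul (c : ℝ) (hf : IsDeriv f f') : IsDeriv (c • f) (c • f') :=
  fun x => (hf x).const_smul c

theorem mul (hf : IsDeriv f f') (hg : IsDeriv g g') : IsDeriv (f * g) (f' * g + f * g') :=
  fun x => (hf x).mul (hg x)

theorem pow (hf : IsDeriv f f') (k : ℕ) : IsDeriv (f ^ k) (k * f ^ (k - 1) * f') :=
  fun x => by simpa using (hf x).fun_pow k

theorem zero : IsDeriv (0 : C(AddCircle M, ℝ)) 0 := fun x => hasDerivAt_const x 0

theorem one : IsDeriv (1 : C(AddCircle M, ℝ)) 0 := fun x => hasDerivAt_const x 1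

theorem sum {ι : Type*} {s : Finset ι} {F F' : ι → C(AddCircle M, ℝ)}
    (h : ∀ i ∈ s, IsDeriv (F i) (F' i)) : IsDeriv (∑ i ∈ s, F i) (∑ i ∈ s, F' i) := by
  classical
  induction s using Finset.induction_on with
  | empty => simpa using zero
  | insert a s ha ih =>
    rw [Finset.sum_insert ha, Finset.sum_insert ha]
    exact (h a (by simp)).add (ih fun i hi => h i (by simp [hi]))

theorem natCast_mul (k : ℕ) (hf : IsDeriv f f') : IsDeriv ((k : C(AddCircle M, ℝ)) * f) (k * f') := by
  have h := hf.smul (k : ℝ)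
  simpa [Nat.cast_smul_eq_nsmul] using h

theorem sub_eq_integral (h : IsDeriv f g) (a b : ℝ) :
    f (b : AddCircle M) - f (a : AddCircle M) = ∫ x in a..b, g (x : AddCircle M) := by
  rw [intervalIntegral.integral_eq_sub_of_hasDerivAt (f := fun y : ℝ => f (y : AddCircle M))
    (fun x _ => h x)]
  exact (by fun_prop : Continuous fun x : ℝ => g (x : AddCircle M)).intervalIntegrable _ _

theorem avg_eq_zero (h : IsDeriv f g) : avg g = 0 := by
  have h1 := avg_eq_interval g 0
  rw [← h.sub_eq_integral] at h1
  have h2 : ((0 + M : ℝ) : AddCircle M) = ((0 : ℝ) : AddCircle M) := by simp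
  rw [h2, sub_self] at h1
  exact (mul_eq_zero.1 h1).resolve_left hM.out.ne'

theorem by_parts (hf : IsDeriv f f') (hg : IsDeriv g g') : avg (f' * g) = - avg (f * g') := by
  have := (hf.mul hg).avg_eq_zero
  rw [map_add] at this
  linarith

theorem of_tendsto {F F' : ℕ → C(AddCircle M, ℝ)} (h : ∀ m, IsDeriv (F m) (F' m))
    (hf : Filter.Tendsto F Filter.atTop (𝓝 f)) (hf' : Filter.Tendsto F' Filter.atTop (𝓝 f')) :
    IsDeriv f f' := by
  refine fun x => hasDerivAt_of_tendstoUniformly (l := Filter.atTop)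
    (f := fun m (y : ℝ) => F m (y : AddCircle M)) (f' := fun m (y : ℝ) => F' m (y : AddCircle M))
    (g' := fun y : ℝ => f' (y : AddCircle M)) ?_
    (Filter.Eventually.of_forall fun m y => h m y) ?_ x
  · exact (ContinuousMap.tendsto_iff_tendstoUniformly.1 hf').comp _
  · intro y
    exact ((ContinuousMap.tendsto_iff_tendstoUniformly.1 hf).tendsto_at _)

/-- The points lift to `a ≤ b < a + M`, and the integral of `|g|` over `[a, b]` is at most that over
a full period. -/
theorem abs_sub_le (h : IsDeriv f g) (x y : AddCircle M) : |f x - f y| ≤ M * avg |g| := by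
  induction y using QuotientAddGroup.induction_on with
  | H a =>
  obtain ⟨b, hb, rfl⟩ : ∃ b ∈ Set.Ico a (a + M), ((b : ℝ) : AddCircle M) = x := by
    have := AddCircle.coe_image_Ico_eq M a
    have hx : x ∈ (Set.univ : Set (AddCircle M)) := trivial
    rw [← this] at hx
    exact hx
  have hc : Continuous fun x : ℝ => |g (x : AddCircle M)| := by fun_prop
  rw [h.sub_eq_integral a b, avg_eq_interval _ a]
  calc |∫ x in a..b, g (x : AddCircle M)| ≤ ∫ x in a..b, |g (x : AddCircle M)| :=
        intervalIntegral.abs_integral_le_integral_abs hb.1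
    _ ≤ ∫ x in a..a + M, |g (x : AddCircle M)| := by
        refine intervalIntegral.integral_mono_interval le_rfl hb.1 hb.2.le ?_ ?_
        · exact Filter.Eventually.of_forall fun x => abs_nonneg _
        · exact hc.intervalIntegrable _ _
    _ = _ := rfl

/-- The oscillation bound `abs_sub_le` puts the mean within `M * avg |g|` of every value. This is
the embedding of `W^{1,1}` in `C`, from which all sup bounds below descend. -/
theorem norm_le_abs_avg (h : IsDeriv f g) : ‖f‖ ≤ |avg f| + M * avg |g| := by
  refine norm_le_of_forall fun x => ?_
  have h1 : |f x - avg f| ≤ M * avg |g| := by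
    have e1 : avg f ≤ f x + M * avg |g| := by
      rw [← avg_const (M := M) (f x + M * avg |g|)]
      refine avg_mono fun y => ?_
      have := (abs_le.1 (h.abs_sub_le x y)).1
      simp only [ContinuousMap.const_apply]; linarith
    have e2 : f x - M * avg |g| ≤ avg f := by
      rw [← avg_const (M := M) (f x - M * avg |g|)]
      refine avg_mono fun y => ?_
      have := (abs_le.1 (h.abs_sub_le x y)).2
      simp only [ContinuousMap.const_apply]; linarith
    rw [abs_le]; constructor <;> linarith
  have := abs_sub_abs_le_abs_sub (f x) (avg f)
  linarith

end IsDeriv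

/-! ### The `L²` norm and one-dimensional Sobolev inequalities -/

/-- The normalized `L²` norm. -/
noncomputable def N2 (f : C(AddCircle M, ℝ)) : ℝ := Real.sqrt (avg (f * f))

theorem avg_mul_self_nonneg (f : C(AddCircle M, ℝ)) : 0 ≤ avg (f * f) :=
  avg_nonneg fun x => mul_self_nonneg (f x)

theorem N2_nonneg (f : C(AddCircle M, ℝ)) : 0 ≤ N2 f := Real.sqrt_nonneg _

theorem N2_sq (f : C(AddCircle M, ℝ)) : N2 f ^ 2 = avg (f * f) :=
  Real.sq_sqrt (avg_mul_self_nonneg f)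

/-- Cauchy–Schwarz, from the discriminant of the nonnegative quadratic `t ↦ avg ((t|g| - |f|)²)`. -/
theorem avg_abs_mul_le (f g : C(AddCircle M, ℝ)) : avg |f * g| ≤ N2 f * N2 g := by
  have key : ∀ t : ℝ, 0 ≤ avg (g * g) * (t * t) + (-2 * avg |f * g|) * t + avg (f * f) := by
    intro t
    have h := avg_nonneg (M := M) (f := (t * t) • (g * g) + (-2 * t) • |f * g| + f * f) (fun x => by
      simp only [ContinuousMap.add_apply, ContinuousMap.smul_apply, ContinuousMap.mul_apply,
        ContinuousMap.abs_apply, smul_eq_mul]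
      have := sq_nonneg (t * |g x| - |f x|)
      rw [abs_mul]
      nlinarith [abs_mul_abs_self (f x), abs_mul_abs_self (g x)])
    simp only [map_add, map_smul, smul_eq_mul] at h
    linarith
  have hd := discrim_le_zero key
  have h0 : 0 ≤ avg |f * g| := avg_nonneg fun x => abs_nonneg _
  unfold discrim at hd
  rw [N2, N2, ← Real.sqrt_mul (avg_mul_self_nonneg f)]
  apply Real.le_sqrt_of_sq_le
  nlinarith

theorem abs_avg_le_avg_abs (f : C(AddCircle M, ℝ)) : |avg f| ≤ avg (|f|) := by
  rw [abs_le]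
  constructor
  · rw [← map_neg]
    have : avg (-|f|) ≤ avg f := avg_mono fun x => neg_abs_le (f x)
    rwa [map_neg] at this ⊢
  · exact avg_mono fun x => le_abs_self (f x)

theorem abs_avg_mul_le (f g : C(AddCircle M, ℝ)) : |avg (f * g)| ≤ N2 f * N2 g :=
  (abs_avg_le_avg_abs _).trans (avg_abs_mul_le f g)

theorem N2_smul (c : ℝ) (f : C(AddCircle M, ℝ)) : N2 (c • f) = |c| * N2 f := by
  rw [N2, N2, smul_mul_smul_comm, map_smul, smul_eq_mul, Real.sqrt_mul (mul_self_nonneg c),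
    Real.sqrt_mul_self_eq_abs]

theorem N2_neg (f : C(AddCircle M, ℝ)) : N2 (-f) = N2 f := by simp [N2]

theorem N2_sub_comm (f g : C(AddCircle M, ℝ)) : N2 (f - g) = N2 (g - f) := by
  rw [← N2_neg, neg_sub]

theorem N2_zero : N2 (0 : C(AddCircle M, ℝ)) = 0 := by simp [N2]

theorem N2_add_le (f g : C(AddCircle M, ℝ)) : N2 (f + g) ≤ N2 f + N2 g := by
  refine Real.sqrt_le_iff.2 ⟨add_nonneg (N2_nonneg f) (N2_nonneg g), ?_⟩
  have h1 : avg ((f + g) * (f + g)) = avg (f * f) + 2 * avg (f * g) + avg (g * g) := by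
    rw [show (f + g) * (f + g) = f * f + (2 : ℝ) • (f * g) + g * g by
      ext x; simp; ring]
    simp only [map_add, map_smul, smul_eq_mul]
  have := (le_abs_self _).trans (abs_avg_mul_le f g)
  rw [h1, ← N2_sq, ← N2_sq]
  nlinarith

theorem N2_sub_le (f g : C(AddCircle M, ℝ)) : N2 (f - g) ≤ N2 f + N2 g := by
  rw [sub_eq_add_neg, ← N2_neg g]; exact N2_add_le _ _

theorem N2_sum_le {ι : Type*} (s : Finset ι) (F : ι → C(AddCircle M, ℝ)) :
    N2 (∑ i ∈ s, F i) ≤ ∑ i ∈ s, N2 (F i) := by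
  classical
  induction s using Finset.induction_on with
  | empty => simp [N2_zero]
  | insert a s ha ih =>
    rw [Finset.sum_insert ha, Finset.sum_insert ha]
    exact (N2_add_le _ _).trans (by linarith)

theorem N2_mul_le (f g : C(AddCircle M, ℝ)) : N2 (f * g) ≤ ‖f‖ * N2 g := by
  refine Real.sqrt_le_iff.2 ⟨mul_nonneg (norm_nonneg _) (N2_nonneg g), ?_⟩
  rw [mul_pow, N2_sq, ← smul_eq_mul (‖f‖ ^ 2), ← map_smul]
  refine avg_mono fun x => ?_
  have h1 : f x ^ 2 ≤ ‖f‖ ^ 2 := by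
    rw [← sq_abs]
    exact pow_le_pow_left₀ (abs_nonneg _) (f.norm_coe_le_norm x) 2
  simp only [ContinuousMap.mul_apply, ContinuousMap.smul_apply, smul_eq_mul]
  nlinarith [mul_self_nonneg (g x)]

theorem N2_mul_le' (f g : C(AddCircle M, ℝ)) : N2 (f * g) ≤ N2 f * ‖g‖ := by
  rw [mul_comm, mul_comm (N2 f)]; exact N2_mul_le _ _

theorem N2_one : N2 (1 : C(AddCircle M, ℝ)) = 1 := by
  have : avg (1 : C(AddCircle M, ℝ)) = 1 := avg_const 1
  simp [N2, this]

theorem N2_le_norm (f : C(AddCircle M, ℝ)) : N2 f ≤ ‖f‖ := by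
  simpa [N2_one] using N2_mul_le f 1

theorem avg_abs_le (f : C(AddCircle M, ℝ)) : avg |f| ≤ N2 f := by
  simpa [N2_one] using avg_abs_mul_le f 1

theorem abs_avg_le_N2 (f : C(AddCircle M, ℝ)) : |avg f| ≤ N2 f := by
  simpa [N2_one] using abs_avg_mul_le f 1

theorem abs_avg_mul_mul_le (f g k : C(AddCircle M, ℝ)) :
    |avg (f * g * k)| ≤ ‖f‖ * N2 g * N2 k :=
  (abs_avg_mul_le _ _).trans (mul_le_mul_of_nonneg_right (N2_mul_le f g) (N2_nonneg k))

namespace IsDeriv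

variable {f g k : C(AddCircle M, ℝ)}

theorem norm_le (h : IsDeriv f g) : ‖f‖ ≤ N2 f + M * N2 g :=
  h.norm_le_abs_avg.trans (add_le_add (abs_avg_le_N2 f)
    (mul_le_mul_of_nonneg_left (avg_abs_le g) hM.out.le))

theorem norm_le_of_avg_eq_zero (h : IsDeriv f g) (h0 : avg f = 0) : ‖f‖ ≤ M * N2 g := by
  have := h.norm_le_abs_avg.trans (add_le_add le_rfl
    (mul_le_mul_of_nonneg_left (avg_abs_le g) hM.out.le))
  simpa [h0] using this

/-- The `W^{1,1}` bound applied to `f²`. Its point is that `N2 g` enters only to the power one half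
of its size: for frequencies up to `m⁴` a derivative then costs `m²` in the sup norm. -/
theorem norm_sq_le (h : IsDeriv f g) : ‖f‖ ^ 2 ≤ N2 f ^ 2 + 2 * M * (N2 f * N2 g) := by
  have h1 := (h.mul h).norm_le_abs_avg
  have h2 : ‖f * f‖ = ‖f‖ ^ 2 := by
    rw [sq]
    refine le_antisymm (norm_mul_le _ _) ?_
    obtain ⟨x, hx⟩ : ∃ x, |f x| = ‖f‖ := by
      obtain ⟨x, -, hx⟩ := isCompact_univ.exists_isMaxOn (Set.univ_nonempty (α := AddCircle M))
        (f.continuous.abs.continuousOn)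
      exact ⟨x, le_antisymm (f.norm_coe_le_norm x) (norm_le_of_forall fun y => hx (Set.mem_univ y))⟩
    rw [← hx, ← abs_mul]
    exact (f * f).norm_coe_le_norm x
  have h3 : avg |g * f + f * g| = 2 * avg |f * g| := by
    rw [show |g * f + f * g| = (2 : ℝ) • |f * g| by
      ext x; simp only [ContinuousMap.abs_apply, ContinuousMap.add_apply, ContinuousMap.mul_apply,
        ContinuousMap.smul_apply, smul_eq_mul]
      rw [mul_comm (g x), ← two_mul, abs_mul, abs_two]]
    simp
  have h4 := avg_abs_mul_le f g
  rw [h2, h3, abs_of_nonneg (avg_mul_self_nonneg f), ← N2_sq] at h1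
  have := mul_le_mul_of_nonneg_left h4 hM.out.le
  linarith

theorem N2_sq_le (h : IsDeriv f g) (h' : IsDeriv g k) : N2 g ^ 2 ≤ N2 f * N2 k := by
  rw [N2_sq, h.by_parts h']
  exact (neg_le_abs _).trans (abs_avg_mul_le _ _)

end IsDeriv

/-! ### A real Fourier basis, truncation and Bernstein inequalities -/

/-- The wave number `2πk/M`. -/
noncomputable def wn (M : ℝ) (k : ℤ) : ℝ := 2 * Real.pi * k / M

theorem wn_neg (k : ℤ) : wn M (-k) = - wn M k := by simp [wn, neg_div]

theorem wn_sq_le {k : ℤ} {N : ℕ} (hk : k ∈ Finset.Icc (-(N : ℤ)) N) : wn M k ^ 2 ≤ wn M N ^ 2 := by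
  rw [sq_le_sq, wn, wn, abs_div, abs_div, abs_mul, abs_mul (2 * Real.pi)]
  have h : |((k : ℤ) : ℝ)| ≤ |(((N : ℕ) : ℤ) : ℝ)| := by
    rw [← Int.cast_abs, ← Int.cast_abs]
    exact_mod_cast (abs_le.2 (Finset.mem_Icc.1 hk)).trans (le_abs_self _)
  gcongr

theorem le_wn_sq {k : ℤ} {N : ℕ} (hk : k ∉ Finset.Icc (-(N : ℤ)) N) : wn M N ^ 2 ≤ wn M k ^ 2 := by
  rw [sq_le_sq, wn, wn, abs_div, abs_div, abs_mul, abs_mul (2 * Real.pi)]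
  have h : |(((N : ℕ) : ℤ) : ℝ)| ≤ |((k : ℤ) : ℝ)| := by
    rw [← Int.cast_abs, ← Int.cast_abs]
    have : |(N : ℤ)| ≤ |k| := by
      rw [abs_of_nonneg (by positivity : (0:ℤ) ≤ N)]
      by_contra hc
      exact hk (Finset.mem_Icc.2 (abs_le.1 (not_le.1 hc).le))
    exact_mod_cast this
  gcongr

theorem wn_nat_pos {N : ℕ} (hN : 0 < N) : 0 < wn M N := by
  have := hM.out
  have : (0 : ℝ) < N := by exact_mod_cast hN
  unfold wn
  push_cast
  positivity

theorem wn_nat_nonneg (N : ℕ) : 0 ≤ wn M N := by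
  have := hM.out
  unfold wn
  push_cast
  positivity

/-- The real orthonormal system `cos(2πkx/M) + sin(2πkx/M)`. -/
noncomputable def cas (k : ℤ) : C(AddCircle M, ℝ) :=
  ⟨fun x => (fourier k x).re + (fourier k x).im,
    (Complex.continuous_re.comp (fourier k).continuous).add
      (Complex.continuous_im.comp (fourier k).continuous)⟩

theorem cas_apply (k : ℤ) (x : AddCircle M) : cas k x = (fourier k x).re + (fourier k x).im := rfl

/-- Since `cos' = -sin` and `sin' = cos`, the two basis functions of one frequency trade places, so
a single index set serves all derivatives. -/
theorem cas_isDeriv (k : ℤ) : IsDeriv (cas (M := M) k) (wn M k • cas (-k)) := by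
  intro x
  have h := hasDerivAt_fourier M k x
  have h1 := (Complex.reCLM.hasFDerivAt.comp_hasDerivAt x h).add
    (Complex.imCLM.hasFDerivAt.comp_hasDerivAt x h)
  have h0 : (fun y : ℝ => cas k (y : AddCircle M)) =
      (⇑Complex.reCLM ∘ fun y : ℝ => (fourier k : C(AddCircle M, ℂ)) y) +
        ⇑Complex.imCLM ∘ fun y : ℝ => (fourier k : C(AddCircle M, ℂ)) y := by
    funext y
    rw [cas_apply]
    rfl
  rw [h0]
  refine h1.congr_deriv ?_
  have e : (2 * (Real.pi : ℂ) * Complex.I * k / M) = ((wn M k : ℝ) : ℂ) * Complex.I := by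
    unfold wn; push_cast; ring
  rw [e]
  simp only [Complex.reCLM_apply, Complex.imCLM_apply, ContinuousMap.smul_apply, cas_apply,
    fourier_neg, Complex.conj_re, Complex.conj_im, smul_eq_mul, mul_assoc, Complex.ofReal_re,
    Complex.ofReal_im, Complex.mul_re, Complex.mul_im, Complex.I_re, Complex.I_im]
  ring

theorem abs_cas_le (k : ℤ) (x : AddCircle M) : |cas k x| ≤ 2 := by
  have h : ‖fourier k x‖ = 1 := by rw [fourier_apply]; exact Circle.norm_coe _
  rw [cas_apply]
  have h1 := Complex.abs_re_le_norm (fourier k x)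
  have h2 := Complex.abs_im_le_norm (fourier k x)
  have := abs_add_le (fourier k x).re (fourier k x).im
  linarith

theorem norm_cas_le (k : ℤ) : ‖cas (M := M) k‖ ≤ 2 := norm_le_of_forall (abs_cas_le k)

theorem integral_fourier (k : ℤ) :
    ∫ x : AddCircle M, (fourier k x : ℂ) ∂AddCircle.haarAddCircle = if k = 0 then 1 else 0 := by
  have h := congrFun (fourierCoeff_fourier (T := M) k) 0
  simp only [fourierCoeff, neg_zero, fourier_zero, one_smul] at h
  rw [h, Pi.single_apply]
  simp [eq_comm]

theorem integrable_fourier (k : ℤ) :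
    Integrable (fun x : AddCircle M => (fourier k x : ℂ)) AddCircle.haarAddCircle :=
  (fourier k).continuous.integrable_of_hasCompactSupport (HasCompactSupport.of_compactSpace _)

theorem avg_cas_mul (k l : ℤ) : avg (cas (M := M) k * cas l) = if k = l then 1 else 0 := by
  have e : ∀ x : AddCircle M, (cas (M := M) k * cas (M := M) l) x =
      (fourier (k - l) x : ℂ).re + (fourier (k + l) x : ℂ).im := by
    intro x
    rw [sub_eq_add_neg, fourier_add, fourier_add, fourier_neg]
    simp only [ContinuousMap.mul_apply, cas_apply, Complex.mul_re, Complex.mul_im, Complex.conj_re,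
      Complex.conj_im]
    ring
  have h1 := Complex.reCLM.integral_comp_comm (integrable_fourier (M := M) (k - l))
  have h2 := Complex.imCLM.integral_comp_comm (integrable_fourier (M := M) (k + l))
  rw [integral_fourier] at h1 h2
  rw [avg_apply]
  simp_rw [e]
  rw [integral_add]
  · simp only [Complex.reCLM_apply, Complex.imCLM_apply] at h1 h2
    rw [h1, h2]
    have : (if k + l = 0 then (1 : ℂ) else 0).im = 0 := by split_ifs <;> simp
    rw [this, add_zero]
    simp only [sub_eq_zero]
    split_ifs <;> simp
  · exact Complex.reCLM.integrable_comp (integrable_fourier (M := M) (k - l))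
  · exact Complex.imCLM.integrable_comp (integrable_fourier (M := M) (k + l))

/-- The coefficients with respect to the system `cas`. -/
noncomputable def hc (k : ℤ) : C(AddCircle M, ℝ) →L[ℝ] ℝ :=
  avg.comp (ContinuousLinearMap.mul ℝ _ (cas k))

theorem hc_apply (k : ℤ) (f : C(AddCircle M, ℝ)) : hc k f = avg (cas k * f) := rfl

theorem hc_cas (k l : ℤ) : hc k (cas (M := M) l) = if k = l then 1 else 0 := avg_cas_mul k l

theorem abs_hc_le (k : ℤ) (f : C(AddCircle M, ℝ)) : |hc k f| ≤ 2 * ‖f‖ :=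
  (abs_avg_le _).trans ((norm_mul_le _ _).trans
    (mul_le_mul_of_nonneg_right (norm_cas_le k) (norm_nonneg _)))

theorem IsDeriv.hc_eq {f g : C(AddCircle M, ℝ)} (h : IsDeriv f g) (k : ℤ) :
    hc k g = - wn M k * hc (-k) f := by
  rw [hc_apply, hc_apply, mul_comm (cas k), h.by_parts (cas_isDeriv k), mul_smul_comm, map_smul,
    smul_eq_mul, mul_comm f]
  ring

/-- For real `f`, `hc k f` and `hc (-k) f` are the real part of the Fourier coefficient minus and
plus its imaginary part. This links the real basis to the norm in the theorem. -/
theorem norm_sq_fourierCoeff (f : C(AddCircle M, ℝ)) (k : ℤ) :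
    ‖fourierCoeff (fun x : AddCircle M => (f x : ℂ)) k‖ ^ 2 = (hc k f ^ 2 + hc (-k) f ^ 2) / 2 := by
  have hint : Integrable (fun x : AddCircle M => (fourier (-k) x : ℂ) * (f x : ℂ))
      AddCircle.haarAddCircle :=
    Continuous.integrable_of_hasCompactSupport
      ((fourier (-k)).continuous.mul (Complex.continuous_ofReal.comp f.continuous)) (HasCompactSupport.of_compactSpace _)
  have h1 := Complex.reCLM.integral_comp_comm hint
  have h2 := Complex.imCLM.integral_comp_comm hint
  have e1 : hc k f = (fourierCoeff (fun x : AddCircle M => (f x : ℂ)) k).re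
      - (fourierCoeff (fun x : AddCircle M => (f x : ℂ)) k).im := by
    simp only [fourierCoeff, smul_eq_mul]
    rw [← Complex.reCLM_apply, ← Complex.imCLM_apply, ← h1, ← h2, ← integral_sub
      (Complex.reCLM.integrable_comp hint) (Complex.imCLM.integrable_comp hint), hc_apply, avg_apply]
    refine integral_congr_ae (Filter.Eventually.of_forall fun x => ?_)
    simp only [ContinuousMap.mul_apply, cas_apply, Complex.reCLM_apply, Complex.imCLM_apply,
      fourier_neg, Complex.mul_re, Complex.mul_im, Complex.conj_re, Complex.conj_im,
      Complex.ofReal_re, Complex.ofReal_im]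
    ring
  have e2 : hc (-k) f = (fourierCoeff (fun x : AddCircle M => (f x : ℂ)) k).re
      + (fourierCoeff (fun x : AddCircle M => (f x : ℂ)) k).im := by
    simp only [fourierCoeff, smul_eq_mul]
    rw [← Complex.reCLM_apply, ← Complex.imCLM_apply, ← h1, ← h2, ← integral_add
      (Complex.reCLM.integrable_comp hint) (Complex.imCLM.integrable_comp hint), hc_apply, avg_apply]
    refine integral_congr_ae (Filter.Eventually.of_forall fun x => ?_)
    simp only [ContinuousMap.mul_apply, cas_apply, Complex.reCLM_apply, Complex.imCLM_apply,
      fourier_neg, Complex.mul_re, Complex.mul_im, Complex.conj_re, Complex.conj_im,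
      Complex.ofReal_re, Complex.ofReal_im]
    ring
  rw [e1, e2, ← Complex.normSq_eq_norm_sq, Complex.normSq_apply]
  ring

theorem hasSum_comp_neg {F : ℤ → ℝ} {a : ℝ} (h : HasSum F a) : HasSum (fun k => F (-k)) a :=
  (Equiv.neg ℤ).hasSum_iff.2 h

/-- Complex Parseval sums the averages of the terms at `k` and `-k`; the symmetry of the index set
undoes the averaging. -/
theorem hasSum_hc_sq (f : C(AddCircle M, ℝ)) : HasSum (fun k => hc k f ^ 2) (N2 f ^ 2) := by
  let F : C(AddCircle M, ℂ) := ⟨fun x => (f x : ℂ), Complex.continuous_ofReal.comp f.continuous⟩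
  have h := hasSum_sq_fourierCoeff (ContinuousMap.toLp 2 AddCircle.haarAddCircle ℂ F)
  have e1 : ∫ (t : AddCircle M), ‖(ContinuousMap.toLp 2 AddCircle.haarAddCircle ℂ F) t‖ ^ 2
      ∂AddCircle.haarAddCircle = N2 f ^ 2 := by
    rw [N2_sq, avg_apply]
    refine integral_congr_ae ?_
    filter_upwards [ContinuousMap.coeFn_toLp (p := 2) (𝕜 := ℂ) AddCircle.haarAddCircle F] with x hx
    rw [hx]
    simp [F, sq]
  simp_rw [fourierCoeff_toLp] at h
  rw [e1] at h
  have e2 : ∀ k : ℤ, ‖fourierCoeff F k‖ ^ 2 = (hc k f ^ 2 + hc (-k) f ^ 2) / 2 :=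
    norm_sq_fourierCoeff f
  simp_rw [e2] at h
  have hs : Summable (fun k : ℤ => hc k f ^ 2) := by
    have hs := h.summable.mul_left 2
    have hle : ∀ k : ℤ, hc k f ^ 2 ≤ 2 * ((hc k f ^ 2 + hc (-k) f ^ 2) / 2) := fun k => by
      have := sq_nonneg (hc (-k) f)
      linarith
    exact Summable.of_nonneg_of_le (fun k => sq_nonneg (hc k f)) hle hs
  have h1 := hs.hasSum
  have h2 : HasSum (fun k : ℤ => hc (-k) f ^ 2) (∑' k, hc k f ^ 2) :=
    hasSum_comp_neg (F := fun k => hc k f ^ 2) h1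
  have h3 := (h1.add h2).div_const 2
  have h4 := h3.unique h
  rw [← h4, add_self_div_two]
  exact h1

theorem eq_zero_of_N2_eq_zero {f : C(AddCircle M, ℝ)} (h : N2 f = 0) : f = 0 := by
  by_contra hne
  have hf : ∃ x, f x ≠ 0 := by
    by_contra hc
    push Not at hc
    exact hne (ContinuousMap.ext hc)
  obtain ⟨x, hx⟩ := hf
  have h1 : 0 < ∫ y, (f * f : C(AddCircle M, ℝ)) y ∂AddCircle.haarAddCircle :=
    Continuous.integral_pos_of_hasCompactSupport_nonneg_nonzero (f * f).continuous
      (HasCompactSupport.of_compactSpace _) (fun y => mul_self_nonneg (f y))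
      (x := x) (by simpa using hx)
  have h2 := N2_sq f
  rw [h, avg_apply] at h2
  linarith

theorem eq_of_hc_eq {f g : C(AddCircle M, ℝ)} (h : ∀ k, hc k f = hc k g) : f = g := by
  rw [← sub_eq_zero]
  apply eq_zero_of_N2_eq_zero
  have h1 := hasSum_hc_sq (f - g)
  simp only [map_sub, h, sub_self, ne_eq, OfNat.ofNat_ne_zero, not_false_eq_true, zero_pow] at h1
  have h2 := h1.unique hasSum_zero
  exact pow_eq_zero_iff (two_ne_zero) |>.1 h2

/-- The `i`-th derivative of `cas k`. -/
noncomputable def casD : ℕ → ℤ → C(AddCircle M, ℝ)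
  | 0, k => cas k
  | i + 1, k => wn M k • casD i (-k)

theorem casD_isDeriv (i : ℕ) (k : ℤ) : IsDeriv (casD (M := M) i k) (casD (i + 1) k) := by
  induction i generalizing k with
  | zero => exact cas_isDeriv k
  | succ i ih => exact (ih (-k)).smul _

theorem avg_casD_mul (i : ℕ) (k l : ℤ) :
    avg (casD (M := M) i k * casD i l) = if k = l then (wn M k ^ 2) ^ i else 0 := by
  induction i generalizing k l with
  | zero => simpa [casD] using avg_cas_mul k l
  | succ i ih =>
    simp only [casD, smul_mul_smul_comm, map_smul, ih, smul_eq_mul, neg_inj, wn_neg]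
    split_ifs with h
    · subst h; ring
    · simp

/-- Coefficients of real trigonometric polynomials of degree at most `N`. -/
abbrev Coef (N : ℕ) : Type := Finset.Icc (-(N : ℤ)) N → ℝ

/-- The `i`-th derivative of the trigonometric polynomial with given coefficients. -/
noncomputable def trig (N i : ℕ) : Coef N →L[ℝ] C(AddCircle M, ℝ) :=
  ∑ k, (ContinuousLinearMap.proj (R := ℝ) (φ := fun _ : Finset.Icc (-(N : ℤ)) N => ℝ) k).smulRight
    (casD i k.1)

theorem trig_apply (N i : ℕ) (c : Coef N) :
    trig (M := M) N i c = ∑ k, c k • casD i k.1 := by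
  simp [trig]

theorem trig_isDeriv (N i : ℕ) (c : Coef N) : IsDeriv (trig (M := M) N i c) (trig N (i + 1) c) := by
  rw [trig_apply, trig_apply]
  exact IsDeriv.sum fun k _ => (casD_isDeriv i k.1).smul _

theorem N2_trig_sq (N i : ℕ) (c : Coef N) :
    N2 (trig (M := M) N i c) ^ 2 = ∑ k, (wn M k.1 ^ 2) ^ i * c k ^ 2 := by
  rw [N2_sq, trig_apply, Finset.sum_mul_sum, map_sum]
  refine Finset.sum_congr rfl fun k _ => ?_
  rw [map_sum, Finset.sum_eq_single k]
  · rw [smul_mul_smul_comm, map_smul, avg_casD_mul, if_pos rfl, smul_eq_mul]; ring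
  · intro l _ hl
    rw [smul_mul_smul_comm, map_smul, avg_casD_mul, if_neg, smul_zero]
    exact fun h => hl (Subtype.ext h.symm)
  · intro h; exact absurd (Finset.mem_univ k) h

/-- Bernstein's inequality. -/
theorem N2_trig_succ_le (N i : ℕ) (c : Coef N) :
    N2 (trig (M := M) N (i + 1) c) ≤ wn M N * N2 (trig (M := M) N i c) := by
  refine le_of_sq_le_sq ?_ (mul_nonneg (wn_nat_nonneg N) (N2_nonneg _))
  rw [mul_pow, N2_trig_sq, N2_trig_sq, Finset.mul_sum]
  refine Finset.sum_le_sum fun k _ => ?_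
  rw [pow_succ]
  have := mul_le_mul_of_nonneg_left (wn_sq_le (M := M) k.2)
    (by positivity : 0 ≤ (wn M k.1 ^ 2) ^ i * c k ^ 2)
  linarith

/-- Frequency by frequency, with `x = wn M k ^ 2`: `x^(n-1)` is at most `x^n / R` if `x ≥ R`, and at
most `R^(n-1)` otherwise. -/
theorem N2_trig_interp {n : ℕ} (hn : 1 ≤ n) (N : ℕ) (c : Coef N) {R : ℝ} (hR : 0 < R) :
    N2 (trig (M := M) N (n - 1) c) ^ 2 ≤
      R⁻¹ * N2 (trig (M := M) N n c) ^ 2 + R ^ (n - 1) * N2 (trig (M := M) N 0 c) ^ 2 := by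
  rw [N2_trig_sq, N2_trig_sq, N2_trig_sq, Finset.mul_sum, Finset.mul_sum, ← Finset.sum_add_distrib]
  refine Finset.sum_le_sum fun k _ => ?_
  have key : (wn M k.1 ^ 2) ^ (n - 1) ≤ R⁻¹ * (wn M k.1 ^ 2) ^ n + R ^ (n - 1) := by
    have hx := sq_nonneg (wn M k.1)
    generalize wn M k.1 ^ 2 = x at hx
    obtain ⟨n, rfl⟩ : ∃ j, n = j + 1 := ⟨n - 1, by omega⟩
    simp only [Nat.add_sub_cancel]
    rcases le_total R x with h | h
    · have h1 : x ^ n ≤ R⁻¹ * x ^ (n + 1) := by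
        rw [pow_succ, inv_mul_eq_div, le_div_iff₀ hR]
        exact mul_le_mul_of_nonneg_left h (by positivity)
      have : 0 ≤ R ^ n := by positivity
      linarith
    · have h1 := pow_le_pow_left₀ hx h n
      have : 0 ≤ R⁻¹ * x ^ (n + 1) := by positivity
      linarith
  have := mul_le_mul_of_nonneg_right key (sq_nonneg (c k))
  simp only [pow_zero, one_mul]
  linarith

/-- The low-frequency coefficients. -/
noncomputable def coef (N : ℕ) : C(AddCircle M, ℝ) →L[ℝ] Coef N :=
  ContinuousLinearMap.pi fun k => hc k.1

theorem coef_apply (N : ℕ) (f : C(AddCircle M, ℝ)) (k) : coef N f k = hc k.1 f := rfl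

theorem coef_trig (N : ℕ) (c : Coef N) : coef N (trig (M := M) N 0 c) = c := by
  ext k
  rw [coef_apply, trig_apply, map_sum, Finset.sum_eq_single k]
  · simp [casD, hc_cas]
  · intro l _ hl
    have : k.1 ≠ l.1 := fun h => hl (Subtype.ext h.symm)
    simp [casD, hc_cas, this]
  · intro h; exact absurd (Finset.mem_univ k) h

theorem trig_coef (N i : ℕ) (f : C(AddCircle M, ℝ)) :
    trig N i (coef N f) = ∑ k ∈ Finset.Icc (-(N : ℤ)) N, hc k f • casD (M := M) i k := by
  rw [trig_apply]
  exact Finset.sum_coe_sort (Finset.Icc (-(N : ℤ)) N) fun k => hc k f • casD (M := M) i k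

theorem IsDeriv.trig_coef {f g : C(AddCircle M, ℝ)} (h : IsDeriv f g) (N i : ℕ) :
    trig (M := M) N i (coef N g) = trig N (i + 1) (coef N f) := by
  rw [HarryDym.trig_coef, HarryDym.trig_coef]
  refine Finset.sum_nbij' (fun k => -k) (fun k => -k) ?_ ?_ ?_ ?_ ?_
  · intro k hk; simp only [Finset.mem_Icc] at hk ⊢; omega
  · intro k hk; simp only [Finset.mem_Icc] at hk ⊢; omega
  · simp
  · simp
  · intro k _
    rw [h.hc_eq k, casD, neg_neg, wn_neg, smul_smul, mul_comm]

/-- The projection onto frequencies at most `N`. -/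
noncomputable def proj (N : ℕ) : C(AddCircle M, ℝ) →L[ℝ] C(AddCircle M, ℝ) :=
  (trig N 0).comp (coef N)

theorem proj_apply (N : ℕ) (f : C(AddCircle M, ℝ)) : proj N f = trig N 0 (coef N f) := rfl

theorem IsDeriv.proj {f g : C(AddCircle M, ℝ)} (h : IsDeriv f g) (N : ℕ) :
    IsDeriv (proj N f) (proj N g) := by
  rw [proj_apply, proj_apply, h.trig_coef]
  exact trig_isDeriv N 0 _

theorem hc_proj (N : ℕ) (f : C(AddCircle M, ℝ)) (k : ℤ) :
    hc k (proj N f) = if k ∈ Finset.Icc (-(N : ℤ)) N then hc k f else 0 := by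
  rw [proj_apply, trig_coef, map_sum]
  simp [casD, hc_cas]

theorem avg_proj_mul_sub (N : ℕ) (f g : C(AddCircle M, ℝ)) :
    avg (proj N f * (g - proj N g)) = 0 := by
  rw [proj_apply, trig_coef, Finset.sum_mul, map_sum]
  refine Finset.sum_eq_zero fun k hk => ?_
  rw [smul_mul_assoc, map_smul, casD, ← hc_apply, map_sub, hc_proj, if_pos hk]
  simp

/-- Only the high-frequency part of `f` sees the truncation error of `g`, so a smooth `f`
contributes negative powers of `N`. -/
theorem avg_mul_sub_proj (N : ℕ) (f g : C(AddCircle M, ℝ)) :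
    avg (f * (g - proj N g)) = avg ((f - proj N f) * (g - proj N g)) := by
  rw [sub_mul, map_sub, avg_proj_mul_sub, sub_zero]

theorem N2_sq_eq_add (N : ℕ) (f : C(AddCircle M, ℝ)) :
    N2 f ^ 2 = N2 (f - proj N f) ^ 2 + N2 (proj N f) ^ 2 := by
  have h := avg_proj_mul_sub N f f
  rw [N2_sq, N2_sq, N2_sq]
  have e : f * f = (f - proj N f) * (f - proj N f) + proj N f * proj N f +
      (2 : ℝ) • (proj N f * (f - proj N f)) := by
    ext x; simp; ring
  conv_lhs => rw [e]
  rw [map_add, map_add, map_smul, h]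
  simp

theorem N2_sub_proj_le (N : ℕ) (f : C(AddCircle M, ℝ)) : N2 (f - proj N f) ≤ N2 f := by
  refine le_of_sq_le_sq ?_ (N2_nonneg f)
  rw [N2_sq_eq_add N f]
  linarith [sq_nonneg (N2 (proj N f))]

theorem N2_proj_le (N : ℕ) (f : C(AddCircle M, ℝ)) : N2 (proj N f) ≤ N2 f := by
  refine le_of_sq_le_sq ?_ (N2_nonneg f)
  rw [N2_sq_eq_add N f]
  linarith [sq_nonneg (N2 (f - proj N f))]

theorem IsDeriv.N2_sub_proj_le {f g : C(AddCircle M, ℝ)} (h : IsDeriv f g) (N : ℕ) :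
    wn M N * N2 (f - HarryDym.proj N f) ≤ N2 (g - HarryDym.proj N g) := by
  refine le_of_sq_le_sq ?_ (N2_nonneg _)
  rw [mul_pow]
  have h1 := hasSum_hc_sq (f - HarryDym.proj N f)
  have h2 := hasSum_hc_sq (g - HarryDym.proj N g)
  have h3 := hasSum_comp_neg (F := fun k => hc k (g - HarryDym.proj N g) ^ 2) h2
  have h4 := h1.mul_left (wn M N ^ 2)
  refine hasSum_le (fun k => ?_) h4 h3
  rw [(h.sub (h.proj N)).hc_eq (-k), neg_neg, wn_neg, neg_neg, mul_pow]
  by_cases hk : k ∈ Finset.Icc (-(N : ℤ)) N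
  · rw [map_sub, hc_proj, if_pos hk]; simp
  · exact mul_le_mul_of_nonneg_right (le_wn_sq hk) (sq_nonneg _)

theorem proj_trig (N i : ℕ) (c : Coef N) : proj N (trig (M := M) N i c) = trig N i c := by
  have h : ∀ j, trig (M := M) N j (coef N (trig (M := M) N i c)) = trig N (j + i) c := by
    induction i with
    | zero => intro j; rw [coef_trig, add_zero]
    | succ i ih =>
      intro j
      rw [(trig_isDeriv N i c).trig_coef, ih]
      congr 2; omega
  rw [proj_apply, h, zero_add]

/-! ### Jets, the Leibniz rule and bounds for products -/

/-- A sequence of successive derivatives. -/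
def IsJet (F : ℕ → C(AddCircle M, ℝ)) : Prop := ∀ i, IsDeriv (F i) (F (i + 1))

/-- Successive derivatives of a product. -/
noncomputable def mulJ (F G : ℕ → C(AddCircle M, ℝ)) (m : ℕ) : C(AddCircle M, ℝ) :=
  ∑ p ∈ Finset.HasAntidiagonal.antidiagonal m, (m.choose p.1 : C(AddCircle M, ℝ)) * (F p.1 * G p.2)

theorem IsJet.mul {F G : ℕ → C(AddCircle M, ℝ)} (hF : IsJet F) (hG : IsJet G) :
    IsJet (mulJ F G) := by
  intro m
  have h := Finset.sum_antidiagonal_choose_succ_mul (fun i j => F i * G j) m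
  rw [mulJ, mulJ, h]
  have h2 : ∑ ij ∈ Finset.HasAntidiagonal.antidiagonal m, (m.choose ij.2 : C(AddCircle M, ℝ)) *
      (F (ij.1 + 1) * G ij.2) = ∑ ij ∈ Finset.HasAntidiagonal.antidiagonal m, (m.choose ij.1 : C(AddCircle M, ℝ)) *
      (F (ij.1 + 1) * G ij.2) := by
    refine Finset.sum_congr rfl fun p hp => ?_
    rw [Nat.choose_symm_of_eq_add (Finset.HasAntidiagonal.mem_antidiagonal.1 hp).symm]
  rw [h2, add_comm, ← Finset.sum_add_distrib]
  refine IsDeriv.sum fun p _ => ?_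
  rw [← mul_add]
  exact ((hF p.1).mul (hG p.2)).natCast_mul _

theorem mulJ_zero (F G : ℕ → C(AddCircle M, ℝ)) : mulJ F G 0 = F 0 * G 0 := by simp [mulJ]

theorem mulJ_one (F G : ℕ → C(AddCircle M, ℝ)) : mulJ F G 1 = F 0 * G 1 + F 1 * G 0 := by
  simp [mulJ, Finset.Nat.antidiagonal_succ]

/-- Successive derivatives of a power. -/
noncomputable def powJ (F : ℕ → C(AddCircle M, ℝ)) : ℕ → ℕ → C(AddCircle M, ℝ)
  | 0 => fun i => if i = 0 then 1 else 0
  | k + 1 => mulJ F (powJ F k)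

theorem IsJet.pow {F : ℕ → C(AddCircle M, ℝ)} (hF : IsJet F) (k : ℕ) : IsJet (powJ F k) := by
  induction k with
  | zero =>
    rintro (_ | i)
    · simpa [powJ] using IsDeriv.one
    · simpa [powJ] using IsDeriv.zero
  | succ k ih => exact hF.mul ih

theorem powJ_zero (F : ℕ → C(AddCircle M, ℝ)) (k : ℕ) : powJ F k 0 = F 0 ^ k := by
  induction k with
  | zero => simp [powJ]
  | succ k ih => rw [powJ, mulJ_zero, ih, pow_succ']

theorem IsJet.powJ_one {F : ℕ → C(AddCircle M, ℝ)} (hF : IsJet F) (k : ℕ) :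
    powJ F k 1 = k * F 0 ^ (k - 1) * F 1 := by
  have h := hF.pow k 0
  rw [powJ_zero] at h
  exact h.unique ((hF 0).pow k)

theorem IsJet.trig_coef {F : ℕ → C(AddCircle M, ℝ)} (hF : IsJet F) (N i : ℕ) :
    trig N i (coef N (F 0)) = proj N (F i) := by
  have h : ∀ j, trig (M := M) N (j + i) (coef N (F 0)) = trig N j (coef N (F i)) := by
    induction i with
    | zero => intro j; rfl
    | succ i ih =>
      intro j
      rw [(hF i).trig_coef, ← ih]
      congr 2; omega
  rw [proj_apply, ← h, zero_add]

theorem isJet_trig (N : ℕ) (c : Coef N) : IsJet fun i => trig (M := M) N i c :=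
  fun i => trig_isDeriv N i c

theorem IsJet.shift {F : ℕ → C(AddCircle M, ℝ)} (hF : IsJet F) (k : ℕ) :
    IsJet fun i => F (k + i) := fun i => hF (k + i)

/-- Sup bounds on the derivatives of order `< n`, and an `L²` bound on the one of order `n`. -/
def JetBound (n : ℕ) (F : ℕ → C(AddCircle M, ℝ)) (B : ℝ) : Prop :=
  (∀ i < n, ‖F i‖ ≤ B) ∧ N2 (F n) ≤ B

namespace JetBound

variable {n : ℕ} {F G : ℕ → C(AddCircle M, ℝ)} {B D : ℝ}

theorem nonneg (h : JetBound n F B) : 0 ≤ B := (N2_nonneg _).trans h.2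

theorem N2_le (h : JetBound n F B) {i : ℕ} (hi : i ≤ n) : N2 (F i) ≤ B := by
  rcases hi.lt_or_eq with h1 | rfl
  · exact (N2_le_norm _).trans (h.1 i h1)
  · exact h.2

theorem N2_mul_le (hF : JetBound n F B) (hG : JetBound n G D) {i j : ℕ} (hi : i ≤ n) (hj : j ≤ n)
    (hij : i < n ∨ j < n) : N2 (F i * G j) ≤ B * D := by
  rcases hij with h | h
  · exact (HarryDym.N2_mul_le _ _).trans
      (mul_le_mul (hF.1 i h) (hG.N2_le hj) (N2_nonneg _) hF.nonneg)
  · exact (N2_mul_le' _ _).trans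
      (mul_le_mul (hF.N2_le hi) (hG.1 j h) (norm_nonneg _) hF.nonneg)

theorem norm_natCast_mul (k : ℕ) (f : C(AddCircle M, ℝ)) :
    ‖(k : C(AddCircle M, ℝ)) * f‖ = k * ‖f‖ := by
  have : (k : C(AddCircle M, ℝ)) * f = (k : ℝ) • f := by simp [Nat.cast_smul_eq_nsmul]
  rw [this, norm_smul]; simp

theorem N2_natCast_mul (k : ℕ) (f : C(AddCircle M, ℝ)) :
    N2 ((k : C(AddCircle M, ℝ)) * f) = k * N2 f := by
  have : (k : C(AddCircle M, ℝ)) * f = (k : ℝ) • f := by simp [Nat.cast_smul_eq_nsmul]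
  rw [this, N2_smul]; simp

theorem sum_choose_antidiagonal (m : ℕ) :
    ∑ p ∈ Finset.HasAntidiagonal.antidiagonal m, (m.choose p.1 : ℝ) = 2 ^ m := by
  rw [Finset.Nat.sum_antidiagonal_eq_sum_range_succ (fun i _ => (m.choose i : ℝ))]
  exact_mod_cast Nat.sum_range_choose m

/-- In a Leibniz term of order `n ≥ 1` at most one factor has order `n`; that factor is measured in
`L²` and the other in the sup norm. -/
theorem mul (hn : 1 ≤ n) (hF : JetBound n F B) (hG : JetBound n G D) :
    JetBound n (mulJ F G) (2 ^ n * (B * D)) := by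
  have hBD := mul_nonneg hF.nonneg hG.nonneg
  constructor
  · intro i hi
    refine (norm_sum_le _ _).trans ?_
    calc _ ≤ ∑ p ∈ Finset.HasAntidiagonal.antidiagonal i, (i.choose p.1 : ℝ) * (B * D) := by
          refine Finset.sum_le_sum fun p hp => ?_
          rw [norm_natCast_mul]
          have := Finset.HasAntidiagonal.mem_antidiagonal.1 hp
          exact mul_le_mul_of_nonneg_left ((norm_mul_le _ _).trans (mul_le_mul (hF.1 _ (by omega))
            (hG.1 _ (by omega)) (norm_nonneg _) hF.nonneg)) (by positivity)
      _ = 2 ^ i * (B * D) := by rw [← Finset.sum_mul, sum_choose_antidiagonal]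
      _ ≤ _ := mul_le_mul_of_nonneg_right (pow_le_pow_right₀ one_le_two hi.le) hBD
  · refine (N2_sum_le _ _).trans ?_
    calc _ ≤ ∑ p ∈ Finset.HasAntidiagonal.antidiagonal n, (n.choose p.1 : ℝ) * (B * D) := by
          refine Finset.sum_le_sum fun p hp => ?_
          rw [N2_natCast_mul]
          have := Finset.HasAntidiagonal.mem_antidiagonal.1 hp
          exact mul_le_mul_of_nonneg_left (hF.N2_mul_le hG (by omega) (by omega) (by omega))
            (by positivity)
      _ = 2 ^ n * (B * D) := by rw [← Finset.sum_mul, sum_choose_antidiagonal]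

theorem exists_pow (M : ℝ) [Fact (0 < M)] (hn : 1 ≤ n) (B : ℝ) (k : ℕ) :
    ∃ D, 0 ≤ D ∧ ∀ F : ℕ → C(AddCircle M, ℝ), JetBound n F B → JetBound n (powJ F k) D := by
  induction k with
  | zero =>
    refine ⟨1, zero_le_one, fun F _ => ⟨fun i _ => ?_, ?_⟩⟩
    · simp only [powJ]
      split_ifs
      · exact norm_le_of_forall fun x => by simp
      · simp
    · have : n ≠ 0 := by omega
      simp [powJ, this, N2_zero]
  | succ k ih =>
    obtain ⟨D, hD, h⟩ := ih
    refine ⟨2 ^ n * (|B| * D), by positivity, fun F hF => ?_⟩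
    rw [abs_of_nonneg hF.nonneg]
    exact hF.mul hn (h F hF)

end JetBound

/-! ### The dispersive cancellation -/

/-- The integration by parts behind the weighted energy estimate. -/
theorem avg_dispersive {f f₁ f₂ f₃ w w₁ w₂ w₃ : C(AddCircle M, ℝ)} (hf : IsDeriv f f₁)
    (hf₁ : IsDeriv f₁ f₂) (hf₂ : IsDeriv f₂ f₃) (hw : IsDeriv w w₁) (hw₁ : IsDeriv w₁ w₂)
    (hw₂ : IsDeriv w₂ w₃) :
    avg (f * (w * w₃)) + 3 / 2 * avg (f₁ * (w * w₂)) = 1 / 4 * avg (f₃ * (w * w)) := by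
  -- The mean of a derivative vanishes; here the primitive is `f w w₂ - ½ f w₁² + ½ f₁ w w₁ - ¼ f₂
  -- w²`.
  have h := ((((hf.mul (hw.mul hw₂)).sub ((hf.mul (hw₁.mul hw₁)).smul (1 / 2))).add
    ((hf₁.mul (hw.mul hw₁)).smul (1 / 2))).sub ((hf₂.mul (hw.mul hw)).smul (1 / 4))).avg_eq_zero
  rw [show (f₁ * (w * w₂) + f * (w₁ * w₂ + w * w₃) - (1 / 2 : ℝ) • (f₁ * (w₁ * w₁) + f * (w₂ * w₁ + w₁ * w₂))
    + (1 / 2 : ℝ) • (f₂ * (w * w₁) + f₁ * (w₁ * w₁ + w * w₂))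
    - (1 / 4 : ℝ) • (f₃ * (w * w) + f₂ * (w₁ * w + w * w₁))) =
    f * (w * w₃) + (3 / 2 : ℝ) • (f₁ * (w * w₂)) - (1 / 4 : ℝ) • (f₃ * (w * w)) by
      ext x; simp; ring] at h
  simp only [map_add, map_sub, map_smul, smul_eq_mul] at h
  linarith

theorem avg_mul_mul_deriv {f f₁ w w₁ : C(AddCircle M, ℝ)} (hf : IsDeriv f f₁) (hw : IsDeriv w w₁) :
    avg (f * (w * w₁)) = - (1 / 2) * avg (f₁ * (w * w)) := by
  have h := (hf.mul (hw.mul hw)).avg_eq_zero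
  rw [show f₁ * (w * w) + f * (w₁ * w + w * w₁) = f₁ * (w * w) + (2 : ℝ) • (f * (w * w₁)) by
    ext x; simp; ring] at h
  simp only [map_add, map_smul, smul_eq_mul] at h
  linarith

theorem abs_avg_mul_mul_le' (f g k : C(AddCircle M, ℝ)) :
    |avg (f * (g * k))| ≤ ‖f‖ * N2 g * N2 k := by
  rw [← mul_assoc]; exact abs_avg_mul_mul_le f g k

/-- The terms of `∂ⁿ(q F₃)` which contain derivatives of `F` of order more than `n`. -/
theorem mulJ_top_order {n : ℕ} (hn : 4 ≤ n) {q F : ℕ → C(AddCircle M, ℝ)} {B D : ℝ}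
    (hq : JetBound n q D) (hF : JetBound n F B) :
    ∃ R, mulJ q (fun i => F (3 + i)) n = q 0 * F (n + 3) + (n : ℝ) • (q 1 * F (n + 2)) +
      (n.choose 2 : ℝ) • (q 2 * F (n + 1)) + R ∧ N2 R ≤ 2 ^ n * (D * B) := by
  obtain ⟨k, rfl⟩ : ∃ k, n = k + 3 := ⟨n - 3, by omega⟩
  -- The remainder collects the terms where `q` carries at least three derivatives, so `F` carries
  -- at most `n`. Both factors could have order `n` only if `n = 3`.
  refine ⟨∑ i ∈ Finset.range (k + 1), (((k + 3).choose (i + 3) : ℕ) : C(AddCircle M, ℝ)) *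
    (q (i + 3) * F (3 + (k - i))), ?_, ?_⟩
  · rw [mulJ, Finset.Nat.sum_antidiagonal_eq_sum_range_succ
      (fun i j => (((k + 3).choose i : ℕ) : C(AddCircle M, ℝ)) * (q i * F (3 + j)))]
    rw [Finset.sum_range_succ', Finset.sum_range_succ', Finset.sum_range_succ']
    have e : ∀ i ∈ Finset.range (k + 1),
        (((k + 3).choose (i + 1 + 1 + 1) : ℕ) : C(AddCircle M, ℝ)) * (q (i + 1 + 1 + 1) *
          F (3 + (k + 3 - (i + 1 + 1 + 1)))) =
        (((k + 3).choose (i + 3) : ℕ) : C(AddCircle M, ℝ)) * (q (i + 3) * F (3 + (k - i))) := by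
      intro i _
      rw [show k + 3 - (i + 1 + 1 + 1) = k - i by omega]
    rw [Finset.sum_congr rfl e]
    have e1 : 3 + (k + 3 - 0) = k + 3 + 3 := by omega
    have e2 : 3 + (k + 3 - (0 + 1)) = k + 3 + 2 := by omega
    have e3 : 3 + (k + 3 - (0 + 1 + 1)) = k + 3 + 1 := by omega
    rw [e1, e2, e3]
    simp only [zero_add, Nat.choose_zero_right, Nat.choose_one_right, one_add_one_eq_two]
    ext x
    simp
    rw [show (3 : C(AddCircle M, ℝ)) x = 3 from rfl]
    ring
  · refine (N2_sum_le _ _).trans ?_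
    have hDB := mul_nonneg hq.nonneg hF.nonneg
    calc _ ≤ ∑ i ∈ Finset.range (k + 1), (((k + 3).choose (i + 3) : ℕ) : ℝ) * (D * B) := by
          refine Finset.sum_le_sum fun i hi => ?_
          rw [JetBound.N2_natCast_mul]
          have := Finset.mem_range.1 hi
          exact mul_le_mul_of_nonneg_left (hq.N2_mul_le hF (by omega) (by omega) (by omega))
            (by positivity)
      _ = (∑ i ∈ Finset.range (k + 1), (((k + 3).choose (i + 3) : ℕ) : ℝ)) * (D * B) := by
          rw [Finset.sum_mul]
      _ ≤ _ := by
          refine mul_le_mul_of_nonneg_right ?_ hDB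
          have h := Nat.sum_range_choose (k + 3)
          rw [Finset.sum_range_succ', Finset.sum_range_succ', Finset.sum_range_succ'] at h
          have h' : ∑ i ∈ Finset.range (k + 1), (k + 3).choose (i + 3) ≤ 2 ^ (k + 3) := by
            rw [← h]
            exact ((Nat.le_add_right _ _).trans (Nat.le_add_right _ _)).trans (Nat.le_add_right _ _)
          exact_mod_cast h'

/-- The dispersive term in the weighted energy estimate loses no derivatives. -/
theorem exists_dispersive_bound (M : ℝ) [Fact (0 < M)] {n : ℕ} (hn : 4 ≤ n) (B : ℝ) :
    ∃ C, ∀ F : ℕ → C(AddCircle M, ℝ), IsJet F → JetBound n F B →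
      |avg (F 0 ^ (2 * n - 3) * F n * mulJ (powJ F 3) (fun i => F (3 + i)) n)| ≤ C := by
  obtain ⟨D, hD, hpow⟩ := JetBound.exists_pow M (n := n) (by omega) B (2 * n - 3)
  obtain ⟨D', hD', hpow'⟩ := JetBound.exists_pow M (n := n) (by omega) B 3
  refine ⟨1 / 4 * (2 ^ n * (D * D') * B * B) + n.choose 2 * (1 / 2 * ((D * D' + D * D') * B * B)) +
    D * B * (2 ^ n * (D' * B)), fun F hJ hF => ?_⟩
  have hB := hF.nonneg
  have hρ := hpow F hF
  have hq := hpow' F hF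
  set ρ := powJ F (2 * n - 3) with hρdef
  set q := powJ F 3 with hqdef
  have hρJ : IsJet ρ := hJ.pow _
  have hqJ : IsJet q := hJ.pow _
  obtain ⟨R, hR, hRB⟩ := mulJ_top_order hn hq hF
  have hfJ := hρJ.mul hqJ
  have hfB := hρ.mul (by omega) hq
  set f := mulJ ρ q with hf
  have hf0 : f 0 = ρ 0 * q 0 := mulJ_zero _ _
  -- The exponent `2n - 3` is fixed here. With `ρ = u^k`, `f₁ = (k+3)/3 · ρ q₁`, and `3/2 f₁` must
  -- equal the Leibniz coefficient `n ρ q₁` for `avg_dispersive` to absorb the `∂ⁿ⁺²` term.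
  have hf1 : f 1 = (2 * n / 3 : ℝ) • (ρ 0 * q 1) := by
    rw [hf, mulJ_one, hρdef, hqdef, hJ.powJ_one, hJ.powJ_one, powJ_zero, powJ_zero]
    ext x
    simp
    have e : 2 * n - 3 = (2 * n - 3 - 1) + 1 := by omega
    have e' : ((2 * n - 3 : ℕ) : ℝ) = 2 * n - 3 := by
      rw [Nat.cast_sub (by omega)]; push_cast; ring
    rw [e']
    rw [show (F 0) x ^ (2 * n - 3) = (F 0) x ^ (2 * n - 3 - 1) * (F 0) x by
      rw [← pow_succ, ← e], show (3 : C(AddCircle M, ℝ)) x = 3 from rfl]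
    ring
  have hid := avg_dispersive (hfJ 0) (hfJ 1) (hfJ 2) (hJ n) (hJ (n + 1)) (hJ (n + 2))
  have hid2 := avg_mul_mul_deriv ((hρJ 0).mul (hqJ 2)) (hJ n)
  have hρ0 : F 0 ^ (2 * n - 3) = ρ 0 := (powJ_zero _ _).symm
  have hsum : avg (F 0 ^ (2 * n - 3) * F n * mulJ q (fun i => F (3 + i)) n) =
      (avg (f 0 * (F n * F (n + 2 + 1))) + 3 / 2 * avg (f (0 + 1) * (F n * F (n + 1 + 1)))) +
      n.choose 2 * avg (ρ 0 * q 2 * (F n * F (n + 1))) + avg (ρ 0 * (F n * R)) := by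
    rw [hR, hρ0, zero_add, hf1, hf0]
    rw [show ρ 0 * F n * (q 0 * F (n + 3) + (n : ℝ) • (q 1 * F (n + 2)) +
        (n.choose 2 : ℝ) • (q 2 * F (n + 1)) + R) = ρ 0 * q 0 * (F n * F (n + 3)) +
        (n : ℝ) • (ρ 0 * q 1 * (F n * F (n + 2))) +
        (n.choose 2 : ℝ) • (ρ 0 * q 2 * (F n * F (n + 1))) + ρ 0 * (F n * R) by
      ext x; simp; ring]
    simp only [map_add, map_smul, smul_eq_mul, smul_mul_assoc]
    ring
  rw [hsum, hid, hid2]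
  have b1 : |avg (f (2 + 1) * (F n * F n))| ≤ 2 ^ n * (D * D') * B * B := by
    refine (abs_avg_mul_mul_le' _ _ _).trans ?_
    have h1 := hfB.1 3 (by omega)
    have h2 := hF.2
    have h0 := N2_nonneg (F n)
    gcongr
  have b2 : |avg ((ρ (0 + 1) * q 2 + ρ 0 * q (2 + 1)) * (F n * F n))| ≤
      (D * D' + D * D') * B * B := by
    refine (abs_avg_mul_mul_le' _ _ _).trans ?_
    have h1 : ‖ρ (0 + 1) * q 2 + ρ 0 * q (2 + 1)‖ ≤ D * D' + D * D' := by
      refine (norm_add_le _ _).trans (add_le_add ?_ ?_)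
      · exact (norm_mul_le _ _).trans (mul_le_mul (hρ.1 1 (by omega)) (hq.1 2 (by omega))
          (norm_nonneg _) hD)
      · exact (norm_mul_le _ _).trans (mul_le_mul (hρ.1 0 (by omega)) (hq.1 3 (by omega))
          (norm_nonneg _) hD)
    have h2 := hF.2
    have h0 := N2_nonneg (F n)
    gcongr
  have b3 : |avg (ρ 0 * (F n * R))| ≤ D * B * (2 ^ n * (D' * B)) := by
    refine (abs_avg_mul_mul_le' _ _ _).trans ?_
    have h1 := hρ.1 0 (by omega)
    have h2 := hF.2
    have h0 := N2_nonneg (F n)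
    gcongr
    exact N2_nonneg R
  refine (abs_add_le _ _).trans (add_le_add ((abs_add_le _ _).trans (add_le_add ?_ ?_)) b3)
  · rw [abs_mul, abs_of_nonneg (by norm_num : (0 : ℝ) ≤ 1 / 4)]
    linarith
  · rw [abs_mul, abs_mul, Nat.abs_cast, abs_neg, abs_of_nonneg (by norm_num : (0 : ℝ) ≤ 1 / 2)]
    gcongr

/-- A derivative has mean zero, so its sup norm is at most `M` times the `L²` norm of the next one;
descending from order `n` reaches every order but zero. -/
theorem IsJet.norm_le {F : ℕ → C(AddCircle M, ℝ)} (hF : IsJet F) {n : ℕ} {K : ℝ}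
    (hK : N2 (F n) ≤ K) (j : ℕ) : ∀ i, 1 ≤ i → i + j + 1 = n → ‖F i‖ ≤ (1 + M) ^ (j + 1) * K := by
  have hM0 := hM.out
  have hK0 : 0 ≤ K := (N2_nonneg _).trans hK
  have key : ∀ i, 1 ≤ i → ‖F i‖ ≤ M * N2 (F (i + 1)) := by
    intro i hi
    obtain ⟨i, rfl⟩ : ∃ k, i = k + 1 := ⟨i - 1, by omega⟩
    exact (hF (i + 1)).norm_le_of_avg_eq_zero (hF i).avg_eq_zero
  induction j with
  | zero =>
    rintro i hi rfl
    refine (key i hi).trans ?_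
    rw [zero_add, pow_one]
    exact mul_le_mul (by linarith) hK (N2_nonneg _) (by linarith)
  | succ j ih =>
    intro i hi hij
    have h1 := ih (i + 1) (by omega) (by omega)
    refine (key i hi).trans ?_
    rw [pow_succ' _ (j + 1), mul_assoc]
    exact mul_le_mul (by linarith) ((N2_le_norm _).trans h1) (N2_nonneg _) (by linarith)

/-- Sup bounds on intermediate derivatives. -/
theorem IsJet.jetBound {F : ℕ → C(AddCircle M, ℝ)} (hF : IsJet F) {n : ℕ} {S K : ℝ}
    (hS : ‖F 0‖ ≤ S) (hK : N2 (F n) ≤ K) : JetBound n F (S + (1 + M) ^ n * K) := by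
  have hM0 := hM.out
  have hK0 : 0 ≤ K := (N2_nonneg _).trans hK
  have hS0 : 0 ≤ S := (norm_nonneg _).trans hS
  have h1 : (1 : ℝ) ≤ (1 + M) ^ n := one_le_pow₀ (by linarith)
  refine ⟨fun i hi => ?_, ?_⟩
  · rcases Nat.eq_zero_or_pos i with rfl | h
    · exact hS.trans (by nlinarith)
    · have := hF.norm_le hK (n - 1 - i) i h (by omega)
      have h2 : (1 + M) ^ (n - 1 - i + 1) ≤ (1 + M) ^ n :=
        pow_le_pow_right₀ (by linarith) (by omega)
      nlinarith
  · nlinarith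

/-! ### The viscous Galerkin field and its energy estimate -/

theorem wn_natCast (N : ℕ) : wn M N = wn M 1 * N := by simp [wn]; ring

theorem wn_pow_four (m : ℕ) : wn M ((m ^ 4 : ℕ) : ℤ) = wn M 1 * m ^ 4 := by
  rw [wn_natCast]; push_cast; ring

theorem wn_one_pos : 0 < wn M 1 := by
  have := wn_nat_pos (M := M) one_pos
  simpa using this

/-- The nonlinearity `u³ u_xxx` and its derivatives. -/
noncomputable def dymJ (F : ℕ → C(AddCircle M, ℝ)) : ℕ → C(AddCircle M, ℝ) :=
  mulJ (powJ F 3) (fun i => F (3 + i))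

theorem IsJet.dym {F : ℕ → C(AddCircle M, ℝ)} (hF : IsJet F) : IsJet (dymJ F) :=
  (hF.pow 3).mul (hF.shift 3)

theorem dymJ_zero (F : ℕ → C(AddCircle M, ℝ)) : dymJ F 0 = F 0 ^ 3 * F 3 := by
  rw [dymJ, mulJ_zero, powJ_zero]

/-- The viscous Galerkin vector field. -/
noncomputable def field (M : ℝ) [Fact (0 < M)] (N : ℕ) (ε : ℝ) (c : Coef N) : Coef N :=
  coef N (trig (M := M) N 0 c ^ 3 * trig N 3 c) - ε • coef N (trig (M := M) N 4 c)

/-- Projection commutes with differentiation and fixes trigonometric polynomials, so only the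
nonlinear term keeps a projection. -/
theorem trig_field (N i : ℕ) (ε : ℝ) (c : Coef N) :
    trig N i (field M N ε c) = proj N (dymJ (fun i => trig (M := M) N i c) i) -
      ε • trig N (4 + i) c := by
  have hJ := isJet_trig (M := M) N c
  rw [field, map_sub, map_smul, ← hJ.dym.trig_coef N i, dymJ_zero, (hJ.shift 4).trig_coef N i,
    proj_trig]

theorem JetBound.N2_dymJ_one {F : ℕ → C(AddCircle M, ℝ)} {n : ℕ} (hn : 4 ≤ n) {B D : ℝ}
    (hF : JetBound n F B) (hq : JetBound n (powJ F 3) D) : N2 (dymJ F 1) ≤ 2 * (D * B) := by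
  rw [dymJ, mulJ_one]
  have h1 := hq.N2_mul_le hF (i := 0) (j := 4) (by omega) hn (by omega)
  have h2 := hq.N2_mul_le hF (i := 1) (j := 3) (by omega) (by omega) (by omega)
  exact (N2_add_le _ _).trans (by rw [two_mul]; exact add_le_add h1 h2)

/-- The Galerkin field is uniformly close to the nonlinearity. -/
theorem exists_residual_bound (M : ℝ) [Fact (0 < M)] {n : ℕ} (hn : 4 ≤ n) (B : ℝ) :
    ∃ C, 0 ≤ C ∧ ∀ m : ℕ, 1 ≤ m → ∀ c : Coef (m ^ 4),
      JetBound n (fun i => trig (M := M) (m ^ 4) i c) B →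
      ‖trig (m ^ 4) 0 (field M (m ^ 4) ((m : ℝ) ^ 3)⁻¹ c) -
        trig (M := M) (m ^ 4) 0 c ^ 3 * trig (m ^ 4) 3 c‖ ≤ C / m := by
  have hM0 : 0 < M := Fact.out
  obtain ⟨D, hD, hpow⟩ := JetBound.exists_pow M (n := n) (by omega) B 3
  have hω := wn_one_pos (M := M)
  set ω := wn M 1
  refine ⟨(2 * (D * |B|) / ω + (2 * (D * |B|)) ^ 2 * (2 * M) / ω + 1) + (|B| ^ 2 * (1 + 2 * M * ω) + 1),
    by positivity, fun m hm c hF => ?_⟩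
  have hB := hF.nonneg
  rw [abs_of_nonneg hB]
  have hm1 : (1 : ℝ) ≤ m := by exact_mod_cast hm
  set F := fun i => trig (M := M) (m ^ 4) i c with hFdef
  have hJ : IsJet F := isJet_trig _ c
  have hgJ := hJ.dym
  rw [trig_field]
  have e0 : trig (M := M) (m ^ 4) 0 c ^ 3 * trig (m ^ 4) 3 c = dymJ F 0 := (dymJ_zero F).symm
  rw [e0]
  have hg1 := hF.N2_dymJ_one hn (hpow F hF)
  set L := 2 * (D * B)
  have hL : 0 ≤ L := by positivity
  set p := dymJ F 0 - proj (m ^ 4) (dymJ F 0) with hp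
  have hpd := (hgJ 0).sub ((hgJ 0).proj (m ^ 4))
  -- One derivative of the nonlinearity is bounded in `L²`, which gains a factor `m⁻⁴` on the
  -- discarded frequencies.
  have h1 : N2 p ≤ L / (ω * m ^ 4) := by
    have := ((hgJ 0).N2_sub_proj_le (m ^ 4)).trans ((N2_sub_proj_le _ _).trans hg1)
    rw [wn_pow_four] at this
    rw [le_div_iff₀ (by positivity)]
    linarith
  have h2 := hpd.norm_sq_le
  have h3 : N2 (dymJ F (0 + 1) - proj (m ^ 4) (dymJ F (0 + 1))) ≤ L :=
    (N2_sub_proj_le _ _).trans hg1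
  have hb1 : ‖p‖ ≤ (L / ω + L ^ 2 * (2 * M) / ω + 1) / m := by
    refine le_of_sq_le_sq (h2.trans ?_) (by positivity)
    have h4 : N2 p * N2 (dymJ F (0 + 1) - proj (m ^ 4) (dymJ F (0 + 1))) ≤ L / (ω * m ^ 4) * L :=
      mul_le_mul h1 h3 (N2_nonneg _) (by positivity)
    have h5 : N2 p ^ 2 ≤ (L / (ω * m ^ 4)) ^ 2 := pow_le_pow_left₀ (N2_nonneg _) h1 2
    have hm2 : (m : ℝ) ^ 2 ≤ m ^ 4 := pow_le_pow_right₀ hm1 (by omega)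
    have h6 : L / (ω * m ^ 4) ≤ L / (ω * m ^ 2) := by gcongr
    have h7 : (L / (ω * m ^ 4)) ^ 2 ≤ (L / (ω * m)) ^ 2 := by
      have : (m : ℝ) ≤ m ^ 4 := le_self_pow₀ hm1 (by omega)
      gcongr
    have e2 : (L / (ω * m)) ^ 2 + 2 * M * (L / (ω * m ^ 2) * L) =
        ((L / ω) ^ 2 + L ^ 2 * (2 * M) / ω) / m ^ 2 := by field_simp
    have h8 : L / (ω * m ^ 4) * L ≤ L / (ω * m ^ 2) * L := by gcongr
    have h9 : 2 * M * (N2 p * N2 (dymJ F (0 + 1) - proj (m ^ 4) (dymJ F (0 + 1)))) ≤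
        2 * M * (L / (ω * m ^ 2) * L) := by
      have := h4.trans h8
      gcongr
    have h10 : N2 p ^ 2 + 2 * M * (N2 p * N2 (dymJ F (0 + 1) - proj (m ^ 4) (dymJ F (0 + 1)))) ≤
        ((L / ω) ^ 2 + L ^ 2 * (2 * M) / ω) / m ^ 2 := by
      rw [← e2]
      linarith
    refine h10.trans ?_
    rw [div_pow (L / ω + L ^ 2 * (2 * M) / ω + 1)]
    have ha : 0 ≤ L / ω := by positivity
    have hb : 0 ≤ L ^ 2 * (2 * M) / ω := by positivity
    gcongr
    nlinarith [mul_nonneg ha hb, sq_nonneg (L ^ 2 * (2 * M) / ω)]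
  -- For `n = 4` the fourth derivative is bounded only in `L²`. Bernstein's inequality and
  -- `norm_sq_le` give a sup bound `O(m²)`, and the viscosity `m⁻³` leaves `1/m`.
  have hb2 : ‖((m : ℝ) ^ 3)⁻¹ • F 4‖ ≤ (B ^ 2 * (1 + 2 * M * ω) + 1) / m := by
    have h4 := (hJ 4).norm_sq_le
    have h5 := N2_trig_succ_le (M := M) (m ^ 4) 4 c
    rw [wn_pow_four] at h5
    have h6 : N2 (F 4) ≤ B := hF.N2_le hn
    have h7 : ‖F 4‖ ≤ (B ^ 2 * (1 + 2 * M * ω) + 1) * m ^ 2 := by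
      refine le_of_sq_le_sq (h4.trans ?_) (by positivity)
      have h8 : N2 (F 4) * N2 (F (4 + 1)) ≤ B * (ω * m ^ 4 * B) := by
        refine mul_le_mul h6 (h5.trans ?_) (N2_nonneg _) hB
        gcongr
      have h9 : N2 (F 4) ^ 2 ≤ B ^ 2 := pow_le_pow_left₀ (N2_nonneg _) h6 2
      have hm4 : (1 : ℝ) ≤ m ^ 4 := one_le_pow₀ hm1
      have h10 : N2 (F 4) ^ 2 + 2 * M * (N2 (F 4) * N2 (F (4 + 1))) ≤
          (B ^ 2 * (1 + 2 * M * ω)) * m ^ 4 := by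
        have := mul_le_mul_of_nonneg_left h8 (by positivity : 0 ≤ 2 * M)
        nlinarith [sq_nonneg B]
      refine h10.trans ?_
      have hX : 0 ≤ B ^ 2 * (1 + 2 * M * ω) := by positivity
      rw [mul_pow, ← pow_mul]
      gcongr
      nlinarith
    rw [norm_smul, norm_inv, norm_pow, Real.norm_natCast, inv_mul_le_iff₀ (by positivity)]
    refine h7.trans (le_of_eq ?_)
    field_simp
  have e3 : proj (m ^ 4) (dymJ F 0) - ((m : ℝ) ^ 3)⁻¹ • trig (m ^ 4) (4 + 0) c - dymJ F 0 =
      -(p + ((m : ℝ) ^ 3)⁻¹ • F 4) := by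
    rw [hp]; simp only [hFdef, add_zero]; abel
  rw [e3, norm_neg, add_div]
  exact (norm_add_le _ _).trans (add_le_add hb1 hb2)

/-- Interpolation for the first derivative. -/
theorem IsJet.N2_succ_le {F : ℕ → C(AddCircle M, ℝ)} (hF : IsJet F) {n : ℕ} {B : ℝ}
    (hB : N2 (F n) ≤ B) : N2 (F (n + 1)) ^ 2 ≤ B * N2 (F (n + 2)) :=
  ((hF n).N2_sq_le (hF (n + 1))).trans (mul_le_mul_of_nonneg_right hB (N2_nonneg _))

theorem IsJet.weight_deriv_two {F ρ : ℕ → C(AddCircle M, ℝ)} (hF : IsJet F) (hρ : IsJet ρ) (n : ℕ) :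
    IsDeriv (ρ 1 * F n + ρ 0 * F (n + 1)) (ρ 2 * F n + (2 : ℝ) • (ρ 1 * F (n + 1)) + ρ 0 * F (n + 2)) := by
  have h := ((hρ 1).mul (hF n)).add ((hρ 0).mul (hF (n + 1)))
  convert h using 1
  rw [two_smul]
  abel

/-- Effect of the viscosity on the weighted energy. -/
theorem exists_viscosity_bound (M : ℝ) [Fact (0 < M)] {n : ℕ} (hn : 4 ≤ n) {a : ℝ} (ha : 0 < a)
    (B : ℝ) :
    ∃ C, 0 ≤ C ∧ ∀ F : ℕ → C(AddCircle M, ℝ), IsJet F → JetBound n F B → (∀ x, a ≤ F 0 x) →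
      -2 * avg (F 0 ^ (2 * n - 3) * F n * F (n + 4)) ≤ -a ^ (2 * n - 3) * N2 (F (n + 2)) ^ 2 + C := by
  obtain ⟨D, hD, hpow⟩ := JetBound.exists_pow M (n := n) (by omega) B (2 * n - 3)
  have hb : 0 < a ^ (2 * n - 3) := by positivity
  set b := a ^ (2 * n - 3)
  refine ⟨(2 * D * |B| + 8 * D ^ 2 * |B| / b) ^ 2 / (2 * b), by positivity, fun F hJ hF hlow => ?_⟩
  have hB := hF.nonneg
  rw [abs_of_nonneg hB]
  set L := 2 * D * B + 8 * D ^ 2 * B / b with hL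
  have hρ := hpow F hF
  rw [← powJ_zero F (2 * n - 3)]
  set ρ := powJ F (2 * n - 3) with hρdef
  have hρJ : IsJet ρ := hJ.pow _
  have hX1 := (hρJ 0).mul (hJ n)
  have hX2 := hJ.weight_deriv_two hρJ n
  have hp1 := hX1.by_parts (hJ (n + 3))
  have hp2 := hX2.by_parts (hJ (n + 2))
  have hz := hJ.N2_succ_le (n := n) hF.2
  have e : avg (ρ 0 * F n * F (n + 4)) = avg (ρ 2 * (F n * F (n + 2))) +
      2 * avg (ρ 1 * (F (n + 1) * F (n + 2))) + avg (ρ 0 * (F (n + 2) * F (n + 2))) := by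
    have : avg (ρ 0 * F n * F (n + 4)) = avg ((ρ 2 * F n + (2 : ℝ) • (ρ 1 * F (n + 1)) +
        ρ 0 * F (n + 2)) * F (n + 2)) := by
      rw [hp2]
      have : avg (ρ 0 * F n * F (n + 4)) = - avg ((ρ (0 + 1) * F n + ρ 0 * F (n + 1)) * F (n + 3)) := by
        rw [hp1]; simp [add_assoc]
      rw [this]
    rw [this]
    simp only [add_mul, map_add, smul_mul_assoc, map_smul, smul_eq_mul, mul_assoc]
  rw [e]
  set y := N2 (F (n + 2)) with hy
  set z := N2 (F (n + 1)) with hzdef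
  have hy0 : 0 ≤ y := N2_nonneg _
  have hz0 : 0 ≤ z := N2_nonneg _
  have b1 : |avg (ρ 2 * (F n * F (n + 2)))| ≤ D * B * y := by
    refine (abs_avg_mul_mul_le' _ _ _).trans ?_
    have h1 := hρ.1 2 (by omega)
    have h2 := hF.2
    have h0 := N2_nonneg (F n)
    gcongr
  have b2 : |avg (ρ 1 * (F (n + 1) * F (n + 2)))| ≤ D * z * y := by
    refine (abs_avg_mul_mul_le' _ _ _).trans ?_
    have h1 := hρ.1 1 (by omega)
    gcongr
  have b3 : b * y ^ 2 ≤ avg (ρ 0 * (F (n + 2) * F (n + 2))) := by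
    rw [hy, N2_sq, ← smul_eq_mul, ← map_smul]
    refine avg_mono fun x => ?_
    simp only [ContinuousMap.smul_apply, ContinuousMap.mul_apply, smul_eq_mul]
    refine mul_le_mul_of_nonneg_right ?_ (mul_self_nonneg _)
    rw [hρdef, powJ_zero]
    exact pow_le_pow_left₀ ha.le (hlow x) _
  have b1' := (abs_le.1 b1).1
  have b2' := (abs_le.1 b2).1
  -- The lower-order terms are absorbed by Young's inequality. This step and `c2` each spend half of
  -- `b y²`, out of the `2 b y²` supplied by `b3`; `z² ≤ B y` removes `z`.
  have c1 : 4 * (D * z * y) ≤ b / 2 * y ^ 2 + 8 * D ^ 2 * B / b * y := by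
    have h1 : 4 * (D * z * y) ≤ b / 2 * y ^ 2 + 8 * D ^ 2 / b * z ^ 2 := by
      have := sq_nonneg (b * y - 4 * D * z)
      have e : b / 2 * y ^ 2 + 8 * D ^ 2 / b * z ^ 2 - 4 * (D * z * y) =
        (b * y - 4 * D * z) ^ 2 / (2 * b) := by field_simp; ring
      have : 0 ≤ (b * y - 4 * D * z) ^ 2 / (2 * b) := by positivity
      linarith
    have h2 : 8 * D ^ 2 / b * z ^ 2 ≤ 8 * D ^ 2 / b * (B * y) := by gcongr
    have e2 : 8 * D ^ 2 / b * (B * y) = 8 * D ^ 2 * B / b * y := by ring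
    linarith
  have c2 : L * y ≤ b / 2 * y ^ 2 + L ^ 2 / (2 * b) := by
    have e : b / 2 * y ^ 2 + L ^ 2 / (2 * b) - L * y = (b * y - L) ^ 2 / (2 * b) := by
      field_simp; ring
    have : 0 ≤ (b * y - L) ^ 2 / (2 * b) := by positivity
    linarith
  have e3 : L * y = 2 * (D * B * y) + 8 * D ^ 2 * B / b * y := by rw [hL]; ring
  nlinarith

/-- The frequency truncation error in the weighted energy. -/
theorem exists_truncation_bound (M : ℝ) [Fact (0 < M)] {n : ℕ} (hn : 4 ≤ n) (B : ℝ) :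
    ∃ C, 0 ≤ C ∧ ∀ m : ℕ, 1 ≤ m → ∀ c : Coef (m ^ 4), ∀ F : ℕ → C(AddCircle M, ℝ),
      (F = fun i => trig (M := M) (m ^ 4) i c) → JetBound n F B →
      |avg (F 0 ^ (2 * n - 3) * F n * (dymJ F n - proj (m ^ 4) (dymJ F n)))| ≤
        C / m ^ 4 * (B + N2 (F (n + 2))) ^ 2 := by
  obtain ⟨D, hD, hpow⟩ := JetBound.exists_pow M (n := n) (by omega) B (2 * n - 3)
  obtain ⟨D', hD', hpow'⟩ := JetBound.exists_pow M (n := n) (by omega) B 3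
  have hω := wn_one_pos (M := M)
  set ω := wn M 1 with hωdef
  set κ : ℝ := n + n.choose 2 + 2 ^ n with hκ
  refine ⟨3 * D * D' * (ω + κ) / ω ^ 2, by positivity, fun m hm c F hFdef hF => ?_⟩
  have hB := hF.nonneg
  have hm1 : (1 : ℝ) ≤ m := by exact_mod_cast hm
  have hm4 : (1 : ℝ) ≤ (m : ℝ) ^ 4 := one_le_pow₀ hm1
  have hJ : IsJet F := by rw [hFdef]; exact isJet_trig _ c
  have hρ := hpow F hF
  have hq := hpow' F hF
  rw [← powJ_zero F (2 * n - 3)]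
  set ρ := powJ F (2 * n - 3) with hρdef
  have hρJ : IsJet ρ := hJ.pow _
  have hX1 := (hρJ 0).mul (hJ n)
  have hX2 := hJ.weight_deriv_two hρJ n
  have hz := hJ.N2_succ_le (n := n) hF.2
  rw [avg_mul_sub_proj]
  have t1 := hX1.N2_sub_proj_le (m ^ 4)
  have t2 := hX2.N2_sub_proj_le (m ^ 4)
  have hbern : N2 (F (n + 3)) ≤ ω * m ^ 4 * N2 (F (n + 2)) := by
    rw [hFdef, hωdef, ← wn_pow_four]
    exact N2_trig_succ_le (m ^ 4) (n + 2) c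
  rw [wn_pow_four] at t1 t2
  set Ω := ω * (m : ℝ) ^ 4 with hΩ
  have hΩ0 : 0 < Ω := by positivity
  set y := N2 (F (n + 2)) with hy
  have hy0 : 0 ≤ y := N2_nonneg _
  have hz1 : N2 (F (n + 1)) ≤ B + y := by
    refine le_of_sq_le_sq (hz.trans ?_) (by positivity)
    nlinarith
  have hX2B : N2 (ρ 2 * F n + (2 : ℝ) • (ρ 1 * F (n + 1)) + ρ 0 * F (n + 2)) ≤ 3 * D * (B + y) := by
    have a1 : N2 (ρ 2 * F n) ≤ D * B := hρ.N2_mul_le hF (by omega) le_rfl (by omega)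
    have a2 : N2 (ρ 1 * F (n + 1)) ≤ D * (B + y) := (N2_mul_le _ _).trans
      (mul_le_mul (hρ.1 1 (by omega)) hz1 (N2_nonneg _) hD)
    have a3 : N2 (ρ 0 * F (n + 2)) ≤ D * y := (N2_mul_le _ _).trans
      (mul_le_mul_of_nonneg_right (hρ.1 0 (by omega)) hy0)
    have a4 : N2 ((2 : ℝ) • (ρ 1 * F (n + 1))) = 2 * N2 (ρ 1 * F (n + 1)) := by
      rw [N2_smul, abs_two]
    have := N2_add_le (ρ 2 * F n + (2 : ℝ) • (ρ 1 * F (n + 1))) (ρ 0 * F (n + 2))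
    have := N2_add_le (ρ 2 * F n) ((2 : ℝ) • (ρ 1 * F (n + 1)))
    linarith
  obtain ⟨R, hR, hRB⟩ := mulJ_top_order hn hq hF
  have hGB : N2 (dymJ F n) ≤ D' * (Ω + κ) * (B + y) := by
    rw [dymJ, hR]
    have a1 : N2 (powJ F 3 0 * F (n + 3)) ≤ D' * (Ω * y) := (N2_mul_le _ _).trans
      (mul_le_mul (hq.1 0 (by omega)) hbern (N2_nonneg _) hD')
    have a2 : N2 ((n : ℝ) • (powJ F 3 1 * F (n + 2))) ≤ n * (D' * y) := by
      rw [N2_smul, Nat.abs_cast]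
      exact mul_le_mul_of_nonneg_left ((N2_mul_le _ _).trans
        (mul_le_mul_of_nonneg_right (hq.1 1 (by omega)) hy0)) (by positivity)
    have a3 : N2 ((n.choose 2 : ℝ) • (powJ F 3 2 * F (n + 1))) ≤ n.choose 2 * (D' * (B + y)) := by
      rw [N2_smul, Nat.abs_cast]
      exact mul_le_mul_of_nonneg_left ((N2_mul_le _ _).trans
        (mul_le_mul (hq.1 2 (by omega)) hz1 (N2_nonneg _) hD')) (by positivity)
    have s1 := N2_add_le (powJ F 3 0 * F (n + 3) + (n : ℝ) • (powJ F 3 1 * F (n + 2)) +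
      (n.choose 2 : ℝ) • (powJ F 3 2 * F (n + 1))) R
    have s2 := N2_add_le (powJ F 3 0 * F (n + 3) + (n : ℝ) • (powJ F 3 1 * F (n + 2)))
      ((n.choose 2 : ℝ) • (powJ F 3 2 * F (n + 1)))
    have s3 := N2_add_le (powJ F 3 0 * F (n + 3)) ((n : ℝ) • (powJ F 3 1 * F (n + 2)))
    have p1 : 0 ≤ D' * Ω * B := by positivity
    have p2 : 0 ≤ n * (D' * B) := by positivity
    have p3 : 0 ≤ (2 : ℝ) ^ n * (D' * y) := by positivity
    have e : D' * (Ω + κ) * (B + y) = D' * (Ω * y) + D' * Ω * B + n * (D' * y) + n * (D' * B) +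
      n.choose 2 * (D' * (B + y)) + 2 ^ n * (D' * B) + 2 ^ n * (D' * y) := by rw [hκ]; ring
    linarith
  set XX := ρ 0 * F n - proj (m ^ 4) (ρ 0 * F n) with hXX
  -- Two derivatives fall on the weighted factor and gain `Ω⁻²`. The nonlinearity costs only `Ω` by
  -- Bernstein's inequality, so the net error is of order `m⁻⁴`.
  have u1 : Ω ^ 2 * N2 XX ≤ 3 * D * (B + y) := by
    have := mul_le_mul_of_nonneg_left t1 hΩ0.le
    have := N2_sub_proj_le (m ^ 4) (ρ 2 * F n + (2 : ℝ) • (ρ 1 * F (n + 1)) + ρ 0 * F (n + 2))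
    simp only [zero_add] at *
    nlinarith
  have u2 : N2 (dymJ F n - proj (m ^ 4) (dymJ F n)) ≤ D' * (Ω + κ) * (B + y) :=
    (N2_sub_proj_le _ _).trans hGB
  have u3 : Ω ^ 2 * |avg (XX * (dymJ F n - proj (m ^ 4) (dymJ F n)))| ≤
      3 * D * (B + y) * (D' * (Ω + κ) * (B + y)) := by
    refine (mul_le_mul_of_nonneg_left (abs_avg_mul_le _ _) (sq_nonneg Ω)).trans ?_
    rw [← mul_assoc]
    exact mul_le_mul u1 u2 (N2_nonneg _) (by positivity)
  have u4 : Ω + κ ≤ (ω + κ) * m ^ 4 := by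
    have : 0 ≤ κ := by positivity
    rw [hΩ]
    nlinarith
  have u5 : Ω ^ 2 * |avg (XX * (dymJ F n - proj (m ^ 4) (dymJ F n)))| ≤
      3 * D * (B + y) * (D' * ((ω + κ) * m ^ 4) * (B + y)) := by
    refine u3.trans ?_
    gcongr
  rw [← le_div_iff₀' (by positivity)] at u5
  refine u5.trans (le_of_eq ?_)
  rw [hΩ]
  field_simp

/-- The weighted energy estimate for the Galerkin field. -/
theorem exists_energy_rate (M : ℝ) [Fact (0 < M)] {n : ℕ} (hn : 4 ≤ n) {a : ℝ} (ha : 0 < a)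
    (B : ℝ) :
    ∃ C, 0 ≤ C ∧ ∃ m₀ : ℕ, 1 ≤ m₀ ∧ ∀ m : ℕ, m₀ ≤ m → ∀ c : Coef (m ^ 4),
      ∀ F V : ℕ → C(AddCircle M, ℝ), (F = fun i => trig (M := M) (m ^ 4) i c) →
      (V = fun i => trig (m ^ 4) i (field M (m ^ 4) ((m : ℝ) ^ 3)⁻¹ c)) →
      JetBound n F B → (∀ x, a ≤ F 0 x) →
      ‖V 0‖ ≤ C ∧
      avg (((2 * n - 3 : ℕ) : C(AddCircle M, ℝ)) * F 0 ^ (2 * n - 3 - 1) * V 0 * (F n * F n)) +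
        2 * avg (F 0 ^ (2 * n - 3) * F n * V n) ≤ C := by
  obtain ⟨Cr, hCr, hr⟩ := exists_residual_bound M hn B
  obtain ⟨Cd, hd⟩ := exists_dispersive_bound M hn B
  obtain ⟨Cv, hCv, hv⟩ := exists_viscosity_bound M hn ha B
  obtain ⟨Ct, hCt, ht⟩ := exists_truncation_bound M hn B
  have hb : 0 < a ^ (2 * n - 3) := by positivity
  set b := a ^ (2 * n - 3) with hbdef
  -- Above this threshold the truncation error, of size `m⁻⁴ y²`, is dominated by the dissipation
  -- `m⁻³ b y²`.
  obtain ⟨k, hk⟩ := exists_nat_ge (4 * Ct / b)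
  have hCV : 0 ≤ Cr + |B| ^ 4 := by positivity
  set CV := Cr + |B| ^ 4
  refine ⟨CV + ((2 * n - 3 : ℕ) * |B| ^ (2 * n - 3 - 1) * CV * |B| * |B| + 2 * |Cd| + 4 * Ct * |B| ^ 2 + Cv),
    by positivity, k + 1, by omega, fun m hm c F V hFdef hVdef hF hlow => ?_⟩
  have hB := hF.nonneg
  rw [abs_of_nonneg hB] at *
  have hmk : 4 * Ct / b ≤ m := hk.trans (by exact_mod_cast (by omega : k ≤ m))
  have hm1 : (1 : ℝ) ≤ m := by exact_mod_cast (by omega : 1 ≤ m)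
  have hJ : IsJet F := by rw [hFdef]; exact isJet_trig _ c
  have hV0 : ‖V 0‖ ≤ CV := by
    have h1 := hr m (by omega) c (by rw [← hFdef]; exact hF)
    have h2 : ‖trig (M := M) (m ^ 4) 0 c ^ 3 * trig (m ^ 4) 3 c‖ ≤ B ^ 4 := by
      have e : trig (M := M) (m ^ 4) 0 c ^ 3 * trig (m ^ 4) 3 c = F 0 ^ 3 * F 3 := by rw [hFdef]
      rw [e]
      have := hF.1 0 (by omega)
      have := hF.1 3 (by omega)
      calc ‖F 0 ^ 3 * F 3‖ ≤ ‖F 0‖ ^ 3 * ‖F 3‖ :=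
            (norm_mul_le _ _).trans (mul_le_mul_of_nonneg_right (norm_pow_le _ _) (norm_nonneg _))
        _ ≤ B ^ 3 * B := by gcongr
        _ = B ^ 4 := by ring
    have h3 : Cr / m ≤ Cr := div_le_self hCr hm1
    have h4 := norm_le_norm_add_norm_sub' (V 0) (trig (M := M) (m ^ 4) 0 c ^ 3 * trig (m ^ 4) 3 c)
    have e : V 0 = trig (m ^ 4) 0 (field M (m ^ 4) ((m : ℝ) ^ 3)⁻¹ c) := by rw [hVdef]
    rw [← e] at h1
    have eC : CV = Cr + B ^ 4 := by simp only [CV, abs_of_nonneg hB]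
    linarith
  have hw : |avg (((2 * n - 3 : ℕ) : C(AddCircle M, ℝ)) * F 0 ^ (2 * n - 3 - 1) * V 0 * (F n * F n))| ≤
      (2 * n - 3 : ℕ) * B ^ (2 * n - 3 - 1) * CV * B * B := by
    refine (abs_avg_mul_mul_le' _ _ _).trans ?_
    rw [mul_assoc ((2 * n - 3 : ℕ) : C(AddCircle M, ℝ)), JetBound.norm_natCast_mul]
    have h1 : ‖F 0 ^ (2 * n - 3 - 1) * V 0‖ ≤ B ^ (2 * n - 3 - 1) * CV := by
      refine (norm_mul_le _ _).trans (mul_le_mul ((norm_pow_le _ _).trans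
        (pow_le_pow_left₀ (norm_nonneg _) (hF.1 0 (by omega)) _)) hV0 (norm_nonneg _) (by positivity))
    have h2 := hF.2
    have h3 := N2_nonneg (F n)
    rw [mul_assoc ((2 * n - 3 : ℕ) : ℝ) _ CV]
    gcongr
  have hVn : V n = dymJ F n - (dymJ F n - proj (m ^ 4) (dymJ F n)) - ((m : ℝ) ^ 3)⁻¹ • F (n + 4) := by
    rw [hVdef, hFdef]
    simp only
    rw [trig_field, add_comm 4 n]
    abel
  have hsum : avg (F 0 ^ (2 * n - 3) * F n * V n) = avg (F 0 ^ (2 * n - 3) * F n * dymJ F n) -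
      avg (F 0 ^ (2 * n - 3) * F n * (dymJ F n - proj (m ^ 4) (dymJ F n))) -
      ((m : ℝ) ^ 3)⁻¹ * avg (F 0 ^ (2 * n - 3) * F n * F (n + 4)) := by
    rw [hVn, mul_sub, mul_sub, map_sub, map_sub, mul_smul_comm, map_smul, smul_eq_mul]
  have q1 := (le_abs_self _).trans hw
  have q2 := (le_abs_self _).trans ((hd F hJ hF).trans (le_abs_self Cd))
  have q3 := (neg_abs_le _).trans' (neg_le_neg (ht m (by omega) c F hFdef hF))
  have q4 := hv F hJ hF hlow
  set y := N2 (F (n + 2)) with hy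
  set ε := ((m : ℝ) ^ 3)⁻¹ with hε
  have hε0 : 0 < ε := by positivity
  have hε1 : ε ≤ 1 := inv_le_one_of_one_le₀ (one_le_pow₀ hm1)
  have q5 : ε * (-2 * avg (F 0 ^ (2 * n - 3) * F n * F (n + 4))) ≤ ε * (-b * y ^ 2 + Cv) :=
    mul_le_mul_of_nonneg_left q4 hε0.le
  have q6 : 2 * (Ct / m ^ 4 * (B + y) ^ 2) ≤ 4 * Ct * B ^ 2 + ε * b * y ^ 2 := by
    have h1 : (B + y) ^ 2 ≤ 2 * (B ^ 2 + y ^ 2) := by nlinarith [sq_nonneg (B - y)]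
    have h2 : 4 * (Ct / m ^ 4) ≤ ε * b := by
      rw [div_le_iff₀ hb] at hmk
      rw [hε, inv_mul_eq_div, ← mul_div_assoc, div_le_div_iff₀ (by positivity) (by positivity)]
      calc 4 * Ct * m ^ 3 ≤ (m * b) * m ^ 3 := by gcongr
        _ = b * m ^ 4 := by ring
    have h3 : Ct / m ^ 4 ≤ Ct := div_le_self hCt (one_le_pow₀ hm1)
    have h4 : 0 ≤ Ct / m ^ 4 := by positivity
    have h5 := mul_le_mul_of_nonneg_left h1 h4
    have h6 := mul_le_mul_of_nonneg_right h2 (sq_nonneg y)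
    have h7 := mul_le_mul_of_nonneg_right h3 (sq_nonneg B)
    nlinarith
  have q7 : ε * Cv ≤ Cv := mul_le_of_le_one_left hCv hε1
  refine ⟨hV0.trans (le_add_of_nonneg_right (by positivity)), ?_⟩
  rw [hsum]
  have : dymJ F n = mulJ (powJ F 3) (fun i => F (3 + i)) n := rfl
  rw [← this] at q2
  nlinarith

/-! ### Differential inequalities and weighted `L²` stability -/

theorem antitoneOn_of_hasDerivWithinAt_nonpos {T : ℝ} {f f' : ℝ → ℝ}
    (h : ∀ t ∈ Set.Icc 0 T, HasDerivWithinAt f (f' t) (Set.Icc 0 T) t)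
    (h' : ∀ t ∈ Set.Icc 0 T, f' t ≤ 0) : AntitoneOn f (Set.Icc 0 T) := by
  have hd : ∀ t ∈ interior (Set.Icc 0 T), HasDerivAt f (f' t) t := fun t ht => by
    have ht' := interior_subset ht
    rw [interior_Icc] at ht
    exact (h t ht').hasDerivAt (Icc_mem_nhds ht.1 ht.2)
  refine antitoneOn_of_deriv_nonpos (convex_Icc 0 T) (fun t ht => (h t ht).continuousWithinAt)
    (fun t ht => (hd t ht).differentiableAt.differentiableWithinAt) fun t ht => ?_
  rw [(hd t ht).deriv]
  exact h' t (interior_subset ht)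

theorem le_add_mul_of_hasDerivWithinAt {T C : ℝ} {f f' : ℝ → ℝ}
    (h : ∀ t ∈ Set.Icc 0 T, HasDerivWithinAt f (f' t) (Set.Icc 0 T) t)
    (h' : ∀ t ∈ Set.Icc 0 T, f' t ≤ C) {t : ℝ} (ht : t ∈ Set.Icc 0 T) : f t ≤ f 0 + C * t := by
  have := antitoneOn_of_hasDerivWithinAt_nonpos (f := fun t => f t - C * t)
    (f' := fun t => f' t - C * 1)
    (fun t ht => (h t ht).sub ((hasDerivWithinAt_id t _).const_mul C))
    (fun t ht => by linarith [h' t ht])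
  have := this (Set.left_mem_Icc.2 (ht.1.trans ht.2)) ht ht.1
  simp only [mul_zero] at this
  linarith

theorem gronwall_Icc {T K L : ℝ} (hK : 0 < K) (hL : 0 ≤ L) {f f' : ℝ → ℝ}
    (h : ∀ t ∈ Set.Icc 0 T, HasDerivWithinAt f (f' t) (Set.Icc 0 T) t)
    (h' : ∀ t ∈ Set.Icc 0 T, f' t ≤ K * f t + L) {t : ℝ} (ht : t ∈ Set.Icc 0 T) :
    f t ≤ (f 0 + L / K) * Real.exp (K * t) := by
  have hexp : ∀ t, HasDerivAt (fun t => Real.exp (-K * t)) (Real.exp (-K * t) * (-K * 1)) t :=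
    fun t => ((hasDerivAt_id t).const_mul (-K)).exp
  have := antitoneOn_of_hasDerivWithinAt_nonpos (f := fun t => (f t + L / K) * Real.exp (-K * t))
    (f' := fun t => f' t * Real.exp (-K * t) + (f t + L / K) * (Real.exp (-K * t) * (-K * 1)))
    (fun t ht => ((h t ht).add_const _).mul (hexp t).hasDerivWithinAt)
    (fun t ht => by
      have h1 := h' t ht
      have e : f' t * Real.exp (-K * t) + (f t + L / K) * (Real.exp (-K * t) * (-K * 1)) =
        Real.exp (-K * t) * (f' t - (K * f t + L)) := by field_simp; ring
      rw [e]
      exact mul_nonpos_of_nonneg_of_nonpos (Real.exp_pos _).le (by linarith))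
  have := this (Set.left_mem_Icc.2 (ht.1.trans ht.2)) ht ht.1
  simp only [mul_zero, Real.exp_zero, mul_one, neg_mul, Real.exp_neg] at this
  rw [← div_eq_mul_inv, div_le_iff₀ (Real.exp_pos _)] at this
  have : 0 ≤ L / K := by positivity
  linarith

theorem hasDerivWithinAt_clm {E G : Type*} [NormedAddCommGroup E] [NormedSpace ℝ E]
    [NormedAddCommGroup G] [NormedSpace ℝ G] (L : E →L[ℝ] G) {f : ℝ → E} {f' : E} {s : Set ℝ} {t : ℝ}
    (h : HasDerivWithinAt f f' s t) : HasDerivWithinAt (fun t => L (f t)) (L f') s t :=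
  L.hasFDerivAt.comp_hasDerivWithinAt t h

/-- A curve in `C(X)` which solves the Harry Dym equation up to an error term `e`. -/
structure ApproxSol (T : ℝ) (U U3 e : ℝ → C(AddCircle M, ℝ)) : Prop where
  deriv3 : ∀ t ∈ Set.Icc 0 T, ∃ U1 U2, IsDeriv (U t) U1 ∧ IsDeriv U1 U2 ∧ IsDeriv U2 (U3 t)
  equation : ∀ t ∈ Set.Icc 0 T, HasDerivWithinAt U (U t ^ 3 * U3 t + e t) (Set.Icc 0 T) t

theorem avg_mul_deriv3 {d d1 d2 d3 : C(AddCircle M, ℝ)} (h0 : IsDeriv d d1) (h1 : IsDeriv d1 d2)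
    (h2 : IsDeriv d2 d3) : avg (d * d3) = 0 := by
  have h := avg_dispersive IsDeriv.one IsDeriv.zero IsDeriv.zero h0 h1 h2
  simpa using h

theorem isUnit_of_pos {f : C(AddCircle M, ℝ)} {a : ℝ} (ha : 0 < a) (h : ∀ x, a ≤ f x) : IsUnit f :=
  ContinuousMap.isUnit_iff_forall_ne_zero f |>.2 fun x => (ha.trans_le (h x)).ne'

theorem inverse_apply {f : C(AddCircle M, ℝ)} (h : IsUnit f) (x : AddCircle M) :
    Ring.inverse f x = (f x)⁻¹ := by
  have h1 := congrArg (fun g : C(AddCircle M, ℝ) => g x) (Ring.mul_inverse_cancel f h)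
  simp only [ContinuousMap.mul_apply, ContinuousMap.one_apply] at h1
  exact eq_inv_of_mul_eq_one_right h1

theorem hasDerivWithinAt_inverse {U : ℝ → C(AddCircle M, ℝ)} {U' : C(AddCircle M, ℝ)} {s : Set ℝ}
    {t : ℝ} (hu : IsUnit (U t)) (h : HasDerivWithinAt U U' s t) :
    HasDerivWithinAt (fun t => Ring.inverse (U t)) (-(Ring.inverse (U t) * U' * Ring.inverse (U t)))
      s t := by
  obtain ⟨u, hu⟩ := hu
  have h1 := hasFDerivAt_ringInverse (𝕜 := ℝ) u
  rw [hu] at h1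
  have h2 := h1.comp_hasDerivWithinAt t h
  refine h2.congr_deriv ?_
  rw [← hu, Ring.inverse_unit]
  simp

/-- Weighted `L²` stability of approximate solutions. -/
theorem exists_stability (M : ℝ) [Fact (0 < M)] {a B : ℝ} (ha : 0 < a) (hB : 0 < B) (T : ℝ) :
    ∃ C, 0 ≤ C ∧ ∀ U V U3 V3 e₁ e₂ : ℝ → C(AddCircle M, ℝ), ∀ η : ℝ,
      ApproxSol T U U3 e₁ → ApproxSol T V V3 e₂ →
      (∀ t ∈ Set.Icc 0 T, (∀ x, a ≤ U t x) ∧ ‖U t‖ ≤ B ∧ ‖V t‖ ≤ B ∧ ‖V3 t‖ ≤ B ∧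
        ‖U t ^ 3 * U3 t + e₁ t‖ ≤ B ∧ N2 (e₁ t - e₂ t) ≤ η) →
      ∀ t ∈ Set.Icc 0 T, N2 (U t - V t) ^ 2 ≤ C * (N2 (U 0 - V 0) ^ 2 + η ^ 2) := by
  set K := (3 * (a⁻¹) ^ 4 * B + 2 * (a⁻¹) ^ 3 * (3 * B ^ 2) * B + (a⁻¹) ^ 3) * B ^ 3 with hK
  have hK0 : 0 < K := by positivity
  refine ⟨B ^ 3 * (a⁻¹) ^ 3 * (1 + 1 / K) * Real.exp (K * |T|), by positivity,
    fun U V U3 V3 e₁ e₂ η hU hV hb t₀ ht₀ => ?_⟩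
  set Q := fun t => Ring.inverse (U t) with hQdef
  have hunit : ∀ t ∈ Set.Icc 0 T, IsUnit (U t) := fun t ht => isUnit_of_pos ha (hb t ht).1
  have hQx : ∀ t ∈ Set.Icc 0 T, ∀ x, Q t x = (U t x)⁻¹ := fun t ht x => inverse_apply (hunit t ht) x
  have hQpos : ∀ t ∈ Set.Icc 0 T, ∀ x, 0 < Q t x := fun t ht x => by
    rw [hQx t ht]; exact inv_pos.2 (ha.trans_le ((hb t ht).1 x))
  have hQle : ∀ t ∈ Set.Icc 0 T, ∀ x, Q t x ≤ a⁻¹ := fun t ht x => by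
    rw [hQx t ht]; exact inv_anti₀ ha ((hb t ht).1 x)
  have hQn : ∀ t ∈ Set.Icc 0 T, ‖Q t‖ ≤ a⁻¹ := fun t ht => norm_le_of_forall fun x => by
    rw [abs_of_pos (hQpos t ht x)]; exact hQle t ht x
  have hQU : ∀ t ∈ Set.Icc 0 T, Q t * U t = 1 := fun t ht => Ring.inverse_mul_cancel _ (hunit t ht)
  set d := fun t => U t - V t with hd
  set U' := fun t => U t ^ 3 * U3 t + e₁ t with hU'
  set V' := fun t => V t ^ 3 * V3 t + e₂ t with hV'
  -- The weight `Q³ = U⁻³` cancels the coefficient of the third derivative of `d`. It involves `U`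
  -- alone, so no lower bound on `V` is needed.
  set Φ := fun t => avg (Q t ^ 3 * (d t * d t)) with hΦ
  have hΦd : ∀ t ∈ Set.Icc 0 T, HasDerivWithinAt Φ (avg ((((3 : ℕ) : C(AddCircle M, ℝ)) * Q t ^ (3 - 1) *
      (-(Q t * U' t * Q t))) * (d t * d t) + Q t ^ 3 * ((U' t - V' t) * d t + d t * (U' t - V' t))))
      (Set.Icc 0 T) t := by
    intro t ht
    have h1 := hasDerivWithinAt_inverse (hunit t ht) (hU.equation t ht)
    have h2 := (hU.equation t ht).sub (hV.equation t ht)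
    exact hasDerivWithinAt_clm avg ((h1.fun_pow 3).fun_mul (h2.fun_mul h2))
  have hlow : ∀ t ∈ Set.Icc 0 T, N2 (d t) ^ 2 ≤ B ^ 3 * Φ t := by
    intro t ht
    have e : B ^ 3 * Φ t = avg (B ^ 3 • (Q t ^ 3 * (d t * d t))) := by rw [map_smul, smul_eq_mul]
    rw [N2_sq, e]
    refine avg_mono fun x => ?_
    have hx := (hb t ht).1 x
    have h1 : B⁻¹ ≤ Q t x := by
      rw [hQx t ht]
      exact inv_anti₀ (ha.trans_le hx) ((apply_le_norm _ x).trans (hb t ht).2.1)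
    have h2 : 1 ≤ B ^ 3 * Q t x ^ 3 := by
      rw [← mul_pow]
      refine one_le_pow₀ ?_
      calc (1 : ℝ) = B * B⁻¹ := (mul_inv_cancel₀ hB.ne').symm
        _ ≤ _ := by gcongr
    simp only [ContinuousMap.mul_apply, ContinuousMap.smul_apply, ContinuousMap.pow_apply, smul_eq_mul]
    nlinarith [mul_self_nonneg (d t x)]
  have hrate : ∀ t ∈ Set.Icc 0 T, avg ((((3 : ℕ) : C(AddCircle M, ℝ)) * Q t ^ (3 - 1) *
      (-(Q t * U' t * Q t))) * (d t * d t) + Q t ^ 3 * ((U' t - V' t) * d t + d t * (U' t - V' t)))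
      ≤ K * Φ t + (a⁻¹) ^ 3 * η ^ 2 := by
    intro t ht
    obtain ⟨-, hUB, hVB, hV3B, hU'B, hη⟩ := hb t ht
    obtain ⟨U1, U2, hU0, hU1, hU2⟩ := hU.deriv3 t ht
    obtain ⟨V1, V2, hV0, hV1, hV2⟩ := hV.deriv3 t ht
    have hz := avg_mul_deriv3 (hU0.sub hV0) (hU1.sub hV1) (hU2.sub hV2)
    -- Uses `U³U₃ - V³V₃ = U³(U₃ - V₃) + (U - V)(U² + UV + V²)V₃` and `Q³U³ = 1`. The mean of `d (U₃
    -- - V₃)` vanishes by skewness, and what is left has no derivative of `d`.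
    have e : (((3 : ℕ) : C(AddCircle M, ℝ)) * Q t ^ (3 - 1) * (-(Q t * U' t * Q t))) * (d t * d t) +
        Q t ^ 3 * ((U' t - V' t) * d t + d t * (U' t - V' t)) =
        (-3 : ℝ) • (Q t ^ 4 * U' t * (d t * d t)) + (2 : ℝ) • (d t * (U3 t - V3 t)) +
        (2 : ℝ) • (Q t ^ 3 * (U t ^ 2 + U t * V t + V t ^ 2) * V3 t * (d t * d t)) +
        (2 : ℝ) • (Q t ^ 3 * (d t * (e₁ t - e₂ t))) := by
      ext x
      have hx : Q t x * U t x = 1 := congrArg (fun g : C(AddCircle M, ℝ) => g x) (hQU t ht)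
      simp [hU', hV', hd]
      rw [show (3 : C(AddCircle M, ℝ)) x = 3 from rfl]
      have hx3 : Q t x ^ 3 * U t x ^ 3 = 1 := by rw [← mul_pow, hx, one_pow]
      linear_combination (2 * (U t x - V t x) * (U3 t x - V3 t x)) * hx3
    rw [e]
    simp only [map_add, map_smul, smul_eq_mul]
    rw [hz]
    have hN := N2_nonneg (d t)
    have b1 : |avg (Q t ^ 4 * U' t * (d t * d t))| ≤ (a⁻¹) ^ 4 * B * N2 (d t) * N2 (d t) := by
      refine (abs_avg_mul_mul_le' _ _ _).trans ?_
      have : ‖Q t ^ 4 * U' t‖ ≤ (a⁻¹) ^ 4 * B := (norm_mul_le _ _).trans (mul_le_mul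
        ((norm_pow_le _ _).trans (pow_le_pow_left₀ (norm_nonneg _) (hQn t ht) _)) hU'B
        (norm_nonneg _) (by positivity))
      gcongr
    have b2 : |avg (Q t ^ 3 * (U t ^ 2 + U t * V t + V t ^ 2) * V3 t * (d t * d t))| ≤
        (a⁻¹) ^ 3 * (3 * B ^ 2) * B * N2 (d t) * N2 (d t) := by
      refine (abs_avg_mul_mul_le' _ _ _).trans ?_
      have h1 : ‖U t ^ 2 + U t * V t + V t ^ 2‖ ≤ 3 * B ^ 2 := by
        have p1 : ‖U t ^ 2‖ ≤ B ^ 2 :=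
          (norm_pow_le _ _).trans (pow_le_pow_left₀ (norm_nonneg _) hUB _)
        have p2 : ‖V t ^ 2‖ ≤ B ^ 2 :=
          (norm_pow_le _ _).trans (pow_le_pow_left₀ (norm_nonneg _) hVB _)
        have p3 : ‖U t * V t‖ ≤ B * B :=
          (norm_mul_le _ _).trans (mul_le_mul hUB hVB (norm_nonneg _) hB.le)
        have := norm_add_le (U t ^ 2 + U t * V t) (V t ^ 2)
        have := norm_add_le (U t ^ 2) (U t * V t)
        nlinarith
      have h2 : ‖Q t ^ 3‖ ≤ (a⁻¹) ^ 3 :=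
        (norm_pow_le _ _).trans (pow_le_pow_left₀ (norm_nonneg _) (hQn t ht) _)
      have h3 : ‖Q t ^ 3 * (U t ^ 2 + U t * V t + V t ^ 2) * V3 t‖ ≤ (a⁻¹) ^ 3 * (3 * B ^ 2) * B :=
        (norm_mul_le _ _).trans (mul_le_mul ((norm_mul_le _ _).trans
          (mul_le_mul h2 h1 (norm_nonneg _) (by positivity))) hV3B (norm_nonneg _) (by positivity))
      gcongr
    have b3 : |avg (Q t ^ 3 * (d t * (e₁ t - e₂ t)))| ≤ (a⁻¹) ^ 3 * N2 (d t) * η := by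
      refine (abs_avg_mul_mul_le' _ _ _).trans ?_
      have h2 : ‖Q t ^ 3‖ ≤ (a⁻¹) ^ 3 :=
        (norm_pow_le _ _).trans (pow_le_pow_left₀ (norm_nonneg _) (hQn t ht) _)
      gcongr
      exact N2_nonneg _
    have b1' := (abs_le.1 b1).1
    have b2' := (abs_le.1 b2).2
    have b3' := (abs_le.1 b3).2
    have c1 : 2 * ((a⁻¹) ^ 3 * N2 (d t) * η) ≤ (a⁻¹) ^ 3 * (N2 (d t) ^ 2 + η ^ 2) := by
      have h1 := two_mul_le_add_sq (N2 (d t)) η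
      have h2 : 0 ≤ (a⁻¹) ^ 3 := by positivity
      nlinarith
    have c2 := mul_le_mul_of_nonneg_left (hlow t ht) (by positivity : 0 ≤ 3 * (a⁻¹) ^ 4 * B +
      2 * (a⁻¹) ^ 3 * (3 * B ^ 2) * B + (a⁻¹) ^ 3)
    have e5 : K * Φ t = (3 * (a⁻¹) ^ 4 * B + 2 * (a⁻¹) ^ 3 * (3 * B ^ 2) * B + (a⁻¹) ^ 3) *
        (B ^ 3 * Φ t) := by rw [hK]; ring
    linarith
  have hg := gronwall_Icc hK0 (by positivity) hΦd hrate ht₀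
  have h0 : (0 : ℝ) ∈ Set.Icc 0 T := Set.left_mem_Icc.2 (ht₀.1.trans ht₀.2)
  have hΦ0 : Φ 0 ≤ (a⁻¹) ^ 3 * N2 (U 0 - V 0) ^ 2 := by
    rw [N2_sq, ← smul_eq_mul ((a⁻¹) ^ 3), ← map_smul]
    refine avg_mono fun x => ?_
    simp only [ContinuousMap.mul_apply, ContinuousMap.smul_apply, ContinuousMap.pow_apply, smul_eq_mul]
    exact mul_le_mul_of_nonneg_right (pow_le_pow_left₀ (hQpos 0 h0 x).le (hQle 0 h0 x) 3)
      (mul_self_nonneg _)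
  have hexp : Real.exp (K * t₀) ≤ Real.exp (K * |T|) :=
    Real.exp_le_exp.2 (mul_le_mul_of_nonneg_left (ht₀.2.trans (le_abs_self T)) hK0.le)
  have hN0 := sq_nonneg (N2 (U 0 - V 0))
  have hη0 := sq_nonneg η
  calc N2 (U t₀ - V t₀) ^ 2 ≤ B ^ 3 * Φ t₀ := hlow t₀ ht₀
    _ ≤ B ^ 3 * (((a⁻¹) ^ 3 * N2 (U 0 - V 0) ^ 2 + (a⁻¹) ^ 3 * η ^ 2 / K) * Real.exp (K * |T|)) := by
        refine mul_le_mul_of_nonneg_left (hg.trans ?_) (by positivity)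
        exact mul_le_mul (by linarith) hexp (Real.exp_pos _).le (by positivity)
    _ = B ^ 3 * (a⁻¹) ^ 3 * Real.exp (K * |T|) * (N2 (U 0 - V 0) ^ 2 + 1 / K * η ^ 2) := by ring
    _ ≤ B ^ 3 * (a⁻¹) ^ 3 * Real.exp (K * |T|) * ((1 + 1 / K) * (N2 (U 0 - V 0) ^ 2 + η ^ 2)) := by
        have : 0 ≤ 1 / K := by positivity
        have h1 := mul_nonneg this hN0
        gcongr
        nlinarith
    _ = _ := by ring

/-! ### Galerkin approximations on a common time interval -/

/-- A global solution of a vector field truncated outside a ball. -/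
theorem exists_truncated_ode {E : Type*} [NormedAddCommGroup E] [NormedSpace ℝ E]
    [FiniteDimensional ℝ E] {F : E → E} (hF : ContDiff ℝ 1 F) {R T : ℝ} (hR : 0 < R) (hT : 0 ≤ T)
    (c₀ : E) :
    ∃ c : ℝ → E, c 0 = c₀ ∧ ∀ t ∈ Set.Icc 0 T, ∃ v, HasDerivWithinAt c v (Set.Icc 0 T) t ∧
      (‖c t‖ ≤ R → v = F (c t)) := by
  let χ : ContDiffBump (0 : E) := ⟨R, R + 1, hR, by linarith⟩
  let G : E → E := fun c => χ c • F c
  have hG : ContDiff ℝ 1 G := χ.contDiff.smul hF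
  have hGc : HasCompactSupport G := χ.hasCompactSupport.smul_right
  obtain ⟨K, hK⟩ := ContDiff.lipschitzWith_of_hasCompactSupport hGc hG one_ne_zero
  obtain ⟨L, hL⟩ := hGc.exists_bound_of_continuous hG.continuous
  have hL0 : 0 ≤ L := (norm_nonneg _).trans (hL 0)
  have hPL : IsPicardLindelof (fun _ => G) (⟨0, Set.left_mem_Icc.2 hT⟩ : Set.Icc 0 T) c₀
      (Real.toNNReal (L * T)) 0 (Real.toNNReal L) K := by
    refine ⟨fun t _ => hK.lipschitzOnWith, fun x _ => continuousOn_const, fun t _ x _ => ?_, ?_⟩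
    · rw [Real.coe_toNNReal _ hL0]; exact hL x
    · simp [Real.coe_toNNReal _ hL0, Real.coe_toNNReal _ (mul_nonneg hL0 hT), hT]
  obtain ⟨c, hc0, hc⟩ := hPL.exists_eq_forall_mem_Icc_hasDerivWithinAt
    (x := c₀) (Metric.mem_closedBall_self (by simp))
  refine ⟨c, hc0, fun t ht => ⟨_, hc t ht, fun h => ?_⟩⟩
  have : χ (c t) = 1 := χ.one_of_mem_closedBall (by simpa using h)
  simp [G, this]

/-- At the first time where `g` reaches `1`, continuity gives `g ≤ 1` up to and including that time,
and the hypothesis contradicts it. -/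
theorem bootstrap {g : ℝ → ℝ} {T : ℝ} (hg : ContinuousOn g (Set.Icc 0 T)) (h0 : g 0 ≤ 1)
    (h : ∀ t ∈ Set.Icc 0 T, (∀ s ∈ Set.Icc 0 t, g s ≤ 1) → g t < 1) :
    ∀ t ∈ Set.Icc 0 T, g t < 1 := by
  by_contra hc
  push Not at hc
  obtain ⟨t₁, ht₁, hgt₁⟩ := hc
  have hclosed : IsClosed (Set.Icc 0 T ∩ g ⁻¹' Set.Ici 1) :=
    hg.preimage_isClosed_of_isClosed isClosed_Icc isClosed_Ici
  have hcomp : IsCompact (Set.Icc 0 T ∩ g ⁻¹' Set.Ici 1) :=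
    isCompact_Icc.of_isClosed_subset hclosed Set.inter_subset_left
  obtain ⟨t, ⟨ht, hgt⟩, hmin⟩ := hcomp.exists_isLeast ⟨t₁, ht₁, hgt₁⟩
  have hlt : ∀ s ∈ Set.Ico 0 t, g s < 1 := fun s hs => by
    by_contra hcs
    exact absurd (hmin ⟨⟨hs.1, hs.2.le.trans ht.2⟩, not_lt.1 hcs⟩) (not_le.2 hs.2)
  refine absurd (h t ht fun s hs => ?_) (not_lt.2 hgt)
  rcases hs.2.lt_or_eq with hst | rfl
  · exact (hlt s ⟨hs.1, hst⟩).le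
  · rcases ht.1.eq_or_lt with h1 | h1
    · rwa [← h1]
    · have hcw : ContinuousWithinAt g (Set.Ico 0 s) s :=
        (hg s ht).mono fun r hr => ⟨hr.1, hr.2.le.trans ht.2⟩
      refine hcw.closure_le ?_ continuousWithinAt_const fun r hr => (hlt r hr).le
      rw [closure_Ico h1.ne]
      exact Set.right_mem_Icc.2 h1.le

theorem contDiff_field (N : ℕ) (ε : ℝ) : ContDiff ℝ 1 (field M N ε) := by
  unfold field
  have h (i : ℕ) : ContDiff ℝ 1 fun c : Coef N => trig (M := M) N i c :=
    ContinuousLinearMap.contDiff (𝕜 := ℝ) (E := Coef N) (F := C(AddCircle M, ℝ)) (trig N i)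
  exact ((coef N).contDiff.comp (((h 0).pow 3).mul (h 3))).sub
    (((coef N).contDiff.comp (h 4)).const_smul ε)

/-- A sup bound on the function keeps its coefficients inside the ball where the cut-off field is
the true one; hence the radius `2 * (S + a)` in `exists_galerkin`. -/
theorem norm_coef_le (N : ℕ) (c : Coef N) : ‖c‖ ≤ 2 * ‖trig (M := M) N 0 c‖ := by
  refine (pi_norm_le_iff_of_nonneg (by positivity)).2 fun k => ?_
  conv_lhs => rw [← coef_trig (M := M) N c]
  exact abs_hc_le k.1 _

/-- Galerkin approximations exist on a common time interval with uniform bounds. -/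
theorem exists_galerkin (M : ℝ) [Fact (0 < M)] {n : ℕ} (hn : 4 ≤ n) {a S K₀ : ℝ} (ha : 0 < a)
    (hS : 0 ≤ S) :
    ∃ T B C : ℝ, 0 < T ∧ 0 ≤ C ∧ ∃ m₀ : ℕ, 1 ≤ m₀ ∧ ∀ m : ℕ, m₀ ≤ m → ∀ c₀ : Coef (m ^ 4),
      (∀ x, 3 / 4 * a ≤ trig (M := M) (m ^ 4) 0 c₀ x) → ‖trig (M := M) (m ^ 4) 0 c₀‖ ≤ S →
      N2 (trig (M := M) (m ^ 4) n c₀) ≤ K₀ →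
      ∃ c : ℝ → Coef (m ^ 4), c 0 = c₀ ∧ ∀ t ∈ Set.Icc 0 T,
        HasDerivWithinAt c (field M (m ^ 4) ((m : ℝ) ^ 3)⁻¹ (c t)) (Set.Icc 0 T) t ∧
        JetBound n (fun i => trig (M := M) (m ^ 4) i (c t)) B ∧
        (∀ x, 5 / 8 * a ≤ trig (M := M) (m ^ 4) 0 (c t) x) ∧
        ‖trig (M := M) (m ^ 4) 0 (c t) - trig (m ^ 4) 0 c₀‖ ≤ C * t ∧
        avg (trig (M := M) (m ^ 4) 0 (c t) ^ (2 * n - 3) *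
          (trig (m ^ 4) n (c t) * trig (m ^ 4) n (c t))) ≤
        avg (trig (M := M) (m ^ 4) 0 c₀ ^ (2 * n - 3) *
          (trig (m ^ 4) n c₀ * trig (m ^ 4) n c₀)) + C * t := by
  have hM0 : 0 < M := Fact.out
  have hb : 0 < (a / 2) ^ (2 * n - 3) := by positivity
  set b := (a / 2) ^ (2 * n - 3) with hbdef
  -- Chosen so that `b K²` exceeds the largest possible initial energy by `2`. On `[0, T]` the
  -- energy gains at most `1`, so the bound by `K` is never attained.
  set K := Real.sqrt ((S ^ (2 * n - 3) * K₀ ^ 2 + 2) / b) with hK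
  have hKpos : 0 < K := Real.sqrt_pos.2 (by positivity)
  have hKsq : b * K ^ 2 = S ^ (2 * n - 3) * K₀ ^ 2 + 2 := by
    rw [hK, Real.sq_sqrt (by positivity)]
    field_simp
  set B := S + a + (1 + M) ^ n * K with hBdef
  obtain ⟨C, hC, m₀, hm₀, hrate⟩ := exists_energy_rate M hn (a := a / 2) (by positivity) B
  set T := min (a / 16) 1 / (C + 1) with hTdef
  have hT : 0 < T := by positivity
  -- Over time `T` the function moves by at most `a / 16`, half of the allowed `a / 8`, and the
  -- energy grows by at most `1`.
  have hCT : C * T ≤ min (a / 16) 1 := by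
    rw [hTdef, mul_div_assoc', div_le_iff₀ (by positivity), mul_comm]
    have : 0 < min (a / 16) 1 := by positivity
    nlinarith
  refine ⟨T, B, C, hT, hC, m₀, hm₀, fun m hm c₀ hlow hSup hK₀ => ?_⟩
  obtain ⟨c, hc0, hc⟩ := exists_truncated_ode (contDiff_field (M := M) (m ^ 4) ((m : ℝ) ^ 3)⁻¹)
    (R := 2 * (S + a)) (by positivity) hT.le c₀
  have hcc : ContinuousOn c (Set.Icc 0 T) := fun t ht => by
    obtain ⟨v, hv, -⟩ := hc t ht
    exact hv.continuousWithinAt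
  set U := fun t => trig (M := M) (m ^ 4) 0 (c t) with hU
  set W := fun t => trig (M := M) (m ^ 4) n (c t) with hW
  have hUc : ContinuousOn U (Set.Icc 0 T) := (trig (m ^ 4) 0).continuous.comp_continuousOn hcc
  have hWc : ContinuousOn W (Set.Icc 0 T) := (trig (m ^ 4) n).continuous.comp_continuousOn hcc
  have hE0 : avg (U 0 ^ (2 * n - 3) * (W 0 * W 0)) ≤ S ^ (2 * n - 3) * K₀ ^ 2 := by
    refine (le_abs_self _).trans ((abs_avg_mul_mul_le' _ _ _).trans ?_)
    simp only [hU, hW, hc0]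
    have h1 := (norm_pow_le (trig (M := M) (m ^ 4) 0 c₀) (2 * n - 3)).trans
      (pow_le_pow_left₀ (norm_nonneg _) hSup _)
    have h2 := N2_nonneg (trig (M := M) (m ^ 4) n c₀)
    have h3 : 0 ≤ K₀ := h2.trans hK₀
    rw [sq, ← mul_assoc]
    gcongr
  have hElow : ∀ t, (∀ x, a / 2 ≤ U t x) →
      b * N2 (W t) ^ 2 ≤ avg (U t ^ (2 * n - 3) * (W t * W t)) := fun t h3 => by
    rw [N2_sq, ← smul_eq_mul, ← map_smul]
    refine avg_mono fun x => ?_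
    simp only [ContinuousMap.smul_apply, ContinuousMap.mul_apply, ContinuousMap.pow_apply, smul_eq_mul]
    exact mul_le_mul_of_nonneg_right (pow_le_pow_left₀ (by positivity) (h3 x) _) (mul_self_nonneg _)
  -- The condition `g ≤ 1` holds both bootstrap assumptions: displacement at most `a / 8`, which
  -- leaves the lower bound `3/4 a - 1/8 a = 5/8 a`, and `L²` norm of order `n` at most `K`.
  set g := fun t => max (‖U t - U 0‖ / (a / 8)) (N2 (W t) / K) with hg
  have hgc : ContinuousOn g (Set.Icc 0 T) := by
    refine ContinuousOn.sup ((hUc.sub continuousOn_const).norm.div_const _) (ContinuousOn.div_const ?_ _)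
    exact Real.continuous_sqrt.comp_continuousOn (avg.continuous.comp_continuousOn (hWc.mul hWc))
  have key : ∀ t ∈ Set.Icc 0 T, g t ≤ 1 →
      HasDerivWithinAt c (field M (m ^ 4) ((m : ℝ) ^ 3)⁻¹ (c t)) (Set.Icc 0 T) t ∧
        JetBound n (fun i => trig (M := M) (m ^ 4) i (c t)) B ∧ (∀ x, 5 / 8 * a ≤ U t x) := by
    intro t ht hgt
    have h1 : ‖U t - U 0‖ ≤ a / 8 := by
      have := (le_max_left _ _).trans hgt
      rwa [div_le_one (by positivity)] at this
    have h2 : N2 (W t) ≤ K := by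
      have := (le_max_right _ _).trans hgt
      rwa [div_le_one hKpos] at this
    have h3 : ‖U 0‖ ≤ S := by simpa only [hU, hc0] using hSup
    have h4 : ‖U t‖ ≤ S + a := by
      have := norm_le_norm_add_norm_sub' (U t) (U 0)
      linarith
    refine ⟨?_, (isJet_trig (m ^ 4) (c t)).jetBound h4 h2, fun x => ?_⟩
    · obtain ⟨v, hv, hv'⟩ := hc t ht
      rw [← hv' ((norm_coef_le (M := M) _ _).trans (by gcongr))]
      exact hv
    · have h5 := ((U t - U 0).norm_coe_le_norm x).trans h1
      have h6 := hlow x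
      have h7 := (abs_le.1 h5).1
      have h8 : U 0 x = trig (M := M) (m ^ 4) 0 c₀ x := by simp only [hU, hc0]
      rw [ContinuousMap.sub_apply, h8] at h7
      linarith
  have est : ∀ t ∈ Set.Icc 0 T, (∀ s ∈ Set.Icc 0 t, g s ≤ 1) →
      ‖U t - U 0‖ ≤ C * t ∧ avg (U t ^ (2 * n - 3) * (W t * W t)) ≤
        avg (U 0 ^ (2 * n - 3) * (W 0 * W 0)) + C * t := by
    intro t ht hgt
    have hsub : Set.Icc 0 t ⊆ Set.Icc 0 T := Set.Icc_subset_Icc le_rfl ht.2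
    have hder : ∀ (i : ℕ), ∀ s ∈ Set.Icc 0 t, HasDerivWithinAt (fun s => trig (M := M) (m ^ 4) i (c s))
        (trig (m ^ 4) i (field M (m ^ 4) ((m : ℝ) ^ 3)⁻¹ (c s))) (Set.Icc 0 t) s := fun i s hs =>
      hasDerivWithinAt_clm _ ((key s (hsub hs) (hgt s hs)).1.mono hsub)
    have hr : ∀ s ∈ Set.Icc 0 t, _ := fun s hs => hrate m hm (c s) _ _ rfl rfl
      (key s (hsub hs) (hgt s hs)).2.1 (fun x => (by linarith : a / 2 ≤ 5 / 8 * a).trans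
        ((key s (hsub hs) (hgt s hs)).2.2 x))
    constructor
    · have := (convex_Icc 0 t).norm_image_sub_le_of_norm_hasDerivWithin_le (hder 0)
        (fun s hs => (hr s hs).1) (Set.left_mem_Icc.2 ht.1) (Set.right_mem_Icc.2 ht.1)
      simpa [abs_of_nonneg ht.1] using this
    · refine le_add_mul_of_hasDerivWithinAt (f := fun t => avg (U t ^ (2 * n - 3) * (W t * W t)))
        (fun s hs => hasDerivWithinAt_clm avg (((hder 0 s hs).fun_pow (2 * n - 3)).fun_mul
          ((hder n s hs).fun_mul (hder n s hs)))) (fun s hs => ?_) (Set.right_mem_Icc.2 ht.1)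
      refine le_trans (le_of_eq ?_) (hr s hs).2
      rw [map_add]
      congr 1
      have e2 : ∀ f : C(AddCircle M, ℝ), 2 * avg f = avg ((2 : ℝ) • f) := fun f => by
        rw [map_smul, smul_eq_mul]
      rw [e2]
      congr 1
      ext x
      simp
      ring
  have hg0 : g 0 ≤ 1 := by
    simp only [hg, sub_self, norm_zero, zero_div]
    refine max_le zero_le_one ?_
    rw [div_le_one hKpos]
    refine le_of_sq_le_sq ?_ hKpos.le
    have h1 := hElow 0 fun x => by
      have := hlow x
      simp only [hU, hc0]
      linarith
    by_contra hcon
    have := mul_le_mul_of_nonneg_left (not_le.1 hcon).le hb.le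
    linarith
  have hg1 := bootstrap hgc hg0 fun t ht hgt => by
    obtain ⟨h1, h2⟩ := est t ht hgt
    have hCt : C * t ≤ min (a / 16) 1 := (mul_le_mul_of_nonneg_left ht.2 hC).trans hCT
    refine max_lt ?_ ?_
    · rw [div_lt_one (by positivity)]
      have := hCt.trans (min_le_left _ _)
      linarith
    · rw [div_lt_one hKpos]
      refine lt_of_pow_lt_pow_left₀ 2 hKpos.le ?_
      have h3 := (key t ht (hgt t (Set.right_mem_Icc.2 ht.1))).2.2
      have h4 := hElow t fun x => (by linarith : a / 2 ≤ 5 / 8 * a).trans (h3 x)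
      have := hCt.trans (min_le_right _ _)
      by_contra hcon
      have := mul_le_mul_of_nonneg_left (not_lt.1 hcon) hb.le
      linarith
  refine ⟨c, hc0, fun t ht => ?_⟩
  obtain ⟨h1, h2, h3⟩ := key t ht (hg1 t ht).le
  obtain ⟨h4, h5⟩ := est t ht fun s hs => (hg1 s ⟨hs.1, hs.2.trans ht.2⟩).le
  simp only [hU, hW, hc0] at h3 h4 h5
  exact ⟨h1, h2, h3, h4, h5⟩

/-! ### Sobolev bounds by coefficients, and interpolation into `C³` -/

/-- The squared Sobolev norm of order `n` is at most `W`. -/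
def SobLe (n : ℕ) (f : C(AddCircle M, ℝ)) (W : ℝ) : Prop :=
  ∀ s : Finset ℤ, ∑ k ∈ s, (1 + wn M k ^ 2) ^ n * hc k f ^ 2 ≤ W

namespace SobLe

variable {n : ℕ} {f g : C(AddCircle M, ℝ)} {W W' : ℝ}

theorem nonneg (h : SobLe n f W) : 0 ≤ W := by simpa using h ∅

theorem mono (h : SobLe n f W) (hW : W ≤ W') : SobLe n f W' := fun s => (h s).trans hW

theorem of_abs_hc_le (h : SobLe n f W) (hg : ∀ k, |hc k g| ≤ |hc k f|) : SobLe n g W := fun s =>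
  (Finset.sum_le_sum fun k _ => mul_le_mul_of_nonneg_left (sq_le_sq.2 (hg k))
    (by positivity)).trans (h s)

theorem sub (hf : SobLe n f W) (hg : SobLe n g W') : SobLe n (f - g) (2 * (W + W')) := fun s => by
  refine le_trans ?_ (mul_le_mul_of_nonneg_left (add_le_add (hf s) (hg s)) zero_le_two)
  rw [← Finset.sum_add_distrib, Finset.mul_sum]
  refine Finset.sum_le_sum fun k _ => ?_
  rw [map_sub, ← mul_add, mul_left_comm]
  refine mul_le_mul_of_nonneg_left ?_ (by positivity)
  nlinarith [sq_nonneg (hc k f + hc k g)]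

theorem of_le {m : ℕ} (hmn : m ≤ n) (h : SobLe n f W) : SobLe m f W := fun s =>
  (Finset.sum_le_sum fun k _ => mul_le_mul_of_nonneg_right
    (pow_le_pow_right₀ (by nlinarith [sq_nonneg (wn M k)]) hmn) (sq_nonneg _)).trans (h s)

/-- Each finite partial sum is continuous for the sup norm. Thus `H^n` bounds survive uniform limits
without any weak compactness, which is the reason for quantifying over finite sets. -/
theorem of_tendsto {F : ℕ → C(AddCircle M, ℝ)} (h : ∀ᶠ i in Filter.atTop, SobLe n (F i) W)
    (hF : Filter.Tendsto F Filter.atTop (𝓝 f)) : SobLe n f W := fun s => by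
  refine le_of_tendsto (x := Filter.atTop) (f := fun i => ∑ k ∈ s, (1 + wn M k ^ 2) ^ n * hc k (F i) ^ 2)
    (tendsto_finsetSum _ fun k _ => ?_) (h.mono fun i hi => hi s)
  exact ((((hc k).continuous.tendsto f).comp hF).pow 2).const_mul _

theorem N2_le (h : SobLe n f W) : N2 f ^ 2 ≤ W :=
  hasSum_le_of_sum_le (hasSum_hc_sq f) fun s =>
    (Finset.sum_le_sum fun k _ => le_mul_of_one_le_left (sq_nonneg _)
      (one_le_pow₀ (by nlinarith [sq_nonneg (wn M k)]))).trans (h s)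

theorem sub_proj (h : SobLe n f W) (N : ℕ) : SobLe n (f - HarryDym.proj N f) W := by
  refine h.of_abs_hc_le fun k => ?_
  rw [map_sub, hc_proj]
  split_ifs <;> simp

theorem N2_trig_le (h : SobLe n f W) {i : ℕ} (hi : i ≤ n) (N : ℕ) :
    N2 (trig (M := M) N i (coef N f)) ^ 2 ≤ W := by
  rw [N2_trig_sq]
  simp only [coef_apply]
  rw [Finset.sum_coe_sort (Finset.Icc (-(N : ℤ)) N) fun k => (wn M k ^ 2) ^ i * hc k f ^ 2]
  refine (Finset.sum_le_sum fun k _ => mul_le_mul_of_nonneg_right ?_ (sq_nonneg _)).trans (h _)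
  have hx := sq_nonneg (wn M k)
  exact (pow_le_pow_left₀ hx (by linarith) i).trans (pow_le_pow_right₀ (by linarith) hi)

theorem N2_sub_proj_le (h : SobLe n f W) (hn : 1 ≤ n) (N : ℕ) :
    wn M N ^ 2 * N2 (f - HarryDym.proj N f) ^ 2 ≤ W := by
  have h1 := (hasSum_hc_sq (f - HarryDym.proj N f)).mul_left (wn M N ^ 2)
  refine hasSum_le_of_sum_le h1 fun s => (Finset.sum_le_sum fun k _ => ?_).trans (h s)
  rw [map_sub, hc_proj]
  split_ifs with hk
  · rw [sub_self]
    have : 0 ≤ (1 + wn M k ^ 2) ^ n * hc k f ^ 2 := by positivity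
    simpa
  · rw [sub_zero]
    refine mul_le_mul_of_nonneg_right ((le_wn_sq hk).trans ?_) (sq_nonneg _)
    have hx := sq_nonneg (wn M k)
    exact (by linarith : wn M k ^ 2 ≤ 1 + wn M k ^ 2).trans (le_self_pow₀ (by linarith) (by omega))

end SobLe

/-- Each differentiation exchanges the coefficients at `k` and `-k`, so `e` is the identity or the
negation according to the parity of `i`. -/
theorem IsJet.hc_sq {F : ℕ → C(AddCircle M, ℝ)} (hF : IsJet F) (i : ℕ) :
    ∃ e : ℤ ≃ ℤ, ∀ k, wn M (e k) ^ 2 = wn M k ^ 2 ∧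
      (wn M k ^ 2) ^ i * hc k (F 0) ^ 2 = hc (e k) (F i) ^ 2 := by
  induction i with
  | zero => exact ⟨Equiv.refl ℤ, fun k => by simp⟩
  | succ i ih =>
    obtain ⟨e, he⟩ := ih
    refine ⟨e.trans (Equiv.neg ℤ), fun k => ⟨?_, ?_⟩⟩
    · simp [wn_neg, (he k).1]
    · simp only [Equiv.trans_apply, Equiv.neg_apply]
      rw [(hF i).hc_eq, neg_neg, wn_neg, neg_neg, mul_pow, ← (he k).2, (he k).1]
      ring

theorem sum_hc_sq_le (f : C(AddCircle M, ℝ)) (e : ℤ ≃ ℤ) (s : Finset ℤ) :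
    ∑ k ∈ s, hc (e k) f ^ 2 ≤ N2 f ^ 2 := by
  have h : HasSum (fun k => hc (e k) f ^ 2) (N2 f ^ 2) :=
    (e.hasSum_iff (f := fun k => hc k f ^ 2)).2 (hasSum_hc_sq f)
  exact sum_le_hasSum s (fun k _ => sq_nonneg _) h

theorem one_add_pow_le {x : ℝ} (hx : 0 ≤ x) (n : ℕ) : (1 + x) ^ n ≤ 2 ^ n * (1 + x ^ n) := by
  rcases le_total x 1 with h | h
  · have h1 : (1 + x) ^ n ≤ 2 ^ n := pow_le_pow_left₀ (by linarith) (by linarith) n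
    have : (0 : ℝ) ≤ 2 ^ n * x ^ n := by positivity
    linarith
  · have h1 : (1 + x) ^ n ≤ (2 * x) ^ n := pow_le_pow_left₀ (by linarith) (by linarith) n
    rw [mul_pow] at h1
    have : (0 : ℝ) ≤ 2 ^ n := by positivity
    linarith

theorem IsJet.sobLe {F : ℕ → C(AddCircle M, ℝ)} (hF : IsJet F) (n : ℕ) :
    SobLe n (F 0) (2 ^ n * (N2 (F 0) ^ 2 + N2 (F n) ^ 2)) := fun s => by
  obtain ⟨e, he⟩ := hF.hc_sq n
  have h1 := sum_hc_sq_le (F 0) (Equiv.refl ℤ) s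
  have h2 := sum_hc_sq_le (F n) e s
  refine le_trans ?_ (mul_le_mul_of_nonneg_left (add_le_add h1 h2) (by positivity))
  rw [← Finset.sum_add_distrib, Finset.mul_sum]
  refine Finset.sum_le_sum fun k _ => ?_
  rw [← (he k).2, Equiv.refl_apply]
  have := mul_le_mul_of_nonneg_right (one_add_pow_le (sq_nonneg (wn M k)) n) (sq_nonneg (hc k (F 0)))
  linarith

theorem proj_proj_of_le {N₀ N : ℕ} (h : N₀ ≤ N) (f : C(AddCircle M, ℝ)) :
    proj N (proj N₀ f) = proj N₀ f := by
  refine eq_of_hc_eq fun k => ?_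
  rw [hc_proj, hc_proj]
  by_cases hk : k ∈ Finset.Icc (-(N₀ : ℤ)) N₀
  · rw [if_pos]
    simp only [Finset.mem_Icc] at hk ⊢
    omega
  · simp [hk]

theorem proj_proj_of_ge {N₀ N : ℕ} (h : N₀ ≤ N) (f : C(AddCircle M, ℝ)) :
    proj N₀ (proj N f) = proj N₀ f := by
  refine eq_of_hc_eq fun k => ?_
  rw [hc_proj, hc_proj, hc_proj]
  by_cases hk : k ∈ Finset.Icc (-(N₀ : ℤ)) N₀
  · have : k ∈ Finset.Icc (-(N : ℤ)) N := by
      simp only [Finset.mem_Icc] at hk ⊢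
      omega
    simp [hk, this]
  · simp [hk]

theorem coef_proj_of_ge {N₀ N : ℕ} (h : N₀ ≤ N) (f : C(AddCircle M, ℝ)) :
    coef N₀ (proj N f) = coef N₀ f := by
  have := congrArg (coef N₀) (proj_proj_of_ge h f)
  rwa [proj_apply, coef_trig, proj_apply N₀, coef_trig] at this

theorem proj_trig_coef_of_ge {N₀ N : ℕ} (h : N₀ ≤ N) (i : ℕ) (f : C(AddCircle M, ℝ)) :
    proj N₀ (trig (M := M) N i (coef N f)) = trig (M := M) N₀ i (coef N₀ f) := by
  rw [← (isJet_trig N (coef N f)).trig_coef N₀ i, ← proj_apply, coef_proj_of_ge h]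

theorem trig_coef_sub_proj {N₀ N : ℕ} (h : N₀ ≤ N) (i : ℕ) (f : C(AddCircle M, ℝ)) :
    trig (M := M) N i (coef N (f - proj N₀ f)) = trig (M := M) N i (coef N f) - trig (M := M) N₀ i (coef N₀ f) := by
  rw [map_sub, map_sub, proj_apply N₀ f, (isJet_trig N₀ (coef N₀ f)).trig_coef N i]
  congr 1
  rw [← proj_trig (M := M) N₀ i (coef N₀ f), proj_proj_of_le h]

/-- The tails of the Fourier series of the `n`-th derivative. -/
theorem SobLe.exists_tail {n : ℕ} {f : C(AddCircle M, ℝ)} {W : ℝ} (h : SobLe n f W) {ν : ℝ}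
    (hν : 0 < ν) :
    ∃ N₀ : ℕ, ∀ N, N₀ ≤ N → N2 (trig (M := M) N n (coef N f) - trig (M := M) N₀ n (coef N₀ f)) ≤ ν := by
  -- By Pythagoras the squared norms of the truncations increase with `N`; they are bounded by `W`,
  -- so they converge and their increments control the tails.
  set q : ℕ → ℝ := fun N => N2 (trig (M := M) N n (coef N f)) ^ 2 with hq
  have hsplit : ∀ N₀ N, N₀ ≤ N →
      q N = N2 (trig (M := M) N n (coef N f) - trig (M := M) N₀ n (coef N₀ f)) ^ 2 + q N₀ := fun N₀ N hN => by
    have := N2_sq_eq_add N₀ (trig (M := M) N n (coef N f))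
    rwa [proj_trig_coef_of_ge hN] at this
  have hmono : Monotone q := fun N₀ N hN => by
    rw [hsplit N₀ N hN]
    exact le_add_of_nonneg_left (sq_nonneg _)
  have hbdd : BddAbove (Set.range q) := ⟨W, by rintro _ ⟨N, rfl⟩; exact h.N2_trig_le le_rfl N⟩
  have ht := tendsto_atTop_ciSup hmono hbdd
  obtain ⟨N₀, hN₀⟩ := ((tendsto_order.1 ht).1 (iSup q - ν ^ 2)
    (by linarith [sq_pos_of_pos hν])).exists
  refine ⟨N₀, fun N hN => le_of_sq_le_sq ?_ hν.le⟩
  have h1 := hsplit N₀ N hN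
  have h2 := le_ciSup hbdd N
  linarith

/-- Interpolation of the third derivative between `L²` and `H⁴`. -/
theorem IsJet.interp {F : ℕ → C(AddCircle M, ℝ)} (hF : IsJet F) :
    ‖F 3‖ ^ 8 ≤ 81 * M ^ 4 * N2 (F 0) * N2 (F 4) ^ 7 ∧ ‖F 2‖ ≤ M * ‖F 3‖ ∧ ‖F 1‖ ≤ M ^ 2 * ‖F 3‖ ∧
      ‖F 0‖ ≤ N2 (F 0) + M ^ 3 * ‖F 3‖ := by
  have hM0 := hM.out
  have hz : ∀ i, ‖F (i + 1)‖ ≤ M * N2 (F (i + 2)) := fun i =>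
    (hF (i + 1)).norm_le_of_avg_eq_zero (hF i).avg_eq_zero
  have h2 : ‖F 2‖ ≤ M * ‖F 3‖ := (hz 1).trans (by gcongr; exact N2_le_norm _)
  have h1 : ‖F 1‖ ≤ M ^ 2 * ‖F 3‖ := by
    refine (hz 0).trans ?_
    have := (N2_le_norm (F 2)).trans h2
    calc M * N2 (F 2) ≤ M * (M * ‖F 3‖) := by gcongr
      _ = _ := by ring
  have h0 : ‖F 0‖ ≤ N2 (F 0) + M ^ 3 * ‖F 3‖ := by
    refine (hF 0).norm_le.trans ?_
    have := (N2_le_norm (F 1)).trans h1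
    have : M * N2 (F 1) ≤ M * (M ^ 2 * ‖F 3‖) := by gcongr
    linarith [show M * (M ^ 2 * ‖F 3‖) = M ^ 3 * ‖F 3‖ by ring]
  refine ⟨?_, h2, h1, h0⟩
  have a1 := (hF 0).N2_sq_le (hF 1)
  have a2 := (hF 1).N2_sq_le (hF 2)
  have a3 := (hF 2).N2_sq_le (hF 3)
  have a4 := (hF 3).norm_sq_le
  have a5 : N2 (F 3) ≤ M * N2 (F 4) := (N2_le_norm _).trans (hz 2)
  simp only [zero_add, Nat.reduceAdd] at a1 a2 a3 a4
  have n0 := N2_nonneg (F 0)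
  have n1 := N2_nonneg (F 1)
  have n2 := N2_nonneg (F 2)
  have n3 := N2_nonneg (F 3)
  have n4 := N2_nonneg (F 4)
  generalize N2 (F 0) = x0 at *
  generalize N2 (F 1) = x1 at *
  generalize N2 (F 2) = x2 at *
  generalize N2 (F 3) = x3 at *
  generalize N2 (F 4) = x4 at *
  have b1 : ‖F 3‖ ^ 2 ≤ 3 * M * (x3 * x4) := by nlinarith
  have b2 : x2 ^ 2 ≤ x0 * x4 := by
    rcases n2.eq_or_lt with h | h
    · rw [← h]; simpa using mul_nonneg n0 n4
    · have e1 : x2 ^ 4 ≤ x1 ^ 2 * x3 ^ 2 := by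
        have := pow_le_pow_left₀ (by positivity) a2 2
        nlinarith
      have e2 : x1 ^ 2 * x3 ^ 2 ≤ (x0 * x2) * (x2 * x4) :=
        mul_le_mul a1 a3 (by positivity) (by positivity)
      have e3 : x2 ^ 2 * x2 ^ 2 ≤ x2 ^ 2 * (x0 * x4) := by nlinarith
      exact le_of_mul_le_mul_left e3 (by positivity)
  have b3 : x3 ^ 4 ≤ x0 * x4 ^ 3 := by
    have e1 : (x3 ^ 2) ^ 2 ≤ (x2 * x4) ^ 2 := pow_le_pow_left₀ (by positivity) a3 2
    have e2 := mul_le_mul_of_nonneg_right b2 (sq_nonneg x4)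
    nlinarith
  calc ‖F 3‖ ^ 8 = (‖F 3‖ ^ 2) ^ 4 := by ring
    _ ≤ (3 * M * (x3 * x4)) ^ 4 := pow_le_pow_left₀ (by positivity) b1 4
    _ = 81 * M ^ 4 * x4 ^ 4 * x3 ^ 4 := by ring
    _ ≤ 81 * M ^ 4 * x4 ^ 4 * (x0 * x4 ^ 3) := by gcongr
    _ = _ := by ring

theorem SobLe.N2_le_of_sq {n : ℕ} {f : C(AddCircle M, ℝ)} {K : ℝ} (hK : 0 ≤ K)
    (h : SobLe n f (K ^ 2)) : N2 f ≤ K := le_of_sq_le_sq h.N2_le hK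

theorem SobLe.trig_interp {f : C(AddCircle M, ℝ)} {K : ℝ} (hK : 0 ≤ K)
    (h : SobLe 4 f (K ^ 2)) (N : ℕ) :
    ‖trig (M := M) N 3 (coef N f)‖ ^ 8 ≤ 81 * M ^ 4 * N2 f * K ^ 7 := by
  refine (isJet_trig (M := M) N (coef N f)).interp.1.trans ?_
  have h1 : N2 (trig (M := M) N 4 (coef N f)) ≤ K := le_of_sq_le_sq (h.N2_trig_le le_rfl N) hK
  have h0 := N2_proj_le N f
  have h2 := N2_nonneg f
  have h3 := N2_nonneg (trig (M := M) N 4 (coef N f))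
  have := hM.out
  rw [proj_apply] at h0
  gcongr

theorem norm_trig_le_of_three {c : ℝ} (f : C(AddCircle M, ℝ)) (N : ℕ) (h0 : N2 f ≤ c)
    (h3 : ‖trig (M := M) N 3 (coef N f)‖ ≤ c) {i : ℕ} (hi : i < 4) :
    ‖trig (M := M) N i (coef N f)‖ ≤ (1 + M) ^ 3 * c := by
  have hM0 := hM.out
  have hc : 0 ≤ c := (N2_nonneg f).trans h0
  obtain ⟨-, a2, a1, a0⟩ := (isJet_trig (M := M) N (coef N f)).interp
  have h0' := N2_proj_le N f
  rw [proj_apply] at h0'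
  have e : (1 + M) ^ 3 * c = c + 3 * (M * c) + 3 * (M ^ 2 * c) + M ^ 3 * c := by ring
  have p1 : 0 ≤ M * c := by positivity
  have p2 : 0 ≤ M ^ 2 * c := by positivity
  have p3 : 0 ≤ M ^ 3 * c := by positivity
  have q1 := mul_le_mul_of_nonneg_left h3 hM0.le
  have q2 := mul_le_mul_of_nonneg_left h3 (by positivity : 0 ≤ M ^ 2)
  have q3 := mul_le_mul_of_nonneg_left h3 (by positivity : 0 ≤ M ^ 3)
  rw [e]
  interval_cases i <;> linarith

/-- By `IsJet.interp` the eighth power of the third derivative is linear in the `L²` norm, whence `c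
^ 8` in the threshold. Uniformity in `N` lets the bound pass to limits of partial sums. -/
theorem exists_trig_small (M : ℝ) [Fact (0 < M)] {K δ : ℝ} (hK : 0 ≤ K) (hδ : 0 < δ) :
    ∃ θ, 0 < θ ∧ ∀ f : C(AddCircle M, ℝ), SobLe 4 f (K ^ 2) → N2 f ≤ θ → ∀ N i, i < 4 →
      ‖trig (M := M) N i (coef N f)‖ ≤ δ := by
  have hM0 : 0 < M := Fact.out
  set c := δ / (1 + M) ^ 3 with hc
  have hc0 : 0 < c := by positivity
  refine ⟨min c (c ^ 8 / (81 * M ^ 4 * K ^ 7 + 1)), by positivity, fun f hf hN N i hi => ?_⟩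
  have e : δ = (1 + M) ^ 3 * c := by rw [hc]; field_simp
  rw [e]
  refine norm_trig_le_of_three f N (hN.trans (min_le_left _ _)) ?_ hi
  refine le_of_pow_le_pow_left₀ (by norm_num : (8 : ℕ) ≠ 0) hc0.le ((hf.trig_interp hK N).trans ?_)
  have h1 := hN.trans (min_le_right _ _)
  rw [le_div_iff₀ (by positivity)] at h1
  have := N2_nonneg f
  nlinarith

theorem SobLe.norm_trig_le {f : C(AddCircle M, ℝ)} {K : ℝ} (hK : 0 ≤ K)
    (h : SobLe 4 f (K ^ 2)) (N : ℕ) {i : ℕ} (hi : i < 4) :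
    ‖trig (M := M) N i (coef N f)‖ ≤ (1 + M) ^ 3 * ((1 + 3 * M) * K) := by
  have hM0 := hM.out
  have h0 := h.N2_le_of_sq hK
  refine norm_trig_le_of_three f N (h0.trans (by nlinarith)) ?_ hi
  refine le_of_pow_le_pow_left₀ (by norm_num : (8 : ℕ) ≠ 0) (by positivity)
    ((h.trig_interp hK N).trans ?_)
  have h1 : (3 * M) ^ 4 ≤ (1 + 3 * M) ^ 8 := by
    calc (3 * M) ^ 4 ≤ (1 + 3 * M) ^ 4 := by gcongr; linarith
      _ ≤ _ := pow_le_pow_right₀ (by linarith) (by norm_num)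
  calc 81 * M ^ 4 * N2 f * K ^ 7 ≤ 81 * M ^ 4 * K * K ^ 7 := by gcongr
    _ = (3 * M) ^ 4 * K ^ 8 := by ring
    _ ≤ (1 + 3 * M) ^ 8 * K ^ 8 := by gcongr
    _ = _ := by ring

/-- Functions in `H⁴` have three continuous derivatives, the limits of those of the partial sums. -/
theorem SobLe.exists_derivs {f : C(AddCircle M, ℝ)} {K : ℝ} (hK : 0 ≤ K) (h : SobLe 4 f (K ^ 2)) :
    ∃ G : ℕ → C(AddCircle M, ℝ), G 0 = f ∧
      (∀ i < 4, Filter.Tendsto (fun N => trig (M := M) N i (coef N f)) Filter.atTop (𝓝 (G i))) ∧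
      ∀ i < 3, IsDeriv (G i) (G (i + 1)) := by
  have hω := wn_one_pos (M := M)
  have hcauchy : ∀ i < 4, CauchySeq fun N => trig (M := M) N i (coef N f) := by
    intro i hi
    refine Metric.cauchySeq_iff'.2 fun δ hδ => ?_
    obtain ⟨θ, hθ, hsmall⟩ := exists_trig_small M hK (half_pos hδ)
    obtain ⟨N₀, hN₀⟩ := exists_nat_gt (K / (wn M 1 * θ))
    refine ⟨N₀, fun N hN => ?_⟩
    rw [dist_eq_norm, ← trig_coef_sub_proj hN]
    refine (hsmall _ (h.sub_proj N₀) ?_ N i hi).trans_lt (half_lt_self hδ)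
    have h1 := h.N2_sub_proj_le (by norm_num) N₀
    rw [← mul_pow, wn_natCast] at h1
    have hx := N2_nonneg (f - HarryDym.proj N₀ f)
    have h2 := le_of_sq_le_sq h1 hK
    rw [div_lt_iff₀ (by positivity)] at hN₀
    have hN0pos : 0 < (N₀ : ℝ) := by
      by_contra hc
      have : (N₀ : ℝ) = 0 := le_antisymm (not_lt.1 hc) (by positivity)
      rw [this] at hN₀
      linarith
    by_contra hc
    have h3 := mul_lt_mul_of_pos_left (not_le.1 hc) (by positivity : 0 < wn M 1 * N₀)
    nlinarith
  have hlim : ∀ i, ∃ g, i < 4 →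
      Filter.Tendsto (fun N => trig (M := M) N i (coef N f)) Filter.atTop (𝓝 g) := fun i => by
    by_cases hi : i < 4
    · obtain ⟨g, hg⟩ := cauchySeq_tendsto_of_complete (hcauchy i hi)
      exact ⟨g, fun _ => hg⟩
    · exact ⟨0, fun h => absurd h hi⟩
  choose G hG using hlim
  refine ⟨G, ?_, hG, fun i hi => ?_⟩
  · refine eq_of_hc_eq fun k => ?_
    have h1 := ((hc k).continuous.tendsto _).comp (hG 0 (by norm_num))
    refine tendsto_nhds_unique h1 (tendsto_const_nhds.congr' ?_)
    filter_upwards [Filter.eventually_ge_atTop k.natAbs] with N hN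
    simp only [Function.comp_apply]
    rw [← proj_apply, hc_proj, if_pos]
    rw [Finset.mem_Icc]
    omega
  · exact IsDeriv.of_tendsto (fun N => trig_isDeriv N i _) (hG i (by omega)) (hG (i + 1) (by omega))

theorem SobLe.tendsto_proj {f : C(AddCircle M, ℝ)} {W : ℝ} (h : SobLe 4 f W) :
    Filter.Tendsto (fun N => HarryDym.proj N f) Filter.atTop (𝓝 f) := by
  have h' : SobLe 4 f (Real.sqrt W ^ 2) := by rwa [Real.sq_sqrt h.nonneg]
  obtain ⟨G, hG0, hG, -⟩ := h'.exists_derivs (Real.sqrt_nonneg W)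
  have := hG 0 (by norm_num)
  rwa [hG0] at this

theorem exists_deriv3_small (M : ℝ) [Fact (0 < M)] {K δ : ℝ} (hK : 0 ≤ K) (hδ : 0 < δ) :
    ∃ θ, 0 < θ ∧ ∀ f f₁ f₂ f₃ : C(AddCircle M, ℝ), SobLe 4 f (K ^ 2) → N2 f ≤ θ →
      IsDeriv f f₁ → IsDeriv f₁ f₂ → IsDeriv f₂ f₃ →
      ‖f‖ ≤ δ ∧ ‖f₁‖ ≤ δ ∧ ‖f₂‖ ≤ δ ∧ ‖f₃‖ ≤ δ := by
  obtain ⟨θ, hθ, hs⟩ := exists_trig_small M hK hδ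
  refine ⟨θ, hθ, fun f f₁ f₂ f₃ hf hN h1 h2 h3 => ?_⟩
  obtain ⟨G, rfl, hG, hGd⟩ := hf.exists_derivs hK
  obtain rfl := (hGd 0 (by norm_num)).unique h1
  obtain rfl := (hGd 1 (by norm_num)).unique h2
  obtain rfl := (hGd 2 (by norm_num)).unique h3
  have key : ∀ i < 4, ‖G i‖ ≤ δ := fun i hi =>
    le_of_tendsto (hG i hi).norm (Filter.Eventually.of_forall fun N => hs _ hf hN N i hi)
  exact ⟨key 0 (by norm_num), key 1 (by norm_num), key 2 (by norm_num), key 3 (by norm_num)⟩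

theorem SobLe.norm_deriv3_le {f f₁ f₂ f₃ : C(AddCircle M, ℝ)} {K : ℝ} (hK : 0 ≤ K)
    (hf : SobLe 4 f (K ^ 2)) (h1 : IsDeriv f f₁) (h2 : IsDeriv f₁ f₂) (h3 : IsDeriv f₂ f₃) :
    ‖f‖ ≤ (1 + M) ^ 3 * ((1 + 3 * M) * K) ∧ ‖f₃‖ ≤ (1 + M) ^ 3 * ((1 + 3 * M) * K) := by
  obtain ⟨G, rfl, hG, hGd⟩ := hf.exists_derivs hK
  obtain rfl := (hGd 0 (by norm_num)).unique h1
  obtain rfl := (hGd 1 (by norm_num)).unique h2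
  obtain rfl := (hGd 2 (by norm_num)).unique h3
  have key : ∀ i < 4, ‖G i‖ ≤ (1 + M) ^ 3 * ((1 + 3 * M) * K) := fun i hi =>
    le_of_tendsto (hG i hi).norm (Filter.Eventually.of_forall fun N => hf.norm_trig_le hK N hi)
  exact ⟨key 0 (by norm_num), key 3 (by norm_num)⟩

/-! ### Time derivatives of limits and of pointwise solutions -/

/-- Differentiability on a closed interval from increments. -/
theorem hasDerivWithinAt_of_increment {E : Type*} [NormedAddCommGroup E] [NormedSpace ℝ E] {T : ℝ}
    {u g : ℝ → E} (hg : ContinuousOn g (Set.Icc 0 T))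
    (h : ∀ s ∈ Set.Icc 0 T, ∀ δ, 0 < δ → ∀ r, (∀ x ∈ Set.Icc 0 T, |x - s| ≤ r → ‖g x - g s‖ ≤ δ) →
      ∀ t ∈ Set.Icc 0 T, |t - s| ≤ r → ‖u t - u s - (t - s) • g s‖ ≤ 2 * δ * |t - s|) {s : ℝ}
    (hs : s ∈ Set.Icc 0 T) : HasDerivWithinAt u (g s) (Set.Icc 0 T) s := by
  rw [hasDerivWithinAt_iff_isLittleO, Asymptotics.isLittleO_iff]
  intro c hc
  have hc2 : 0 < c / 2 := by positivity
  obtain ⟨r, hr, hrs⟩ := Metric.continuousOn_iff.1 hg s hs (c / 2) hc2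
  have hmem : Metric.ball s (r / 2) ∈ 𝓝 s := Metric.ball_mem_nhds s (by positivity)
  filter_upwards [mem_nhdsWithin_of_mem_nhds hmem, self_mem_nhdsWithin] with t ht htT
  have h1 := h s hs (c / 2) hc2 (r / 2) (fun x hx hxs => by
    rw [← dist_eq_norm]
    refine (hrs x hx ?_).le
    rw [Real.dist_eq]
    linarith) t htT (by rw [Metric.mem_ball, Real.dist_eq] at ht; exact ht.le)
  rw [Real.norm_eq_abs]
  linarith

theorem norm_increment_le {E : Type*} [NormedAddCommGroup E] [NormedSpace ℝ E] {T : ℝ}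
    {v v' : ℝ → E} (hv : ∀ t ∈ Set.Icc 0 T, HasDerivWithinAt v (v' t) (Set.Icc 0 T) t) {s t r δ : ℝ}
    {a : E} (hs : s ∈ Set.Icc 0 T) (ht : t ∈ Set.Icc 0 T) (hst : |t - s| ≤ r)
    (h : ∀ x ∈ Set.Icc 0 T, |x - s| ≤ r → ‖v' x - a‖ ≤ δ) :
    ‖v t - v s - (t - s) • a‖ ≤ δ * |t - s| := by
  have hsub : Set.uIcc s t ⊆ Set.Icc 0 T := Set.uIcc_subset_Icc hs ht
  have h1 := (convex_uIcc s t).norm_image_sub_le_of_norm_hasDerivWithin_le (C := δ)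
    (f := fun x => v x - x • a) (f' := fun x => v' x - (1 : ℝ) • a)
    (fun x hx => ((hv x (hsub hx)).mono hsub).sub ((hasDerivWithinAt_id x _).smul_const a))
    (fun x hx => by
      rw [one_smul]
      exact h x (hsub hx) ((Set.abs_sub_left_of_mem_uIcc hx).trans hst))
    Set.left_mem_uIcc Set.right_mem_uIcc
  rw [Real.norm_eq_abs] at h1
  refine le_trans (le_of_eq ?_) h1
  congr 1
  rw [sub_smul]
  abel

/-- Limits of solutions of differential equations. -/
theorem hasDerivWithinAt_of_limit {E : Type*} [NormedAddCommGroup E] [NormedSpace ℝ E] {T : ℝ}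
    {v v' : ℕ → ℝ → E} {u g : ℝ → E}
    (hv : ∀ j, ∀ t ∈ Set.Icc 0 T, HasDerivWithinAt (v j) (v' j t) (Set.Icc 0 T) t)
    (hlim : ∀ t ∈ Set.Icc 0 T, Filter.Tendsto (fun j => v j t) Filter.atTop (𝓝 (u t)))
    (hunif : ∀ δ, 0 < δ → ∃ J, ∀ j, J ≤ j → ∀ t ∈ Set.Icc 0 T, ‖v' j t - g t‖ ≤ δ)
    (hg : ContinuousOn g (Set.Icc 0 T)) {s : ℝ} (hs : s ∈ Set.Icc 0 T) :
    HasDerivWithinAt u (g s) (Set.Icc 0 T) s := by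
  refine hasDerivWithinAt_of_increment hg (fun s hs δ hδ r hr t ht hst => ?_) hs
  obtain ⟨J, hJ⟩ := hunif δ hδ
  have h1 : Filter.Tendsto (fun j => ‖v j t - v j s - (t - s) • g s‖) Filter.atTop
      (𝓝 ‖u t - u s - (t - s) • g s‖) :=
    (((hlim t ht).sub (hlim s hs)).sub tendsto_const_nhds).norm
  refine le_of_tendsto h1 ?_
  filter_upwards [Filter.eventually_ge_atTop J] with j hj
  refine norm_increment_le (hv j) hs ht hst fun x hx hxs => ?_
  have := norm_add_le (v' j x - g x) (g x - g s)
  rw [sub_add_sub_cancel] at this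
  linarith [hJ j hj x hx, hr x hx hxs]

/-- Pointwise solutions with a continuous right-hand side are differentiable in `C(X)`. -/
theorem hasDerivWithinAt_of_pointwise {T : ℝ} {u g : ℝ → C(AddCircle M, ℝ)}
    (h : ∀ t ∈ Set.Icc 0 T, ∀ x, HasDerivWithinAt (fun r => u r x) (g t x) (Set.Icc 0 T) t)
    (hg : ContinuousOn g (Set.Icc 0 T)) {s : ℝ} (hs : s ∈ Set.Icc 0 T) :
    HasDerivWithinAt u (g s) (Set.Icc 0 T) s := by
  refine hasDerivWithinAt_of_increment hg (fun s hs δ hδ r hr t ht hst => ?_) hs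
  refine norm_le_of_forall fun x => ?_
  have h1 := norm_increment_le (fun t ht => h t ht x) (a := g s x) hs ht hst
    (δ := 2 * δ) fun y hy hys => by
      have := (g y - g s).norm_coe_le_norm x
      rw [ContinuousMap.sub_apply] at this
      linarith [hr y hy hys]
  simpa using h1

theorem exists_norm_pow_sub_le (M B : ℝ) [Fact (0 < M)] (k : ℕ) :
    ∃ L, 0 ≤ L ∧ ∀ f g : C(AddCircle M, ℝ), ‖f‖ ≤ B → ‖g‖ ≤ B → ‖f ^ k - g ^ k‖ ≤ L * ‖f - g‖ := by
  induction k with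
  | zero => exact ⟨0, le_rfl, fun f g _ _ => by simp⟩
  | succ k ih =>
    obtain ⟨L, hL, h⟩ := ih
    refine ⟨L * |B| + |B| ^ k, by positivity, fun f g hf hg => ?_⟩
    have e : f ^ (k + 1) - g ^ (k + 1) = (f ^ k - g ^ k) * f + g ^ k * (f - g) := by ring
    rw [e, add_mul]
    have hfB := hf.trans (le_abs_self B)
    have hgB := hg.trans (le_abs_self B)
    refine (norm_add_le _ _).trans (add_le_add ?_ ?_)
    · refine (norm_mul_le _ _).trans ?_
      calc ‖f ^ k - g ^ k‖ * ‖f‖ ≤ (L * ‖f - g‖) * |B| :=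
            mul_le_mul (h f g hf hg) hfB (norm_nonneg _) (by positivity)
        _ = _ := by ring
    · refine (norm_mul_le _ _).trans (mul_le_mul_of_nonneg_right ?_ (norm_nonneg _))
      exact (norm_pow_le g k).trans (pow_le_pow_left₀ (norm_nonneg _) hgB k)

/-! ### From energy growth to closeness in `H^n` -/

/-- Quadratic expansion of a weighted energy. -/
theorem mul_N2_sq_le {ρ ρ' w d : C(AddCircle M, ℝ)} {b η η' B : ℝ} (hb : ∀ x, b ≤ ρ x)
    (hE : avg (ρ' * ((w + d) * (w + d))) ≤ avg (ρ * (w * w)) + η) (hρ : ‖ρ - ρ'‖ ≤ η')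
    (hB : N2 (w + d) ≤ B) :
    b * N2 d ^ 2 ≤ η + η' * B ^ 2 - 2 * avg (ρ * (w * d)) := by
  have h1 : b * N2 d ^ 2 ≤ avg (ρ * (d * d)) := by
    rw [N2_sq, ← smul_eq_mul, ← map_smul]
    refine avg_mono fun x => ?_
    simp only [ContinuousMap.smul_apply, ContinuousMap.mul_apply, smul_eq_mul]
    exact mul_le_mul_of_nonneg_right (hb x) (mul_self_nonneg _)
  have h2 : avg ((ρ - ρ') * ((w + d) * (w + d))) ≤ η' * B ^ 2 := by
    refine (le_abs_self _).trans ((abs_avg_mul_mul_le' _ _ _).trans ?_)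
    rw [mul_assoc, ← sq]
    exact mul_le_mul hρ (pow_le_pow_left₀ (N2_nonneg _) hB 2) (by positivity)
      ((norm_nonneg _).trans hρ)
  have e : ρ * (d * d) = ρ' * ((w + d) * (w + d)) + (ρ - ρ') * ((w + d) * (w + d)) -
      ρ * (w * w) - (2 : ℝ) • (ρ * (w * d)) := by ext x; simp; ring
  rw [e] at h1
  simp only [map_add, map_sub, map_smul, smul_eq_mul] at h1
  linarith

theorem exists_small_time (A D E : ℝ) {x y z : ℝ} (hx : 0 < x) (hy : 0 < y) (hz : 0 < z) :
    ∃ η : ℝ, 0 < η ∧ η * A ≤ x ∧ D * η ^ 2 ≤ y ∧ E * η ^ 2 ≤ z := by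
  refine ⟨min 1 (min (x / (|A| + 1)) (min (y / (|D| + 1)) (z / (|E| + 1)))), by positivity, ?_⟩
  set η := min 1 (min (x / (|A| + 1)) (min (y / (|D| + 1)) (z / (|E| + 1))))
  have hη0 : 0 < η := by positivity
  have h1 : η ≤ 1 := min_le_left _ _
  have hx' : η ≤ x / (|A| + 1) := (min_le_right _ _).trans (min_le_left _ _)
  have hy' : η ≤ y / (|D| + 1) := (min_le_right _ _).trans ((min_le_right _ _).trans (min_le_left _ _))
  have hz' : η ≤ z / (|E| + 1) :=
    (min_le_right _ _).trans ((min_le_right _ _).trans (min_le_right _ _))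
  rw [le_div_iff₀ (by positivity)] at hx' hy' hz'
  have hsq : η ^ 2 ≤ η := by nlinarith
  refine ⟨?_, ?_, ?_⟩
  · nlinarith [le_abs_self A]
  · calc D * η ^ 2 ≤ |D| * η := mul_le_mul (le_abs_self D) hsq (by positivity) (abs_nonneg _)
      _ ≤ y := by nlinarith
  · calc E * η ^ 2 ≤ |E| * η := mul_le_mul (le_abs_self E) hsq (by positivity) (abs_nonneg _)
      _ ≤ z := by nlinarith

theorem div_add_one_mul_le {x A : ℝ} (hx : 0 ≤ x) (hA : 0 ≤ A) : x / (A + 1) * A ≤ x := by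
  rw [div_mul_eq_mul_div, div_le_iff₀ (by positivity)]
  nlinarith

/-- The function `w` is controlled only in `L²`, so no derivative may fall on it. It is replaced by
a nearby smooth `G` at cost `ν`; the derivative then moves from `d'` onto `ρ G`, leaving the small
factor `d`. -/
theorem neg_avg_mul_le {ρ ρ₁ w d d' G G' : C(AddCircle M, ℝ)} {D L ν δ B : ℝ} (hρ : IsDeriv ρ ρ₁)
    (hd : IsDeriv d d') (hG : IsDeriv G G') (hρD : ‖ρ‖ ≤ D) (hρ₁D : ‖ρ₁‖ ≤ D) (hGL : ‖G‖ ≤ L)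
    (hGL' : ‖G'‖ ≤ L) (hν : N2 (w - G) ≤ ν) (hd'B : N2 d' ≤ 2 * B) (hδ : N2 d ≤ δ) :
    -avg (ρ * (w * d')) ≤ D * ν * (2 * B) + 2 * D * L * δ := by
  have hD0 := (norm_nonneg _).trans hρD
  have hL0 := (norm_nonneg _).trans hGL
  have e : ρ * (w * d') = ρ * ((w - G) * d') + (ρ * G) * d' := by ring
  have bp := (hρ.mul hG).by_parts hd
  rw [e, map_add]
  have r1 : |avg (ρ * ((w - G) * d'))| ≤ D * ν * (2 * B) :=
    (abs_avg_mul_mul_le' _ _ _).trans (mul_le_mul (mul_le_mul hρD hν (N2_nonneg _) hD0) hd'B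
      (N2_nonneg _) (mul_nonneg hD0 ((N2_nonneg _).trans hν)))
  have r2 : |avg ((ρ₁ * G + ρ * G') * d)| ≤ 2 * D * L * δ := by
    refine (abs_avg_mul_le _ _).trans (mul_le_mul ?_ hδ (N2_nonneg _) (by positivity))
    refine (N2_le_norm _).trans ((norm_add_le _ _).trans ?_)
    have p1 := (norm_mul_le ρ₁ G).trans (mul_le_mul hρ₁D hGL (norm_nonneg _) hD0)
    have p2 := (norm_mul_le ρ G').trans (mul_le_mul hρD hGL' (norm_nonneg _) hD0)
    linarith
  have q1 := (abs_le.1 r1).1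
  have q2 := (abs_le.1 r2).2
  linarith

/-- If the weighted energy of order `n` has hardly grown, and the function has hardly changed
uniformly, then it has hardly changed in the Sobolev norm of order `n`. -/
theorem exists_sobLe_sub (M : ℝ) [Fact (0 < M)] {n : ℕ} (hn : 4 ≤ n) {b B θ : ℝ} (k : ℕ)
    (hb : 0 < b) (hθ : 0 < θ) :
    ∃ ν, 0 < ν ∧ ∀ L, 0 ≤ L → ∃ η, 0 < η ∧ ∀ (N : ℕ) (c₀ c : Coef N) (G G' : C(AddCircle M, ℝ)),
      JetBound n (fun i => trig (M := M) N i c₀) B → JetBound n (fun i => trig (M := M) N i c) B →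
      (∀ x, b ≤ (trig (M := M) N 0 c₀ ^ k) x) → IsDeriv G G' → ‖G‖ ≤ L → ‖G'‖ ≤ L →
      N2 (trig (M := M) N n c₀ - G) ≤ ν →
      avg (trig (M := M) N 0 c ^ k * (trig N n c * trig N n c)) ≤
        avg (trig (M := M) N 0 c₀ ^ k * (trig N n c₀ * trig N n c₀)) + η →
      ‖trig (M := M) N 0 c - trig N 0 c₀‖ ≤ η →
      SobLe n (trig (M := M) N 0 c - trig N 0 c₀) θ := by
  obtain ⟨D, hD0, hD⟩ := JetBound.exists_pow (n := n) M (by omega) B k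
  obtain ⟨P, hP0, hP⟩ := exists_norm_pow_sub_le M B k
  -- The orders `0` and `n` each receive `y`. For order `n` the budget `b y` is split in thirds:
  -- growth of the energy with the change of weight (`η`), approximation of the top derivative by
  -- `G` (`ν`), and the pairing with `G` (`δ`). The tolerance `ν` precedes `L` because `G` is chosen
  -- in terms of `ν`.
  set y := θ / (2 * 2 ^ n) with hy
  have hy0 : 0 < y := by positivity
  have eθ : θ = 2 ^ n * (y + y) := by rw [hy]; field_simp; norm_num
  set ν := b * y / 3 / (4 * D * |B| + 1) with hν
  have hν0 : 0 < ν := by positivity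
  refine ⟨ν, hν0, fun L hL => ?_⟩
  set δ := b * y / 3 / (4 * D * L + 1) with hδ
  have hδ0 : 0 < δ := by positivity
  -- With `N2 ≤ 2 * B` at order `n`, this frequency threshold makes the first interpolation term at
  -- most `δ² / 2`.
  set R := (8 * B ^ 2 + 1) / δ ^ 2 with hR
  have hR0 : 0 < R := by positivity
  obtain ⟨η, hη0, h1, h2, h3⟩ := exists_small_time (1 + P * B ^ 2) (R ^ (n - 1)) 1
    (x := b * y / 3) (y := δ ^ 2 / 2) (z := y) (by positivity) (by positivity) hy0
  refine ⟨η, hη0, fun N c₀ c G G' hc₀ hc hbρ hG hGL hGL' hGν hE hU => ?_⟩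
  have hB0 := hc₀.nonneg
  rw [abs_of_nonneg hB0] at hν
  have edn : ∀ i, trig (M := M) N i (c - c₀) = trig N i c - trig N i c₀ := fun i => map_sub _ _ _
  have hJ := isJet_trig (M := M) N (c - c₀)
  have hpow := hD _ hc₀
  have hpd := (isJet_trig (M := M) N c₀).pow k 0
  set ρ := powJ (fun i => trig (M := M) N i c₀) k 0 with hρ
  set ρ₁ := powJ (fun i => trig (M := M) N i c₀) k (0 + 1) with hρ₁
  have eρ : ρ = trig (M := M) N 0 c₀ ^ k := powJ_zero _ _
  have hρD : ‖ρ‖ ≤ D := hpow.1 0 (by omega)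
  have hρ₁D : ‖ρ₁‖ ≤ D := hpow.1 1 (by omega)
  have hw : trig (M := M) N n c₀ + trig (M := M) N n (c - c₀) = trig N n c := by rw [edn]; abel
  have key := mul_N2_sq_le (ρ := ρ) (ρ' := trig (M := M) N 0 c ^ k) (w := trig (M := M) N n c₀)
    (d := trig (M := M) N n (c - c₀)) (b := b) (η := η) (η' := P * η) (B := B)
    (by rw [eρ]; exact hbρ) (by rw [hw, eρ]; exact hE)
    (by
      rw [eρ]
      refine (hP _ _ (hc₀.1 0 (by omega)) (hc.1 0 (by omega))).trans ?_
      rw [norm_sub_rev]; gcongr) (by rw [hw]; exact hc.2)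
  have hdn : N2 (trig (M := M) N n (c - c₀)) ≤ 2 * B := by
    rw [edn]
    exact (N2_sub_le _ _).trans (by linarith [hc.2, hc₀.2])
  have hd0 : N2 (trig (M := M) N 0 (c - c₀)) ≤ η := by
    rw [edn]; exact (N2_le_norm _).trans hU
  have hdn1 : N2 (trig (M := M) N (n - 1) (c - c₀)) ≤ δ := by
    refine le_of_sq_le_sq ((N2_trig_interp (M := M) (by omega) N (c - c₀) hR0).trans ?_) hδ0.le
    have q1 : R⁻¹ * N2 (trig (M := M) N n (c - c₀)) ^ 2 ≤ δ ^ 2 / 2 := by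
      rw [hR, inv_div, div_mul_eq_mul_div, div_le_iff₀ (by positivity)]
      have := pow_le_pow_left₀ (N2_nonneg _) hdn 2
      nlinarith [sq_nonneg δ]
    have q2 : R ^ (n - 1) * N2 (trig (M := M) N 0 (c - c₀)) ^ 2 ≤ δ ^ 2 / 2 :=
      (mul_le_mul_of_nonneg_left (pow_le_pow_left₀ (N2_nonneg _) hd0 2) (by positivity)).trans h2
    linarith
  have hJn := hJ (n - 1)
  simp only [Nat.sub_add_cancel (show 1 ≤ n by omega)] at hJn
  have hcross := neg_avg_mul_le hpd hJn hG hρD hρ₁D hGL hGL' hGν hdn hdn1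
  have s1 : 2 * (D * ν * (2 * B)) ≤ b * y / 3 := by
    refine le_trans (le_of_eq ?_) (div_add_one_mul_le (by positivity : 0 ≤ b * y / 3)
      (by positivity : 0 ≤ 4 * D * B))
    rw [← hν]; ring
  have s2 : 2 * (2 * D * L * δ) ≤ b * y / 3 := by
    refine le_trans (le_of_eq ?_) (div_add_one_mul_le (by positivity : 0 ≤ b * y / 3)
      (by positivity : 0 ≤ 4 * D * L))
    rw [← hδ]; ring
  have hfin : N2 (trig (M := M) N n (c - c₀)) ^ 2 ≤ y := by
    refine le_of_mul_le_mul_left (a := b) ?_ hb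
    have : η * (1 + P * B ^ 2) = η + P * η * B ^ 2 := by ring
    linarith
  have hfin0 : N2 (trig (M := M) N 0 (c - c₀)) ^ 2 ≤ y := by
    have := pow_le_pow_left₀ (N2_nonneg _) hd0 2
    linarith
  rw [← edn 0, eθ]
  exact (hJ.sobLe n).mono (by gcongr)

/-! ### Convergence of the approximations and local existence -/

theorem norm_cube_mul_sub_le {a b c d : C(AddCircle M, ℝ)} {B δ : ℝ} (ha : ‖a‖ ≤ B) (hc : ‖c‖ ≤ B)
    (hd : ‖d‖ ≤ B) (hac : ‖a - c‖ ≤ δ) (hbd : ‖b - d‖ ≤ δ) :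
    ‖a ^ 3 * b - c ^ 3 * d‖ ≤ 4 * B ^ 3 * δ := by
  have hB := (norm_nonneg _).trans ha
  have hδ := (norm_nonneg _).trans hac
  have e : a ^ 3 * b - c ^ 3 * d = a ^ 3 * (b - d) + (a - c) * ((a * a + a * c + c * c) * d) := by
    ring
  have h1 : ‖a ^ 3‖ ≤ B ^ 3 := (norm_pow_le a 3).trans (pow_le_pow_left₀ (norm_nonneg _) ha 3)
  have h2 : ‖a * a + a * c + c * c‖ ≤ 3 * B ^ 2 := by
    refine (norm_add₃_le).trans ?_
    have p1 := (norm_mul_le a a).trans (mul_le_mul ha ha (norm_nonneg _) hB)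
    have p2 := (norm_mul_le a c).trans (mul_le_mul ha hc (norm_nonneg _) hB)
    have p3 := (norm_mul_le c c).trans (mul_le_mul hc hc (norm_nonneg _) hB)
    nlinarith
  rw [e]
  refine (norm_add_le _ _).trans ?_
  have q1 := (norm_mul_le (a ^ 3) (b - d)).trans (mul_le_mul h1 hbd (norm_nonneg _) (by positivity))
  have q2 := (norm_mul_le (a * a + a * c + c * c) d).trans
    (mul_le_mul h2 hd (norm_nonneg _) (by positivity))
  have q3 := (norm_mul_le (a - c) ((a * a + a * c + c * c) * d)).trans
    (mul_le_mul hac q2 (norm_nonneg _) hδ)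
  calc _ ≤ B ^ 3 * δ + δ * (3 * B ^ 2 * B) := add_le_add q1 q3
    _ = _ := by ring

/-- Approximate solutions that are bounded in `H⁴` and whose initial values and errors converge
have a limit, which is a solution. -/
theorem exists_limit {T a B K : ℝ} (ha : 0 < a) (hB : 0 < B) (hK : 0 ≤ K)
    {F : ℕ → ℝ → ℕ → C(AddCircle M, ℝ)} {e : ℕ → ℝ → C(AddCircle M, ℝ)} {κ : ℕ → ℝ}
    {u₀ : C(AddCircle M, ℝ)} (hF : ∀ j t, IsJet (F j t))
    (hcont : ∀ j i, ContinuousOn (fun t => F j t i) (Set.Icc 0 T))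
    (hsol : ∀ j, ApproxSol T (fun t => F j t 0) (fun t => F j t 3) (e j))
    (hsob : ∀ j, ∀ t ∈ Set.Icc 0 T, SobLe 4 (F j t 0) (K ^ 2))
    (hpos : ∀ j, ∀ t ∈ Set.Icc 0 T, ∀ x, a ≤ F j t 0 x)
    (hbd : ∀ j, ∀ t ∈ Set.Icc 0 T, ‖F j t 0‖ ≤ B ∧ ‖F j t 3‖ ≤ B ∧
      ‖F j t 0 ^ 3 * F j t 3 + e j t‖ ≤ B)
    (he : ∀ j, ∀ t ∈ Set.Icc 0 T, ‖e j t‖ ≤ κ j) (hκ : Filter.Tendsto κ Filter.atTop (𝓝 0))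
    (hu₀ : Filter.Tendsto (fun j => F j 0 0) Filter.atTop (𝓝 u₀)) :
    ∃ u U₃ : ℝ → C(AddCircle M, ℝ), ApproxSol T u U₃ 0 ∧
      ∀ t ∈ Set.Icc 0 T, Filter.Tendsto (fun j => F j t 0) Filter.atTop (𝓝 (u t)) := by
  obtain ⟨C, hC, hst⟩ := exists_stability M ha hB T
  -- Stability makes the sequence Cauchy in `L²` uniformly in time; the `H⁴` bound upgrades this to
  -- uniform convergence of the first three derivatives.
  have hcauchy : ∀ δ, 0 < δ → ∃ J, ∀ i ≥ J, ∀ j ≥ J, ∀ t ∈ Set.Icc 0 T, ∀ l < 4,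
      ‖F i t l - F j t l‖ ≤ δ := by
    intro δ hδ
    obtain ⟨θ, hθ, hs⟩ := exists_deriv3_small M (by positivity : 0 ≤ 2 * K) hδ
    obtain ⟨η, hη, -, h1, -⟩ := exists_small_time 0 (8 * C) 0 (y := θ ^ 2) one_pos
      (by positivity) one_pos
    have ev := ((Metric.tendsto_nhds.1 hu₀ η hη).and (Metric.tendsto_nhds.1 hκ η hη))
    obtain ⟨J, hJ⟩ := Filter.eventually_atTop.1 ev
    refine ⟨J, fun i hi j hj t ht => ?_⟩
    have hi' := hJ i hi
    have hj' := hJ j hj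
    rw [dist_eq_norm, dist_eq_norm, sub_zero] at hi' hj'
    have hη2 : ∀ s ∈ Set.Icc 0 T, N2 (e i s - e j s) ≤ 2 * η := fun s hs => by
      refine (N2_le_norm _).trans ((norm_sub_le _ _).trans ?_)
      have := he i s hs
      have := he j s hs
      have := le_abs_self (κ i)
      have := le_abs_self (κ j)
      have := hi'.2
      have := hj'.2
      rw [Real.norm_eq_abs] at *
      linarith
    have h0 : N2 (F i 0 0 - F j 0 0) ≤ 2 * η := by
      refine (N2_le_norm _).trans ?_
      rw [show F i 0 0 - F j 0 0 = (F i 0 0 - u₀) - (F j 0 0 - u₀) by abel]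
      refine (norm_sub_le _ _).trans ?_
      linarith [hi'.1, hj'.1]
    have hN := hst _ _ _ _ _ _ (2 * η) (hsol i) (hsol j) (fun s hs =>
      ⟨hpos i s hs, (hbd i s hs).1, (hbd j s hs).1, (hbd j s hs).2.1, (hbd i s hs).2.2, hη2 s hs⟩) t ht
    have hN' : N2 (F i t 0 - F j t 0) ≤ θ := by
      refine le_of_sq_le_sq (hN.trans ?_) hθ.le
      have := pow_le_pow_left₀ (N2_nonneg _) h0 2
      calc _ ≤ C * ((2 * η) ^ 2 + (2 * η) ^ 2) := by gcongr
        _ = 8 * C * η ^ 2 := by ring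
        _ ≤ _ := h1
    have hS : SobLe 4 (F i t 0 - F j t 0) ((2 * K) ^ 2) := by
      have := (hsob i t ht).sub (hsob j t ht)
      rwa [show 2 * (K ^ 2 + K ^ 2) = (2 * K) ^ 2 by ring] at this
    obtain ⟨b0, b1, b2, b3⟩ := hs _ _ _ _ hS hN' ((hF i t 0).sub (hF j t 0))
      ((hF i t 1).sub (hF j t 1)) ((hF i t 2).sub (hF j t 2))
    intro l hl
    interval_cases l <;> assumption
  have hex : ∀ l t, ∃ g, t ∈ Set.Icc 0 T → l < 4 →
      Filter.Tendsto (fun j => F j t l) Filter.atTop (𝓝 g) := by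
    intro l t
    by_cases h : t ∈ Set.Icc 0 T ∧ l < 4
    · have : CauchySeq fun j => F j t l := by
        refine Metric.cauchySeq_iff'.2 fun δ hδ => ?_
        obtain ⟨J, hJ⟩ := hcauchy (δ / 2) (half_pos hδ)
        refine ⟨J, fun i hi => ?_⟩
        rw [dist_eq_norm]
        exact (hJ i hi J le_rfl t h.1 l h.2).trans_lt (half_lt_self hδ)
      obtain ⟨g, hg⟩ := cauchySeq_tendsto_of_complete this
      exact ⟨g, fun _ _ => hg⟩
    · exact ⟨0, fun h1 h2 => absurd ⟨h1, h2⟩ h⟩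
  choose G hG using hex
  have hunif : ∀ δ, 0 < δ → ∃ J, ∀ j ≥ J, ∀ t ∈ Set.Icc 0 T, ∀ l < 4, ‖F j t l - G l t‖ ≤ δ := by
    intro δ hδ
    obtain ⟨J, hJ⟩ := hcauchy δ hδ
    refine ⟨J, fun j hj t ht l hl => ?_⟩
    refine le_of_tendsto (tendsto_const_nhds.sub (hG l t ht hl)).norm ?_
    filter_upwards [Filter.eventually_ge_atTop J] with i hi using hJ j hj i hi t ht l hl
  have hGc : ∀ l < 4, ContinuousOn (G l) (Set.Icc 0 T) := by
    intro l hl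
    refine TendstoUniformlyOn.continuousOn (F := fun j t => F j t l) (p := Filter.atTop) ?_
      (Filter.Frequently.of_forall fun j => hcont j l)
    refine Metric.tendstoUniformlyOn_iff.2 fun δ hδ => ?_
    obtain ⟨J, hJ⟩ := hunif (δ / 2) (half_pos hδ)
    filter_upwards [Filter.eventually_ge_atTop J] with j hj t ht
    rw [dist_comm, dist_eq_norm]
    exact (hJ j hj t ht l hl).trans_lt (half_lt_self hδ)
  have hGB : ∀ t ∈ Set.Icc 0 T, ‖G 0 t‖ ≤ B ∧ ‖G 3 t‖ ≤ B := fun t ht =>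
    ⟨le_of_tendsto (hG 0 t ht (by norm_num)).norm (Filter.Eventually.of_forall fun j => (hbd j t ht).1),
      le_of_tendsto (hG 3 t ht (by norm_num)).norm
        (Filter.Eventually.of_forall fun j => (hbd j t ht).2.1)⟩
  refine ⟨G 0, G 3, ⟨fun t ht => ⟨G 1 t, G 2 t, ?_, ?_, ?_⟩, fun t ht => ?_⟩,
    fun t ht => hG 0 t ht (by norm_num)⟩
  · exact IsDeriv.of_tendsto (fun j => hF j t 0) (hG 0 t ht (by norm_num)) (hG 1 t ht (by norm_num))
  · exact IsDeriv.of_tendsto (fun j => hF j t 1) (hG 1 t ht (by norm_num)) (hG 2 t ht (by norm_num))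
  · exact IsDeriv.of_tendsto (fun j => hF j t 2) (hG 2 t ht (by norm_num)) (hG 3 t ht (by norm_num))
  rw [Pi.zero_apply, add_zero]
  refine hasDerivWithinAt_of_limit (v := fun j t => F j t 0) (g := fun t => G 0 t ^ 3 * G 3 t)
    (fun j t ht => (hsol j).equation t ht) (fun t ht => hG 0 t ht (by norm_num)) ?_
    (((hGc 0 (by norm_num)).pow 3).mul (hGc 3 (by norm_num))) ht
  intro δ hδ
  obtain ⟨J₁, hJ₁⟩ := hunif (δ / 2 / (4 * B ^ 3)) (by positivity)
  obtain ⟨J₂, hJ₂⟩ := Filter.eventually_atTop.1 (Metric.tendsto_nhds.1 hκ (δ / 2) (half_pos hδ))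
  refine ⟨max J₁ J₂, fun j hj t ht => ?_⟩
  have h1 := hJ₁ j ((le_max_left _ _).trans hj) t ht
  have h2 := hJ₂ j ((le_max_right _ _).trans hj)
  rw [Real.dist_eq, sub_zero] at h2
  have h3 := norm_cube_mul_sub_le (hbd j t ht).1 (hGB t ht).1 (hGB t ht).2 (h1 0 (by norm_num))
    (h1 3 (by norm_num))
  rw [mul_div_cancel₀ _ (by positivity)] at h3
  rw [add_sub_right_comm]
  refine (norm_add_le _ _).trans ?_
  have := he j t ht
  have := le_abs_self (κ j)
  linarith

/-- Local existence, on a time interval depending only on the lower bound and the Sobolev norm of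
the data. -/
theorem exists_local (M : ℝ) [Fact (0 < M)] {n : ℕ} (hn : 4 ≤ n) {a : ℝ} (ha : 0 < a) (W : ℝ) :
    ∃ T K : ℝ, 0 < T ∧ 0 < K ∧ ∀ u₀ : C(AddCircle M, ℝ), (∀ x, a < u₀ x) → SobLe n u₀ W →
      ∃ u U₃ : ℝ → C(AddCircle M, ℝ), u 0 = u₀ ∧ ApproxSol T u U₃ 0 ∧
        (∀ t ∈ Set.Icc 0 T, SobLe n (u t) (K ^ 2) ∧ ∀ x, 5 / 8 * a ≤ u t x) ∧
        ∀ θ, 0 < θ → ∃ τ, 0 < τ ∧ ∀ t ∈ Set.Icc 0 T, t ≤ τ → SobLe n (u t - u₀) θ := by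
  have hM0 : 0 < M := Fact.out
  obtain ⟨T, B, C, hT, hC, m₀, hm₀, hgal⟩ := exists_galerkin M hn (a := a)
    (S := (1 + M) ^ 3 * ((1 + 3 * M) * Real.sqrt W)) (K₀ := Real.sqrt W) ha (by positivity)
  obtain ⟨Cr, hCr, hres⟩ := exists_residual_bound M hn B
  -- The added `1` ensures `K ≥ 1`, so that `K ≤ K²` and `K²` itself dominates the energy bound.
  set K := 2 ^ n * (B ^ 2 + B ^ 2) + 1 with hK
  have hK1 : 1 ≤ K := by rw [hK]; exact le_add_of_nonneg_left (by positivity)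
  have hKsq : 2 ^ n * (B ^ 2 + B ^ 2) ≤ K ^ 2 := by nlinarith
  refine ⟨T, K, hT, by linarith, fun u₀ hpos hW => ?_⟩
  have hW0 := hW.nonneg
  have hWs : SobLe n u₀ (Real.sqrt W ^ 2) := by rwa [Real.sq_sqrt hW0]
  have hW4 := hWs.of_le hn
  have hproj := hW4.tendsto_proj
  obtain ⟨N₁, hN₁⟩ := Filter.eventually_atTop.1
    (Metric.tendsto_nhds.1 hproj (a / 4) (by positivity))
  -- The shift makes every index admissible for the Galerkin estimate and puts the projected data
  -- within `a / 4` of `u₀`, hence above `3/4 a`.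
  set m : ℕ → ℕ := fun j => m₀ + N₁ + j with hm
  have hm1 : ∀ j, 1 ≤ m j := fun j => by simp only [hm]; omega
  have hmle : ∀ j, j ≤ m j := fun j => by simp only [hm]; omega
  have hm4 : ∀ j, m j ≤ m j ^ 4 := fun j => Nat.le_self_pow (by norm_num) _
  have htend : Filter.Tendsto (fun j => m j ^ 4) Filter.atTop Filter.atTop :=
    Filter.tendsto_atTop_mono (fun j => (hmle j).trans (hm4 j)) Filter.tendsto_id
  have hc : ∀ j, ∃ c : ℝ → Coef (m j ^ 4), c 0 = coef (m j ^ 4) u₀ ∧ _ := fun j =>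
    hgal (m j) (by simp only [hm]; omega) (coef (m j ^ 4) u₀)
      (fun x => by
        have h1 := hN₁ (m j ^ 4) (le_trans (by simp only [hm]; omega) (hm4 j))
        rw [dist_eq_norm] at h1
        have h2 := (proj (m j ^ 4) u₀ - u₀).norm_coe_le_norm x
        rw [ContinuousMap.sub_apply, Real.norm_eq_abs, abs_le] at h2
        rw [← proj_apply]
        linarith [hpos x, h2.1])
      (hW4.norm_trig_le (Real.sqrt_nonneg W) _ (by norm_num))
      (le_of_sq_le_sq (hWs.N2_trig_le le_rfl _) (Real.sqrt_nonneg W))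
  choose c hc0 hc using hc
  have h0T : (0 : ℝ) ∈ Set.Icc 0 T := ⟨le_rfl, hT.le⟩
  set F : ℕ → ℝ → ℕ → C(AddCircle M, ℝ) := fun j t i => trig (m j ^ 4) i (c j t) with hF
  have hJ : ∀ j t, IsJet (F j t) := fun j t => isJet_trig (m j ^ 4) (c j t)
  have hJB : ∀ j, ∀ t ∈ Set.Icc 0 T, JetBound n (F j t) B := fun j t ht => (hc j t ht).2.1
  have hB0 : 0 ≤ B := (hJB 0 0 h0T).nonneg
  have hsobn : ∀ j, ∀ t ∈ Set.Icc 0 T, SobLe n (F j t 0) (K ^ 2) := fun j t ht => by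
    refine ((hJ j t).sobLe n).mono (le_trans ?_ hKsq)
    have h1 := pow_le_pow_left₀ (N2_nonneg _) ((hJB j t ht).N2_le (Nat.zero_le n)) 2
    have h2 := pow_le_pow_left₀ (N2_nonneg _) ((hJB j t ht).2) 2
    gcongr
  set e : ℕ → ℝ → C(AddCircle M, ℝ) := fun j t =>
    trig (m j ^ 4) 0 (field M (m j ^ 4) ((m j : ℝ) ^ 3)⁻¹ (c j t)) - F j t 0 ^ 3 * F j t 3 with he
  have hecancel : ∀ j t, F j t 0 ^ 3 * F j t 3 + e j t =
      trig (m j ^ 4) 0 (field M (m j ^ 4) ((m j : ℝ) ^ 3)⁻¹ (c j t)) := fun j t => by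
    simp only [he]; abel
  have heb : ∀ j, ∀ t ∈ Set.Icc 0 T, ‖e j t‖ ≤ Cr / m j := fun j t ht =>
    hres (m j) (hm1 j) (c j t) (hJB j t ht)
  have heCr : ∀ j, Cr / m j ≤ Cr := fun j => by
    have : (1 : ℝ) ≤ m j := by exact_mod_cast hm1 j
    exact div_le_self hCr this
  have hinit : Filter.Tendsto (fun j => F j 0 0) Filter.atTop (𝓝 u₀) := by
    have := hproj.comp htend
    refine this.congr fun j => ?_
    simp only [hF, hc0, Function.comp_apply, proj_apply]
  obtain ⟨u, U₃, hu, hlim⟩ := exists_limit (T := T) (a := 5 / 8 * a)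
    (B := B + B ^ 4 + Cr + 1) (K := K) (F := F) (e := e) (κ := fun j => Cr / m j) (u₀ := u₀)
    (by positivity) (by positivity) (by linarith) hJ
    (fun j i t ht => (trig (M := M) (m j ^ 4) i).continuous.continuousAt.comp_continuousWithinAt
      (hc j t ht).1.continuousWithinAt)
    (fun j => ⟨fun t _ => ⟨F j t 1, F j t 2, hJ j t 0, hJ j t 1, hJ j t 2⟩, fun t ht => by
      rw [hecancel]
      exact hasDerivWithinAt_clm (trig (M := M) (m j ^ 4) 0) (hc j t ht).1⟩)
    (fun j t ht => (hsobn j t ht).of_le hn) (fun j t ht => (hc j t ht).2.2.1)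
    (fun j t ht => by
      have h0 := (hJB j t ht).1 0 (by omega)
      have h3 := (hJB j t ht).1 3 (by omega)
      have h4 : 0 ≤ B ^ 4 := by positivity
      refine ⟨by linarith, by linarith, (norm_add_le _ _).trans ?_⟩
      have h5 : ‖F j t 0 ^ 3 * F j t 3‖ ≤ B ^ 3 * B := (norm_mul_le _ _).trans
        (mul_le_mul ((norm_pow_le _ 3).trans (pow_le_pow_left₀ (norm_nonneg _) h0 3)) h3
          (norm_nonneg _) (by positivity))
      have := heb j t ht
      have := heCr j
      linarith [show B ^ 3 * B = B ^ 4 by ring])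
    heb
    (tendsto_const_nhds.div_atTop (tendsto_natCast_atTop_atTop.comp
      (Filter.tendsto_atTop_mono hmle Filter.tendsto_id)))
    hinit
  refine ⟨u, U₃, tendsto_nhds_unique (hlim 0 h0T) hinit, hu, fun t ht => ⟨?_, fun x => ?_⟩, ?_⟩
  · exact SobLe.of_tendsto (Filter.Eventually.of_forall fun j => hsobn j t ht) (hlim t ht)
  · refine ge_of_tendsto (((continuous_eval_const x).tendsto (u t)).comp (hlim t ht))
      (Filter.Eventually.of_forall fun j => (hc j t ht).2.2.1 x)
  · intro θ hθ
    obtain ⟨ν, hν, hinc⟩ := exists_sobLe_sub M hn (b := (3 / 4 * a) ^ (2 * n - 3)) (B := B)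
      (2 * n - 3) (by positivity) hθ
    obtain ⟨N₀, htail⟩ := hWs.exists_tail hν
    -- The comparison function `G` is the `n`-th derivative of a fixed truncation of `u₀`. So `η`,
    -- and the time below, do not depend on `j`, and the estimate passes to the limit.
    obtain ⟨η, hη, hinc⟩ := hinc (max ‖trig (M := M) N₀ n (coef N₀ u₀)‖
      ‖trig (M := M) N₀ (n + 1) (coef N₀ u₀)‖) (le_max_of_le_left (norm_nonneg _))
    refine ⟨η / (C + 1), by positivity, fun t ht htτ => ?_⟩
    have hCt : C * t ≤ η := by
      rw [le_div_iff₀ (by positivity)] at htτ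
      linarith [ht.1]
    refine SobLe.of_tendsto (F := fun j => F j t 0 - F j 0 0) ?_ ((hlim t ht).sub hinit)
    filter_upwards [Filter.eventually_ge_atTop N₀] with j hj
    obtain ⟨-, -, -, hsmall, hen⟩ := hc j t ht
    refine hinc (m j ^ 4) (c j 0) (c j t) _ _ (hJB j 0 h0T) (hJB j t ht) (fun x => ?_)
      (trig_isDeriv N₀ n (coef N₀ u₀)) (le_max_left _ _) (le_max_right _ _) ?_ ?_ ?_
    · rw [ContinuousMap.pow_apply]
      refine pow_le_pow_left₀ (by positivity) ?_ _
      rw [hc0, ← proj_apply]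
      have h1 := hN₁ (m j ^ 4) (le_trans (by simp only [hm]; omega) (hm4 j))
      rw [dist_eq_norm] at h1
      have h2 := (proj (m j ^ 4) u₀ - u₀).norm_coe_le_norm x
      rw [ContinuousMap.sub_apply, Real.norm_eq_abs, abs_le] at h2
      linarith [hpos x, h2.1]
    · rw [hc0]
      exact htail _ (hj.trans ((hmle j).trans (hm4 j)))
    · rw [hc0]
      exact hen.trans (by linarith)
    · rw [hc0]
      exact hsmall.trans hCt

/-! ### Uniqueness and the pointwise equation -/

theorem IsDeriv.iteratedDeriv_three {f f₁ f₂ f₃ : C(AddCircle M, ℝ)} (h1 : IsDeriv f f₁)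
    (h2 : IsDeriv f₁ f₂) (h3 : IsDeriv f₂ f₃) (x : ℝ) :
    iteratedDeriv 3 (fun y : ℝ => f (y : AddCircle M)) x = f₃ (x : AddCircle M) := by
  have e1 : deriv (fun y : ℝ => f (y : AddCircle M)) = fun y : ℝ => f₁ (y : AddCircle M) :=
    funext fun y => (h1 y).deriv
  have e2 : deriv (fun y : ℝ => f₁ (y : AddCircle M)) = fun y : ℝ => f₂ (y : AddCircle M) :=
    funext fun y => (h2 y).deriv
  rw [iteratedDeriv_eq_iterate]
  simp only [Function.iterate_succ, Function.iterate_zero, Function.comp_apply, id_eq, e1, e2]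
  exact (h3 x).deriv

/-- Stability of solutions bounded in `H⁴`. -/
theorem exists_stability_exact (M : ℝ) [Fact (0 < M)] {a K : ℝ} (ha : 0 < a) (hK : 0 ≤ K) (T : ℝ) :
    ∃ C, 0 ≤ C ∧ ∀ u v U₃ V₃ : ℝ → C(AddCircle M, ℝ), ApproxSol T u U₃ 0 → ApproxSol T v V₃ 0 →
      (∀ t ∈ Set.Icc 0 T, SobLe 4 (u t) (K ^ 2)) → (∀ t ∈ Set.Icc 0 T, SobLe 4 (v t) (K ^ 2)) →
      (∀ t ∈ Set.Icc 0 T, ∀ x, a ≤ u t x) →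
      ∀ t ∈ Set.Icc 0 T, N2 (u t - v t) ^ 2 ≤ C * N2 (u 0 - v 0) ^ 2 := by
  have hM0 : 0 < M := Fact.out
  set P := (1 + M) ^ 3 * ((1 + 3 * M) * K) with hP
  have hP0 : 0 ≤ P := by positivity
  obtain ⟨C, hC, h⟩ := exists_stability M ha (by positivity : 0 < P + P ^ 4 + 1) T
  refine ⟨C, hC, fun u v U₃ V₃ hu hv hus hvs hpos t ht => ?_⟩
  have hP4 : 0 ≤ P ^ 4 := by positivity
  have := h u v U₃ V₃ 0 0 0 hu hv (fun s hs => ?_) t ht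
  · simpa using this
  obtain ⟨u1, u2, d1, d2, d3⟩ := hu.deriv3 s hs
  obtain ⟨v1, v2, k1, k2, k3⟩ := hv.deriv3 s hs
  obtain ⟨b0, b3⟩ := (hus s hs).norm_deriv3_le hK d1 d2 d3
  obtain ⟨c0, c3⟩ := (hvs s hs).norm_deriv3_le hK k1 k2 k3
  rw [← hP] at b0 b3 c0 c3
  refine ⟨hpos s hs, by linarith, by linarith, by linarith, ?_, by simp [N2_zero]⟩
  have h5 : ‖u s ^ 3 * U₃ s‖ ≤ P ^ 3 * P := (norm_mul_le _ _).trans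
    (mul_le_mul ((norm_pow_le _ 3).trans (pow_le_pow_left₀ (norm_nonneg _) b0 3)) b3
      (norm_nonneg _) (by positivity))
  rw [Pi.zero_apply, add_zero]
  linarith [show P ^ 3 * P = P ^ 4 by ring]

/-- Equal initial values make the right side of the `L²` stability estimate vanish. Only the
solution supplying the weight needs a lower bound, so a competitor may have any sign. -/
theorem ApproxSol.eqOn {T a K : ℝ} {u v U₃ V₃ : ℝ → C(AddCircle M, ℝ)} (ha : 0 < a) (hK : 0 ≤ K)
    (hu : ApproxSol T u U₃ 0) (hv : ApproxSol T v V₃ 0)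
    (hus : ∀ t ∈ Set.Icc 0 T, SobLe 4 (u t) (K ^ 2))
    (hvs : ∀ t ∈ Set.Icc 0 T, SobLe 4 (v t) (K ^ 2))
    (hpos : ∀ t ∈ Set.Icc 0 T, ∀ x, a ≤ u t x) (h0 : u 0 = v 0) :
    Set.EqOn u v (Set.Icc 0 T) := fun t ht => by
  obtain ⟨C, hC, h⟩ := exists_stability_exact M ha hK T
  have := h u v U₃ V₃ hu hv hus hvs hpos t ht
  rw [h0, sub_self, N2_zero, zero_pow two_ne_zero, mul_zero] at this
  rw [← sub_eq_zero]
  exact eq_zero_of_N2_eq_zero (pow_eq_zero_iff two_ne_zero |>.1 (le_antisymm this (sq_nonneg _)))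

theorem ApproxSol.pointwise {T : ℝ} {u U₃ : ℝ → C(AddCircle M, ℝ)} (hu : ApproxSol T u U₃ 0) {t : ℝ}
    (ht : t ∈ Set.Icc 0 T) (x : ℝ) : HasDerivWithinAt (fun r => u r (x : AddCircle M))
      ((u t (x : AddCircle M)) ^ 3 * iteratedDeriv 3 (fun y : ℝ => u t (y : AddCircle M)) x)
      (Set.Icc 0 T) t := by
  obtain ⟨u1, u2, d1, d2, d3⟩ := hu.deriv3 t ht
  rw [d1.iteratedDeriv_three d2 d3]
  simpa using hasDerivWithinAt_clm (ContinuousMap.evalCLM ℝ (x : AddCircle M)) (hu.equation t ht)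

/-- A pointwise solution that is bounded in `H⁴` is differentiable as a curve in `C(X)`. -/
theorem exists_approxSol_of_pointwise {T K : ℝ} {u : ℝ → C(AddCircle M, ℝ)} (hK : 0 ≤ K)
    (hus : ∀ t ∈ Set.Icc 0 T, SobLe 4 (u t) (K ^ 2))
    (heq : ∀ t ∈ Set.Icc 0 T, ∀ x : ℝ, HasDerivWithinAt (fun r => u r (x : AddCircle M))
      ((u t (x : AddCircle M)) ^ 3 * iteratedDeriv 3 (fun y : ℝ => u t (y : AddCircle M)) x)
      (Set.Icc 0 T) t) :
    ∃ U₃, ApproxSol T u U₃ 0 := by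
  have hM0 := hM.out
  have hex : ∀ t, ∃ g₁ g₂ g₃ : C(AddCircle M, ℝ), t ∈ Set.Icc 0 T →
      IsDeriv (u t) g₁ ∧ IsDeriv g₁ g₂ ∧ IsDeriv g₂ g₃ := fun t => by
    by_cases ht : t ∈ Set.Icc 0 T
    · obtain ⟨G, hG0, -, hG⟩ := (hus t ht).exists_derivs hK
      exact ⟨G 1, G 2, G 3, fun _ => ⟨hG0 ▸ hG 0 (by norm_num), hG 1 (by norm_num),
        hG 2 (by norm_num)⟩⟩
    · exact ⟨0, 0, 0, fun h => absurd h ht⟩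
  choose U₁ U₂ U₃ hd using hex
  set P := (1 + M) ^ 3 * ((1 + 3 * M) * K) with hP
  have hP0 : 0 ≤ P := by positivity
  have hpt : ∀ t ∈ Set.Icc 0 T, ∀ x : AddCircle M,
      HasDerivWithinAt (fun r => u r x) ((u t ^ 3 * U₃ t) x) (Set.Icc 0 T) t := by
    intro t ht x
    induction x using QuotientAddGroup.induction_on with
    | H x =>
      have := heq t ht x
      rw [(hd t ht).1.iteratedDeriv_three (hd t ht).2.1 (hd t ht).2.2] at this
      exact this
  have hgb : ∀ t ∈ Set.Icc 0 T, ‖u t ^ 3 * U₃ t‖ ≤ P ^ 3 * P := fun t ht => by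
    obtain ⟨d1, d2, d3⟩ := hd t ht
    obtain ⟨b0, b3⟩ := (hus t ht).norm_deriv3_le hK d1 d2 d3
    exact (norm_mul_le _ _).trans
      (mul_le_mul ((norm_pow_le _ 3).trans (pow_le_pow_left₀ (norm_nonneg _) b0 3)) b3
        (norm_nonneg _) (by positivity))
  -- The bounded right-hand side makes `u` Lipschitz in time in the sup norm. With the `H⁴` bound,
  -- interpolation then makes `U₃` continuous in time, which turns the pointwise time derivative
  -- into one in `C(X)`.
  have hlip : ∀ t ∈ Set.Icc 0 T, ∀ s ∈ Set.Icc 0 T, ‖u s - u t‖ ≤ P ^ 3 * P * ‖s - t‖ :=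
    fun t ht s hs => norm_le_of_forall fun x => by
      have := (convex_Icc 0 T).norm_image_sub_le_of_norm_hasDerivWithin_le (C := P ^ 3 * P)
        (fun r hr => hpt r hr x)
        (fun r hr => ((u r ^ 3 * U₃ r).norm_coe_le_norm x).trans (hgb r hr)) ht hs
      simpa using this
  have hcont3 : ContinuousOn u (Set.Icc 0 T) ∧ ContinuousOn U₃ (Set.Icc 0 T) := by
    rw [Metric.continuousOn_iff, Metric.continuousOn_iff, ← forall₂_and]
    intro t ht
    rw [← forall₂_and]
    intro δ hδ
    obtain ⟨θ, hθ, hs⟩ := exists_deriv3_small M (by positivity : 0 ≤ 2 * K) (half_pos hδ)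
    have key : ∀ s ∈ Set.Icc 0 T, dist s t < θ / (P ^ 3 * P + 1) →
        dist (u s) (u t) < δ ∧ dist (U₃ s) (U₃ t) < δ := by
      intro s hs' hst
      rw [dist_eq_norm, lt_div_iff₀ (by positivity)] at hst
      obtain ⟨d1, d2, d3⟩ := hd t ht
      obtain ⟨k1, k2, k3⟩ := hd s hs'
      have hS : SobLe 4 (u s - u t) ((2 * K) ^ 2) := by
        have := (hus s hs').sub (hus t ht)
        rwa [show 2 * (K ^ 2 + K ^ 2) = (2 * K) ^ 2 by ring] at this
      have hN : N2 (u s - u t) ≤ θ := (N2_le_norm _).trans ((hlip t ht s hs').trans (by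
        nlinarith [norm_nonneg (s - t)]))
      obtain ⟨b0, -, -, b3⟩ := hs _ _ _ _ hS hN (k1.sub d1) (k2.sub d2) (k3.sub d3)
      rw [dist_eq_norm, dist_eq_norm]
      exact ⟨b0.trans_lt (half_lt_self hδ), b3.trans_lt (half_lt_self hδ)⟩
    exact ⟨⟨_, by positivity, fun s h1 h2 => (key s h1 h2).1⟩,
      ⟨_, by positivity, fun s h1 h2 => (key s h1 h2).2⟩⟩
  refine ⟨U₃, fun t ht => ⟨U₁ t, U₂ t, hd t ht⟩, fun t ht => ?_⟩
  rw [Pi.zero_apply, add_zero]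
  exact hasDerivWithinAt_of_pointwise (g := fun t => u t ^ 3 * U₃ t) hpt
    ((hcont3.1.pow 3).mul hcont3.2) ht

/-! ### Reversal symmetry and continuity in time with values in `H^n` -/

/-- Reflection `f(x) ↦ f(-x)`. -/
noncomputable def reflect : C(AddCircle M, ℝ) →L[ℝ] C(AddCircle M, ℝ) :=
  ⟨(ContinuousMap.compRightAlgHom ℝ ℝ ⟨Neg.neg, continuous_neg⟩).toLinearMap,
    ContinuousMap.compRightAlgHom_continuous _ _ _⟩

theorem reflect_apply (f : C(AddCircle M, ℝ)) (x : AddCircle M) : reflect f x = f (-x) := rfl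

theorem reflect_reflect (f : C(AddCircle M, ℝ)) : reflect (reflect f) = f := by
  ext x; simp [reflect_apply]

theorem IsDeriv.reflect {f g : C(AddCircle M, ℝ)} (h : IsDeriv f g) :
    IsDeriv (HarryDym.reflect f) (-HarryDym.reflect g) := fun x => by
  have h1 := (h (-x)).comp x (hasDerivAt_neg x)
  rw [mul_neg_one] at h1
  exact h1

theorem cas_neg_apply (k : ℤ) (x : AddCircle M) : cas k (-x) = cas (-k) x := by
  rw [cas_apply, cas_apply, fourier_apply, fourier_apply, smul_neg, neg_smul]

theorem hc_reflect (k : ℤ) (f : C(AddCircle M, ℝ)) : hc k (reflect f) = hc (-k) f := by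
  rw [hc_apply, hc_apply, avg_apply, avg_apply,
    ← integral_neg_eq_self (fun x => (cas (M := M) (-k) * f) x) AddCircle.haarAddCircle]
  refine integral_congr_ae (Filter.Eventually.of_forall fun x => ?_)
  simp only [ContinuousMap.mul_apply, reflect_apply, cas_neg_apply, neg_neg]

theorem SobLe.reflect {n : ℕ} {f : C(AddCircle M, ℝ)} {W : ℝ} (h : SobLe n f W) :
    SobLe n (HarryDym.reflect f) W := fun s => by
  refine le_of_eq_of_le ?_ (h (s.map (Equiv.neg ℤ).toEmbedding))
  rw [Finset.sum_map]
  refine Finset.sum_congr rfl fun k _ => ?_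
  simp [hc_reflect, wn_neg]

theorem ApproxSol.shift_right {T T' t₀ : ℝ} {u U₃ : ℝ → C(AddCircle M, ℝ)}
    (h : ApproxSol T u U₃ 0) (h0 : 0 ≤ t₀) (hT : t₀ + T' ≤ T) :
    ApproxSol T' (fun s => u (t₀ + s)) (fun s => U₃ (t₀ + s)) 0 := by
  have hmaps : Set.MapsTo (fun s => t₀ + s) (Set.Icc 0 T') (Set.Icc 0 T) := fun s hs =>
    ⟨add_nonneg h0 hs.1, by linarith [hs.2]⟩
  refine ⟨fun s hs => h.deriv3 _ (hmaps hs), fun s hs => ?_⟩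
  have := (h.equation _ (hmaps hs)).scomp s ((hasDerivWithinAt_id s _).const_add t₀) hmaps
  rw [one_smul] at this
  exact this

/-- Reversing both `x` and `t` changes the sign of `u_t` and of `u_xxx`, so the equation is
preserved. -/
theorem ApproxSol.shift_left {T T' t₀ : ℝ} {u U₃ : ℝ → C(AddCircle M, ℝ)}
    (h : ApproxSol T u U₃ 0) (h0 : t₀ ≤ T) (hT : T' ≤ t₀) :
    ApproxSol T' (fun s => reflect (u (t₀ - s))) (fun s => -reflect (U₃ (t₀ - s))) 0 := by
  have hmaps : Set.MapsTo (fun s => t₀ - s) (Set.Icc 0 T') (Set.Icc 0 T) := fun s hs =>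
    ⟨by linarith [hs.2], by linarith [hs.1]⟩
  refine ⟨fun s hs => ?_, fun s hs => ?_⟩
  · obtain ⟨u1, u2, d1, d2, d3⟩ := h.deriv3 _ (hmaps hs)
    have : IsDeriv (-reflect u1) (reflect u2) := by simpa using d2.reflect.smul (-1)
    exact ⟨_, _, d1.reflect, this, d3.reflect⟩
  · have := (h.equation _ (hmaps hs)).scomp s ((hasDerivWithinAt_id s _).const_sub t₀) hmaps
    have := hasDerivWithinAt_clm reflect this
    refine this.congr_deriv ?_
    ext x
    simp [reflect_apply]

/-- The solution built by `exists_local` from the data `u t₀` is continuous in `H^n` at its initial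
time, and by uniqueness it coincides with `u` after `t₀`. -/
theorem exists_sobLe_sub_right {n : ℕ} (hn : 4 ≤ n) {T a K t₀ : ℝ} {u U₃ : ℝ → C(AddCircle M, ℝ)}
    (ha : 0 < a) (h : ApproxSol T u U₃ 0) (hs : ∀ t ∈ Set.Icc 0 T, SobLe n (u t) (K ^ 2))
    (hpos : ∀ t ∈ Set.Icc 0 T, ∀ x, a < u t x) (ht₀ : t₀ ∈ Set.Icc 0 T) {θ : ℝ} (hθ : 0 < θ) :
    ∃ τ, 0 < τ ∧ ∀ t ∈ Set.Icc t₀ T, t - t₀ ≤ τ → SobLe n (u t - u t₀) θ := by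
  obtain ⟨T₁, K₁, hT₁, hK₁, hloc⟩ := exists_local M hn ha (K ^ 2)
  obtain ⟨w, W₃, hw0, hw, hwb, hwc⟩ := hloc (u t₀) (hpos t₀ ht₀) (hs t₀ ht₀)
  obtain ⟨τ, hτ, hτc⟩ := hwc θ hθ
  set T' := min T₁ (T - t₀)
  have h1 : T' ≤ T₁ := min_le_left _ _
  have h2 : t₀ + T' ≤ T := by linarith [min_le_right T₁ (T - t₀)]
  have hw' := hw.shift_right (T' := T') le_rfl (by linarith)
  have hu' := h.shift_right ht₀.1 h2
  have heq := hu'.eqOn (a := a) (K := max |K| K₁) ha (le_max_of_le_right hK₁.le) hw'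
    (fun t ht => ((hs _ ⟨add_nonneg ht₀.1 ht.1, by linarith [ht.2]⟩).of_le hn).mono (by
      rw [← sq_abs K]
      exact pow_le_pow_left₀ (abs_nonneg _) (le_max_left _ _) 2))
    (fun t ht => by
      refine ((hwb _ ⟨add_nonneg le_rfl ht.1, by linarith [ht.2]⟩).1.of_le hn).mono ?_
      exact pow_le_pow_left₀ hK₁.le (le_max_right _ _) 2)
    (fun t ht x => (hpos _ ⟨add_nonneg ht₀.1 ht.1, by linarith [ht.2]⟩ x).le)
    (by simp only [add_zero, hw0])
  refine ⟨min τ T₁, by positivity, fun t ht htτ => ?_⟩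
  have hmem : t - t₀ ∈ Set.Icc 0 T' := ⟨by linarith [ht.1],
    le_min (htτ.trans (min_le_right _ _)) (by linarith [ht.2])⟩
  have e := heq hmem
  simp only [zero_add, add_sub_cancel] at e
  rw [e]
  exact hτc _ ⟨hmem.1, hmem.2.trans h1⟩ (htτ.trans (min_le_left _ _))

/-- For the reversed solution started at `t₀`, continuity from the left becomes continuity from the
right at time zero. -/
theorem exists_sobLe_sub_left {n : ℕ} (hn : 4 ≤ n) {T a K t₀ : ℝ} {u U₃ : ℝ → C(AddCircle M, ℝ)}
    (ha : 0 < a) (h : ApproxSol T u U₃ 0) (hs : ∀ t ∈ Set.Icc 0 T, SobLe n (u t) (K ^ 2))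
    (hpos : ∀ t ∈ Set.Icc 0 T, ∀ x, a < u t x) (ht₀ : t₀ ∈ Set.Icc 0 T) {θ : ℝ} (hθ : 0 < θ) :
    ∃ τ, 0 < τ ∧ ∀ t ∈ Set.Icc 0 t₀, t₀ - t ≤ τ → SobLe n (u t - u t₀) θ := by
  have hmem : ∀ s ∈ Set.Icc 0 t₀, t₀ - s ∈ Set.Icc 0 T := fun s hs =>
    ⟨by linarith [hs.2], by linarith [hs.1, ht₀.2]⟩
  obtain ⟨τ, hτ, hc⟩ := exists_sobLe_sub_right hn ha (h.shift_left ht₀.2 le_rfl) (K := K) (t₀ := 0)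
    (fun t ht => (hs _ (hmem t ht)).reflect) (fun t ht x => hpos _ (hmem t ht) (-x))
    ⟨le_rfl, ht₀.1⟩ hθ
  refine ⟨τ, hτ, fun t ht htτ => ?_⟩
  have := (hc (t₀ - t) ⟨by linarith [ht.2], by linarith [ht.1]⟩ (by linarith)).reflect
  simpa [map_sub, reflect_reflect] using this

/-- Solutions that are bounded in the Sobolev space of order `n` are continuous with values in it. -/
theorem exists_sobLe_sub_of_mem {n : ℕ} (hn : 4 ≤ n) {T a K t₀ : ℝ} {u U₃ : ℝ → C(AddCircle M, ℝ)}
    (ha : 0 < a) (h : ApproxSol T u U₃ 0) (hs : ∀ t ∈ Set.Icc 0 T, SobLe n (u t) (K ^ 2))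
    (hpos : ∀ t ∈ Set.Icc 0 T, ∀ x, a < u t x) (ht₀ : t₀ ∈ Set.Icc 0 T) {θ : ℝ} (hθ : 0 < θ) :
    ∃ τ, 0 < τ ∧ ∀ t ∈ Set.Icc 0 T, |t - t₀| ≤ τ → SobLe n (u t - u t₀) θ := by
  obtain ⟨τ₁, hτ₁, h1⟩ := exists_sobLe_sub_right hn ha h hs hpos ht₀ hθ
  obtain ⟨τ₂, hτ₂, h2⟩ := exists_sobLe_sub_left hn ha h hs hpos ht₀ hθ
  refine ⟨min τ₁ τ₂, by positivity, fun t ht htt => ?_⟩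
  rw [abs_le] at htt
  have m1 := min_le_left τ₁ τ₂
  have m2 := min_le_right τ₁ τ₂
  rcases le_total t₀ t with h' | h'
  · exact h1 t ⟨h', ht.2⟩ (by linarith [htt.2])
  · exact h2 t ⟨ht.1, h'⟩ (by linarith [htt.1])

/-! ### Translation to the Sobolev norm of the theorem -/

/-- The weights are even in `k`, so averaging the coefficients at `k` and `-k` leaves the sum
unchanged and no constant is lost. -/
theorem sobolevENorm_le_of_sum_le {s : ℝ} {f : C(AddCircle M, ℝ)} {S : ℝ}
    (h : ∀ F : Finset ℤ, ∑ k ∈ F, (1 + wn M k ^ 2) ^ s * hc k f ^ 2 ≤ S) :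
    sobolevENorm s f ≤ ENNReal.ofReal (Real.sqrt (M * S)) := by
  have hM0 := hM.out
  have hw : ∀ k, 0 ≤ (1 + wn M k ^ 2) ^ s := fun k => Real.rpow_nonneg (by positivity) _
  have hnn : ∀ k, 0 ≤ (1 + wn M k ^ 2) ^ s * hc k f ^ 2 := fun k =>
    mul_nonneg (hw k) (sq_nonneg _)
  have hsum : Summable fun k => (1 + wn M k ^ 2) ^ s * hc k f ^ 2 := summable_of_sum_le hnn h
  have h1 := hsum.hasSum
  set A := ∑' k, (1 + wn M k ^ 2) ^ s * hc k f ^ 2 with hA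
  have hAS : A ≤ S := hasSum_le_of_sum_le h1 h
  have h2 := hasSum_comp_neg h1
  simp only [wn_neg, neg_sq] at h2
  have h3 := ((h1.add h2).mul_left (M / 2))
  rw [show M / 2 * (A + A) = M * A by ring] at h3
  rw [sobolevENorm, Real.sqrt_eq_rpow, ← ENNReal.ofReal_rpow_of_nonneg
    (mul_nonneg hM0.le ((tsum_nonneg hnn).trans hAS)) (by norm_num)]
  refine ENNReal.rpow_le_rpow ?_ (by norm_num)
  refine le_trans (le_of_eq ?_) (ENNReal.ofReal_le_ofReal (mul_le_mul_of_nonneg_left hAS hM0.le))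
  rw [← h3.tsum_eq, ENNReal.ofReal_tsum_of_nonneg _ h3.summable]
  · refine tsum_congr fun k => ?_
    rw [← ofReal_norm, ← ENNReal.ofReal_pow (norm_nonneg _), norm_sq_fourierCoeff, ← wn,
      ← ENNReal.ofReal_mul (mul_nonneg hM0.le (hw k))]
    congr 1
    ring
  · intro k
    have := hw k
    positivity

theorem SobLe.sobolevENorm_le {n : ℕ} {f : C(AddCircle M, ℝ)} {W : ℝ} (h : SobLe n f W) :
    sobolevENorm n f ≤ ENNReal.ofReal (Real.sqrt (M * W)) :=
  sobolevENorm_le_of_sum_le fun F => by simpa only [Real.rpow_natCast] using h F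

/-- The factor `2` comes from keeping only one of the two squares that make up the squared Fourier
coefficient. -/
theorem sobLe_of_sobolevENorm_le {n : ℕ} {f : C(AddCircle M, ℝ)} {δ : ℝ} (hδ : 0 ≤ δ)
    (h : sobolevENorm n f ≤ ENNReal.ofReal δ) : SobLe n f (2 * δ ^ 2 / M) := fun F => by
  have hM0 := hM.out
  have h1 : (∑' k : ℤ, ENNReal.ofReal (M * (1 + (2 * Real.pi * k / M) ^ 2) ^ (n : ℝ)) *
      ‖fourierCoeff (fun x : AddCircle M => (f x : ℂ)) k‖ₑ ^ 2) ≤ ENNReal.ofReal (δ ^ 2) := by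
    have := ENNReal.rpow_le_rpow h (zero_le_two : (0 : ℝ) ≤ 2)
    rw [sobolevENorm, ← ENNReal.rpow_mul, show (1 / 2 : ℝ) * 2 = 1 by norm_num, ENNReal.rpow_one,
      ENNReal.rpow_two, ← ENNReal.ofReal_pow hδ] at this
    exact this
  have h2 : ∀ k : ℤ, ENNReal.ofReal (M / 2 * ((1 + wn M k ^ 2) ^ n * hc k f ^ 2)) ≤
      ENNReal.ofReal (M * (1 + (2 * Real.pi * k / M) ^ 2) ^ (n : ℝ)) *
      ‖fourierCoeff (fun x : AddCircle M => (f x : ℂ)) k‖ₑ ^ 2 := by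
    intro k
    rw [← ofReal_norm, ← ENNReal.ofReal_pow (norm_nonneg _), norm_sq_fourierCoeff,
      Real.rpow_natCast, ← ENNReal.ofReal_mul (by positivity)]
    refine ENNReal.ofReal_le_ofReal ?_
    rw [← wn]
    have : 0 ≤ M * (1 + wn M k ^ 2) ^ n * hc (-k) f ^ 2 := by positivity
    linarith
  have h3 := (Finset.sum_le_sum fun k (_ : k ∈ F) => h2 k).trans
    ((ENNReal.sum_le_tsum F).trans h1)
  rw [← ENNReal.ofReal_sum_of_nonneg (fun k _ => by positivity),
    ENNReal.ofReal_le_ofReal_iff (sq_nonneg δ), ← Finset.mul_sum] at h3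
  rw [le_div_iff₀ hM0]
  linarith

theorem exists_sobLe_of_memSobolev {n : ℕ} {f : C(AddCircle M, ℝ)} (h : MemSobolev n f) :
    ∃ W, SobLe n f W :=
  ⟨_, sobLe_of_sobolevENorm_le ENNReal.toReal_nonneg (ENNReal.ofReal_toReal h.2.ne).ge⟩

theorem SobLe.memSobolev {n : ℕ} {f : C(AddCircle M, ℝ)} {W : ℝ} (h : SobLe n f W) :
    MemSobolev n f :=
  ⟨f.continuous.memLp_of_hasCompactSupport (HasCompactSupport.of_compactSpace _),
    h.sobolevENorm_le.trans_lt ENNReal.ofReal_lt_top⟩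

/-- Splitting at `l = R`: the second term suffices below the threshold, the first above it because
`s - n` is negative. -/
theorem rpow_le_interp {l R : ℝ} (hl : 0 < l) (hR : 0 < R) {n : ℕ} {s : ℝ} (hs : 0 ≤ s)
    (hsn : s < n) : l ^ s ≤ R ^ (s - n) * l ^ n + R ^ s := by
  rcases le_total l R with h | h
  · exact (Real.rpow_le_rpow hl.le h hs).trans (le_add_of_nonneg_left (by positivity))
  · have h1 := Real.rpow_le_rpow_of_nonpos hR h (by linarith : s - n ≤ 0)
    have h2 : l ^ s = l ^ (s - n) * l ^ n := by
      rw [← Real.rpow_natCast l n, ← Real.rpow_add hl, sub_add_cancel]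
    rw [h2]
    refine (mul_le_mul_of_nonneg_right h1 (by positivity)).trans
      (le_add_of_nonneg_right (by positivity))

theorem SobLe.sobolevENorm_le_interp {n : ℕ} {f : C(AddCircle M, ℝ)} {W : ℝ} (h : SobLe n f W)
    {s R : ℝ} (hs : 0 ≤ s) (hsn : s < n) (hR : 0 < R) :
    sobolevENorm s f ≤ ENNReal.ofReal (Real.sqrt (M * (R ^ (s - n) * W + R ^ s * N2 f ^ 2))) := by
  refine sobolevENorm_le_of_sum_le fun F => ?_
  have h1 := mul_le_mul_of_nonneg_left (h F) (by positivity : 0 ≤ R ^ (s - n))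
  have h2 := mul_le_mul_of_nonneg_left
    (sum_le_hasSum F (fun k _ => sq_nonneg _) (hasSum_hc_sq f)) (by positivity : 0 ≤ R ^ s)
  refine le_trans ?_ (add_le_add h1 h2)
  rw [Finset.mul_sum, Finset.mul_sum, ← Finset.sum_add_distrib]
  refine Finset.sum_le_sum fun k _ => ?_
  rw [← mul_assoc, ← add_mul]
  exact mul_le_mul_of_nonneg_right (rpow_le_interp (by positivity) hR hs hsn) (sq_nonneg _)

/-- Smallness in `L²` of functions bounded in the Sobolev space of order `n` gives smallness in
the spaces of lower order. -/
theorem exists_sobolevENorm_le (M : ℝ) [Fact (0 < M)] {n : ℕ} {s W ε : ℝ} (hs : 0 ≤ s) (hsn : s < n)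
    (hε : 0 < ε) :
    ∃ θ, 0 < θ ∧ ∀ f : C(AddCircle M, ℝ), SobLe n f W → N2 f ^ 2 ≤ θ →
      sobolevENorm s f ≤ ENNReal.ofReal ε := by
  have hM0 : 0 < M := Fact.out
  -- Since `s < n`, a large frequency threshold `R` makes the contribution of the order-`n` bound
  -- less than `ε² / 2`; `θ` then takes care of the `L²` part.
  have hlim := (tendsto_rpow_neg_atTop (by linarith : 0 < n - s)).mul_const (M * W)
  rw [zero_mul] at hlim
  obtain ⟨R, hR1, hR⟩ := ((hlim.eventually_lt_const (by positivity : 0 < ε ^ 2 / 2)).and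
    (Filter.eventually_gt_atTop 0)).exists
  rw [neg_sub] at hR1
  refine ⟨ε ^ 2 / 2 / (M * R ^ s), by positivity, fun f hf hN => ?_⟩
  refine (hf.sobolevENorm_le_interp hs hsn hR).trans (ENNReal.ofReal_le_ofReal ?_)
  rw [le_div_iff₀ (by positivity)] at hN
  rw [Real.sqrt_le_left hε.le]
  nlinarith

theorem SobLe.neg {n : ℕ} {f : C(AddCircle M, ℝ)} {W : ℝ} (h : SobLe n f W) : SobLe n (-f) W :=
  h.of_abs_hc_le fun k => by rw [map_neg, abs_neg]

theorem SobLe.of_sub {n : ℕ} {f g : C(AddCircle M, ℝ)} {W W' : ℝ} (h : SobLe n (f - g) W)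
    (hg : SobLe n g W') : SobLe n f (2 * (W + W')) := by
  have := h.sub hg.neg
  rwa [sub_neg_eq_add, sub_add_cancel] at this

/-- Continuity bounds the norm near each time, and compactness of `[0, T]` makes the bound uniform.
This brings an arbitrary competitor under the uniqueness estimate. -/
theorem exists_sobLe_of_continuousIntoSobolev {n : ℕ} {T : ℝ} {u : ℝ → C(AddCircle M, ℝ)}
    (h : ContinuousIntoSobolev n T u) : ∃ K, 0 ≤ K ∧ ∀ t ∈ Set.Icc 0 T, SobLe n (u t) (K ^ 2) := by
  have key : ∃ W, ∀ t ∈ Set.Icc 0 T, SobLe n (u t) W := by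
    refine isCompact_Icc.induction_on (p := fun s => ∃ W, ∀ t ∈ s, SobLe n (u t) W)
      ⟨0, fun t ht => absurd ht (Set.notMem_empty t)⟩ (fun s t hst ⟨W, hW⟩ => ⟨W, fun r hr => hW r (hst hr)⟩)
      (fun s t ⟨W, hW⟩ ⟨W', hW'⟩ => ⟨max W W', fun r hr => ?_⟩) fun t ht => ?_
    · rcases hr with hr | hr
      · exact (hW r hr).mono (le_max_left _ _)
      · exact (hW' r hr).mono (le_max_right _ _)
    · obtain ⟨W, hW⟩ := exists_sobLe_of_memSobolev (h.1 t ht)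
      have hev := (h.2 t ht).eventually_le_const (u := ENNReal.ofReal 1) (by simp)
      refine ⟨_, hev, 2 * (2 * 1 ^ 2 / M + W), fun r hr => ?_⟩
      exact (sobLe_of_sobolevENorm_le zero_le_one hr).of_sub hW
  obtain ⟨W, hW⟩ := key
  refine ⟨Real.sqrt |W|, Real.sqrt_nonneg _, fun t ht => (hW t ht).mono ?_⟩
  rw [Real.sq_sqrt (abs_nonneg _)]
  exact le_abs_self W

theorem continuousIntoSobolev_of_sobLe {n : ℕ} {T : ℝ} {u : ℝ → C(AddCircle M, ℝ)}
    (hb : ∀ t ∈ Set.Icc 0 T, ∃ W, SobLe n (u t) W)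
    (h : ∀ t₀ ∈ Set.Icc 0 T, ∀ θ, 0 < θ → ∃ τ, 0 < τ ∧ ∀ t ∈ Set.Icc 0 T, |t - t₀| ≤ τ →
      SobLe n (u t - u t₀) θ) : ContinuousIntoSobolev n T u := by
  have hM0 := hM.out
  refine ⟨fun t ht => (hb t ht).elim fun W hW => hW.memSobolev, fun t₀ ht₀ => ?_⟩
  refine ENNReal.tendsto_nhds_zero.2 fun ε hε => ?_
  rcases eq_or_ne ε ∞ with rfl | hε'
  · exact Filter.Eventually.of_forall fun _ => le_top
  have hpos := ENNReal.toReal_pos hε.ne' hε'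
  obtain ⟨τ, hτ, hc⟩ := h t₀ ht₀ (ε.toReal ^ 2 / M) (by positivity)
  filter_upwards [self_mem_nhdsWithin, nhdsWithin_le_nhds (Metric.closedBall_mem_nhds t₀ hτ)]
    with t ht htτ
  refine (hc t ht htτ).sobolevENorm_le.trans ?_
  rw [mul_div_cancel₀ _ hM0.ne', Real.sqrt_sq hpos.le, ENNReal.ofReal_toReal hε']

theorem exists_approxSol_of_isHarryDymSolution {n : ℕ} (hn : 4 ≤ n) {T : ℝ} {u₀ : C(AddCircle M, ℝ)}
    {u : ℝ → C(AddCircle M, ℝ)} (h : IsHarryDymSolution n T u₀ u) :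
    ∃ K U₃, 0 ≤ K ∧ ApproxSol T u U₃ 0 ∧ ∀ t ∈ Set.Icc 0 T, SobLe n (u t) (K ^ 2) := by
  obtain ⟨K, hK, hb⟩ := exists_sobLe_of_continuousIntoSobolev h.continuousInto
  obtain ⟨U₃, hU⟩ := exists_approxSol_of_pointwise hK (fun t ht => (hb t ht).of_le hn) h.equation
  exact ⟨K, U₃, hK, hU, hb⟩

theorem eqOn_of_isHarryDymSolution {n : ℕ} (hn : 4 ≤ n) {T a : ℝ} {u₀ : C(AddCircle M, ℝ)}
    {u v : ℝ → C(AddCircle M, ℝ)} (hu : IsHarryDymSolution n T u₀ u)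
    (hv : IsHarryDymSolution n T u₀ v) (ha : 0 < a) (hpos : ∀ t ∈ Set.Icc 0 T, ∀ x, a ≤ u t x) :
    Set.EqOn v u (Set.Icc 0 T) := by
  obtain ⟨K, U₃, hK, hU, hb⟩ := exists_approxSol_of_isHarryDymSolution hn hu
  obtain ⟨K', V₃, hK', hV, hb'⟩ := exists_approxSol_of_isHarryDymSolution hn hv
  refine (hU.eqOn (K := max K K') ha (le_max_of_le_left hK) hV (fun t ht => ?_) (fun t ht => ?_) hpos
    (hu.initial.trans hv.initial.symm)).symm
  · exact ((hb t ht).of_le hn).mono (pow_le_pow_left₀ hK (le_max_left _ _) 2)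
  · exact ((hb' t ht).of_le hn).mono (pow_le_pow_left₀ hK' (le_max_right _ _) 2)

theorem ApproxSol.isHarryDymSolution {n : ℕ} (hn : 4 ≤ n) {T a K : ℝ} {u U₃ : ℝ → C(AddCircle M, ℝ)}
    (ha : 0 < a) (hu : ApproxSol T u U₃ 0) (hb : ∀ t ∈ Set.Icc 0 T, SobLe n (u t) (K ^ 2))
    (hpos : ∀ t ∈ Set.Icc 0 T, ∀ x, a < u t x) : IsHarryDymSolution n T (u 0) u where
  continuousInto := continuousIntoSobolev_of_sobLe (fun t ht => ⟨_, hb t ht⟩) fun _ ht₀ _ hθ =>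
    exists_sobLe_sub_of_mem hn ha hu hb hpos ht₀ hθ
  initial := rfl
  equation := fun _ ht x => hu.pointwise ht x

end HarryDym

open HarryDym

/-! ### Well-posedness of the Harry Dym equation -/

theorem theorem4p1 (M : ℝ) [Fact (0 < M)] (n : ℕ) (hn : 4 ≤ n) (a₀ : ℝ) (ha₀ : 0 < a₀)
    (u₀ : C(AddCircle M, ℝ)) (hu₀ : MemSobolev n u₀) (hpos : ∀ x, a₀ < u₀ x) :
    ∃ T : ℝ, 0 < T ∧ ∃ u : ℝ → C(AddCircle M, ℝ),
      IsHarryDymSolution n T u₀ u ∧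
      (∀ t ∈ Set.Icc 0 T, ∀ x, a₀ / 2 < u t x) ∧
      (∀ u' : ℝ → C(AddCircle M, ℝ), IsHarryDymSolution n T u₀ u' →
        Set.EqOn u' u (Set.Icc 0 T)) ∧
      ∀ n' : ℝ, 0 ≤ n' → n' < n → ∀ ε : ℝ, 0 < ε → ∃ δ : ℝ, 0 < δ ∧
        ∀ v₀ : C(AddCircle M, ℝ), MemSobolev n v₀ → (∀ x, a₀ < v₀ x) →
          sobolevENorm n (v₀ - u₀) ≤ ENNReal.ofReal δ →
          ∃ v : ℝ → C(AddCircle M, ℝ),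
            IsHarryDymSolution n T v₀ v ∧
            (∀ v' : ℝ → C(AddCircle M, ℝ), IsHarryDymSolution n T v₀ v' →
              Set.EqOn v' v (Set.Icc 0 T)) ∧
            (⨆ t ∈ Set.Icc 0 T, sobolevENorm n' (u t - v t)) < ENNReal.ofReal ε := by
  have hM0 : 0 < M := Fact.out
  obtain ⟨W, hW⟩ := exists_sobLe_of_memSobolev hu₀
  have hW0 := hW.nonneg
  -- The size `2 * (2 * 1 ^ 2 / M + W)` covers all data at `H^n` distance at most `1` from `u₀`, so
  -- a single `T` serves them all, fixed before `n'` and `ε`.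
  obtain ⟨T, K, hT, hK, hloc⟩ := exists_local M hn ha₀ (2 * (2 * 1 ^ 2 / M + W))
  have hsolve : ∀ w₀ : C(AddCircle M, ℝ), (∀ x, a₀ < w₀ x) →
      SobLe n w₀ (2 * (2 * 1 ^ 2 / M + W)) → ∃ w W₃ : ℝ → C(AddCircle M, ℝ), ApproxSol T w W₃ 0 ∧
        (∀ t ∈ Set.Icc 0 T, SobLe n (w t) (K ^ 2)) ∧ (∀ t ∈ Set.Icc 0 T, ∀ x, a₀ / 2 < w t x) ∧
        IsHarryDymSolution n T w₀ w := fun w₀ h1 h2 => by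
    obtain ⟨w, W₃, hw0, hw, hb, -⟩ := hloc w₀ h1 h2
    have hp : ∀ t ∈ Set.Icc 0 T, ∀ x, a₀ / 2 < w t x := fun t ht x =>
      lt_of_lt_of_le (by linarith) ((hb t ht).2 x)
    exact ⟨w, W₃, hw, fun t ht => (hb t ht).1, hp,
      hw0 ▸ hw.isHarryDymSolution hn (half_pos ha₀) (fun t ht => (hb t ht).1) hp⟩
  have hMW : 0 ≤ 2 * 1 ^ 2 / M := by positivity
  obtain ⟨u, U₃, hu, hub, hup, hus⟩ := hsolve u₀ hpos (hW.mono (by linarith))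
  refine ⟨T, hT, u, hus, hup, fun u' hu' =>
    eqOn_of_isHarryDymSolution hn hus hu' (half_pos ha₀) fun t ht x => (hup t ht x).le, fun n' hn'0 hn' ε hε => ?_⟩
  obtain ⟨θ, hθ, hsmall⟩ := exists_sobolevENorm_le M (n := n) (W := 2 * (K ^ 2 + K ^ 2)) hn'0 hn'
    (half_pos hε)
  obtain ⟨C, hC, hstab⟩ := exists_stability_exact M (half_pos ha₀) hK.le T
  -- The first condition gives `δ ≤ 1`, so that the common `T` applies; the second brings the `L²`
  -- stability bound below the interpolation threshold `θ`.
  obtain ⟨δ, hδ, hδ1, hδθ, -⟩ := exists_small_time 1 (C * (2 / M)) 0 one_pos hθ one_pos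
  refine ⟨δ, hδ, fun v₀ _ hv₀p hv₀δ => ?_⟩
  have hd : SobLe n (v₀ - u₀) (2 * δ ^ 2 / M) := sobLe_of_sobolevENorm_le hδ.le hv₀δ
  have hd1 : 2 * δ ^ 2 / M ≤ 2 * 1 ^ 2 / M := by
    have : δ ≤ 1 := by linarith
    gcongr
  obtain ⟨v, V₃, hv, hvb, hvp, hvs⟩ := hsolve v₀ hv₀p ((hd.mono hd1).of_sub hW)
  refine ⟨v, hvs, fun v' hv' =>
    eqOn_of_isHarryDymSolution hn hvs hv' (half_pos ha₀) fun t ht x => (hvp t ht x).le, ?_⟩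
  refine lt_of_le_of_lt (iSup₂_le fun t ht => ?_)
    ((ENNReal.ofReal_lt_ofReal_iff hε).2 (half_lt_self hε))
  refine hsmall (u t - v t) ((hub t ht).sub (hvb t ht)) ?_
  refine (hstab u v U₃ V₃ hu hv (fun s hs => (hub s hs).of_le hn)
    (fun s hs => (hvb s hs).of_le hn) (fun s hs x => (hup s hs x).le) t ht).trans ?_
  rw [hus.initial, hvs.initial, N2_sub_comm]
  calc C * N2 (v₀ - u₀) ^ 2 ≤ C * (2 * δ ^ 2 / M) := mul_le_mul_of_nonneg_left hd.N2_le hC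
    _ = C * (2 / M) * δ ^ 2 := by ring
    _ ≤ θ := hδθ
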